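/- Let $k$ be a field. All algebras are associative $k$-algebras, not necessarily unital, with nondegenerate product; $M(X)$ denotes the multiplier algebra of $X$. Let $Q$ and $L$ be regular multiplier Hopf algebras (algebras with local units, with comultiplications $\Delta:Q\to M(Q\otimes Q)$, $\Delta:L\to M(L\otimes L)$; regular means that the flipped comultiplication also gives a multiplier Hopf algebra). Let $A$ be a (unital) left $Q$-module algebra with action $\rhd$, let $B$ be a (unital) right $L$-module algebra with action $\lhd$, and let $C$ be a $Q$-$L$-bicomodule algebra with commuting injective coactions $\Gamma:C\to M(Q\otimes C)$, $\Gamma(c)=\sum c_{(-1)}\otimes c_0$, and $\Upsilon:C\to M(C\otimes L)$, $\Upsilon(c)=\sum c_0\otimes c_{(1)}$, for which $\Gamma(c)(x\otimes 1),(x\otimes 1)\Gamma(c)\in Q\otimes C$ and $\Upsilon(c)(1\otimes y),(1\otimes y)\Upsilon(c)\in C\otimes L$. Let $A\bowtie_l^Q C\bowtie_r^L B$ be the space $A\otimes C\otimes B$ with the product $$(a\bowtie c\bowtie b)(a'\bowtie c'\bowtie b')=\sum a(c_{(-1)}\rhd a')\bowtie c_0c'_0\bowtie (b\lhd c'_{(1)})b'.$$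 For a $Q$-$L$-bimodule algebra $D$ and for $d,d'\in D$, $c,c'\in C$ define products on $D\otimes C$ and on $C\otimes D$ by $$(d\diamond c)(d'\diamond c')=\sum (d\lhd c'_{(1)})(c_{(-1)}\rhd d')\diamond c_0c'_0\quad (D\diamond_l C),$$ $$(c\diamond d)(c'\diamond d')=\sum c_0c'_0\diamond (d\lhd c'_{(1)})(c_{(-1)}\rhd d')\quad (C\diamond_r D),$$ $$(d\star c)(d'\star c')=\sum d\,(c_{(-1)}\rhd d'\lhd S^{-1}(c_{(1)}))\star c_0c'\quad (D\star_l C),$$ $$(c\star d)(c'\star d')=\sum cc'_0\star (S^{-1}(c'_{(-1)})\rhd d\lhd c'_{(1)})\,d'\quad (C\star_r D),$$ where $S$ is the antipode of $L$, respectively of $Q$ (it exists and is bijective by regularity). The space $A\otimes B$ with the tensor product algebra structure is regarded as a $Q$-$L$-bimodule algebra through $x\rhd(a\otimes b)\lhd y=(x\rhd a)\otimes(b\lhd y)$. The smash products are $A\#_l C=A\otimes C$ with $(a\# c)(a'\# c')=\sum a(c_{(-1)}\rhd a')\# c_0c'$ and $C\#_r B=C\otimes B$ with $(c\# b)(c'\#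 b')=\sum cc'_0\#(b\lhd c'_{(1)})b'$. Then $A\bowtie_l^Q C\bowtie_r^L B$ is an associative algebra, and: (1) $\Phi:(A\otimes B)\diamond_l C\to A\bowtie_l^Q C\bowtie_r^L B$, $\Phi((a\otimes b)\diamond c)=a\bowtie c\bowtie b$, is an algebra isomorphism. (2) $\Psi: C\diamond_r(A\otimes B)\to A\bowtie_l^Q C\bowtie_r^L B$, $\Psi(c\diamond(a\otimes b))=a\bowtie c\bowtie b$, is an algebra isomorphism. (3) There are algebra isomorphisms $(A\otimes B)\star_l C\cong (A\otimes B)\diamond_l C\cong C\diamond_r(A\otimes B)\cong C\star_r(A\otimes B)$. (4) $A\#_l C$ is a right $L$-comodule algebra with $a\# c\mapsto\sum (a\# c_0)\otimes c_{(1)}$, $C\#_r B$ is a left $Q$-comodule algebra with $c\# b\mapsto\sum c_{(-1)}\otimes(c_0\# b)$, and, under the trivial identification of the underlying spaces, $(A\#_l C)\#_r B=A\#_l(C\#_r B)=A\bowtie_l^Q C\bowtie_r^L B$. -/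

import Mathlib

open TensorProduct

namespace MultHopf

noncomputable section

/-! ### Algebras without unit and their multiplier algebras -/

/-- The product of `A` is nondegenerate. -/
def NondegenerateProduct (A : Type*) [NonUnitalNonAssocRing A] : Prop :=
  (∀ a : A, (∀ b : A, a * b = 0) → a = 0) ∧ (∀ a : A, (∀ b : A, b * a = 0) → a = 0)

/-- `A` has local units: every finite subset has a common left unit and a common right unit. -/
def HasLocalUnits (A : Type*) [NonUnitalNonAssocRing A] : Prop :=
  ∀ s : Finset A, ∃ e f : A, ∀ a ∈ s, e * a = a ∧ a * f = a

/-- The multiplier algebra `M(A)`: pairs `m = (m₁, m₂)` of linear endomorphisms of `A` with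
`m₂(a) b = a m₁(b)`, where `m₁(a)` is `m a` and `m₂(a)` is `a m`. Multiplication of multipliers is
composition in the first component and reversed composition in the second. -/
def Multiplier (k A : Type*) [Field k] [NonUnitalNonAssocRing A] [Module k A]
    [SMulCommClass k A A] [IsScalarTower k A A] :
    Subalgebra k (Module.End k A × (Module.End k A)ᵐᵒᵖ) where
  carrier := {m | ∀ a b : A, m.2.unop a * b = a * m.1 b}
  mul_mem' := by
    intro m n hm hn a b
    simp only [Set.mem_ofPred_eq] at hm hn
    simp [hm, hn]
  add_mem' := by
    intro m n hm hn a b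
    simp only [Set.mem_ofPred_eq] at hm hn
    simp [hm, hn, add_mul, mul_add]
  algebraMap_mem' := by
    intro r a b
    simp [Algebra.algebraMap_eq_smul_one, smul_mul_assoc, mul_smul_comm]

namespace Multiplier

variable {k A : Type*} [Field k] [NonUnitalNonAssocRing A] [Module k A]
    [SMulCommClass k A A] [IsScalarTower k A A]

/-- `a ↦ m a`. -/
def left (m : Multiplier k A) : A →ₗ[k] A := m.1.1

/-- `a ↦ a m`. -/
def right (m : Multiplier k A) : A →ₗ[k] A := m.1.2.unop

theorem right_mul (m : Multiplier k A) (a b : A) : right m a * b = a * left m b := m.2 a b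

end Multiplier

/-! ### Multiplication on one tensor leg -/

section Legs

variable {k : Type*} [Field k]
variable {X Y : Type*}
  [NonUnitalNonAssocRing X] [Module k X] [SMulCommClass k X X] [IsScalarTower k X X]
  [NonUnitalNonAssocRing Y] [Module k Y] [SMulCommClass k Y Y] [IsScalarTower k Y Y]

/-- `u ↦ (x ⊗ 1) u` on `X ⊗ Y`. -/
def fstMul (x : X) : X ⊗[k] Y →ₗ[k] X ⊗[k] Y := LinearMap.rTensor Y (LinearMap.mul k X x)

/-- `u ↦ u (x ⊗ 1)` on `X ⊗ Y`. -/
def mulFst (x : X) : X ⊗[k] Y →ₗ[k] X ⊗[k] Y := LinearMap.rTensor Y ((LinearMap.mul k X).flip x)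

/-- `u ↦ (1 ⊗ y) u` on `X ⊗ Y`. -/
def sndMul (y : Y) : X ⊗[k] Y →ₗ[k] X ⊗[k] Y := LinearMap.lTensor X (LinearMap.mul k Y y)

/-- `u ↦ u (1 ⊗ y)` on `X ⊗ Y`. -/
def mulSnd (y : Y) : X ⊗[k] Y →ₗ[k] X ⊗[k] Y := LinearMap.lTensor X ((LinearMap.mul k Y).flip y)

end Legs

/-! ### Multiplier Hopf algebras -/

/-- A multiplier Hopf algebra structure on an algebra `Q` with local units (hence with
nondegenerate product): a homomorphism `Δ : Q → M(Q ⊗ Q)` such that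
`T₁(x ⊗ y) = Δ(x)(1 ⊗ y)` and `T₂(x ⊗ y) = (x ⊗ 1)Δ(y)` lie in `Q ⊗ Q`, which is coassociative, and
for which `T₁` and `T₂` are bijective. The two `spec` fields say that the multipliers
`Δ(x)(1 ⊗ y)` and `(x ⊗ 1)Δ(y)` are the elements `T₁(x ⊗ y)`, `T₂(x ⊗ y)` of `Q ⊗ Q`. -/
structure MultiplierHopfAlgebra (k Q : Type*) [Field k] [NonUnitalRing Q] [Module k Q]
    [SMulCommClass k Q Q] [IsScalarTower k Q Q] where
  localUnits : HasLocalUnits Q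
  comul : Q →ₙₐ[k] Multiplier k (Q ⊗[k] Q)
  T₁ : Q ⊗[k] Q ≃ₗ[k] Q ⊗[k] Q
  T₂ : Q ⊗[k] Q ≃ₗ[k] Q ⊗[k] Q
  T₁_spec : ∀ (x y : Q) (u : Q ⊗[k] Q), Multiplier.left (comul x) (sndMul y u) = T₁ (x ⊗ₜ y) * u
  T₂_spec : ∀ (x y : Q) (u : Q ⊗[k] Q), Multiplier.right (comul y) (mulFst x u) = u * T₂ (x ⊗ₜ y)
  coassoc : ∀ x y z : Q,
    TensorProduct.assoc k Q Q Q
        (LinearMap.rTensor Q T₂.toLinearMap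
          ((TensorProduct.assoc k Q Q Q).symm (x ⊗ₜ[k] T₁ (y ⊗ₜ[k] z)))) =
      LinearMap.lTensor Q T₁.toLinearMap
        (TensorProduct.assoc k Q Q Q (T₂ (x ⊗ₜ[k] y) ⊗ₜ[k] z))

section Hopf

variable {k Q : Type*} [Field k] [NonUnitalRing Q] [Module k Q]
    [SMulCommClass k Q Q] [IsScalarTower k Q Q]

/-- `(Q, Δ)` is regular: `Q` with the flipped comultiplication `τΔ` is again a multiplier Hopf
algebra. -/
def MultiplierHopfAlgebra.IsRegular (H : MultiplierHopfAlgebra k Q) : Prop :=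
  ∃ H' : MultiplierHopfAlgebra k Q, ∀ (x : Q) (u : Q ⊗[k] Q),
    Multiplier.left (H'.comul x) u =
        TensorProduct.comm k Q Q (Multiplier.left (H.comul x) (TensorProduct.comm k Q Q u)) ∧
    Multiplier.right (H'.comul x) u =
        TensorProduct.comm k Q Q (Multiplier.right (H.comul x) (TensorProduct.comm k Q Q u))

/-- A (bijective) antipode with values in `Q` of a multiplier Hopf algebra: a bijective
anti-homomorphism `S` such that, with the counit `ε`,
`m(S ⊗ ι)(Δ(a)(1 ⊗ b)) = ε(a) b` and `m(ι ⊗ S)((a ⊗ 1)Δ(b)) = ε(b) a`. -/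
structure Antipode (H : MultiplierHopfAlgebra k Q) where
  S : Q ≃ₗ[k] Q
  counit : Q →ₗ[k] k
  counit_left : ∀ a b : Q,
    TensorProduct.lid k Q (LinearMap.rTensor Q counit (H.T₁ (a ⊗ₜ b))) = a * b
  counit_right : ∀ a b : Q,
    TensorProduct.rid k Q (LinearMap.lTensor Q counit (H.T₂ (a ⊗ₜ b))) = a * b
  map_mul : ∀ a b : Q, S (a * b) = S b * S a
  antipode_left : ∀ a b : Q,
    LinearMap.mul' k Q (LinearMap.rTensor Q S.toLinearMap (H.T₁ (a ⊗ₜ b))) = counit a • b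
  antipode_right : ∀ a b : Q,
    LinearMap.mul' k Q (LinearMap.lTensor Q S.toLinearMap (H.T₂ (a ⊗ₜ b))) = counit b • a

end Hopf

/-! ### Module algebras -/

section ModuleAlgebras

variable {k Q L : Type*} [Field k]
  [NonUnitalRing Q] [Module k Q] [SMulCommClass k Q Q] [IsScalarTower k Q Q]
  [NonUnitalRing L] [Module k L] [SMulCommClass k L L] [IsScalarTower k L L]

/-- A left `Q`-module algebra structure on `A`. Here `act x a` is `x ▷ a`; the action is unital
(`Q ▷ A = A`) and `x ▷ (a a') = ∑ (x₁ ▷ a)(x₂ ▷ a')`, where `x₂` is covered by writing `a'` as a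
combination of elements `z ▷ a'`, so that `Δ(x)(1 ⊗ z) = T₁(x ⊗ z)` enters. -/
structure LeftModuleAlgebra (H : MultiplierHopfAlgebra k Q) (A : Type*)
    [NonUnitalNonAssocRing A] [Module k A] [SMulCommClass k A A] [IsScalarTower k A A] where
  act : Q →ₗ[k] A →ₗ[k] A
  mul_act : ∀ (x y : Q) (a : A), act (x * y) a = act x (act y a)
  unital : Submodule.span k {b : A | ∃ (x : Q) (a : A), act x a = b} = ⊤
  act_mul : ∀ (x z : Q) (a a' : A),
    act x (a * act z a') =
      LinearMap.mul' k A (TensorProduct.map (act.flip a) (act.flip a') (H.T₁ (x ⊗ₜ z)))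

/-- A right `L`-module algebra structure on `B`. Here `act x b` is `b ◁ x`; the action is unital and
`(b b') ◁ x = ∑ (b ◁ x₁)(b' ◁ x₂)`, where `x₁` is covered by writing `b` as a combination of elements
`b ◁ z`, so that `(z ⊗ 1)Δ(x) = T₂(z ⊗ x)` enters. -/
structure RightModuleAlgebra (H : MultiplierHopfAlgebra k L) (B : Type*)
    [NonUnitalNonAssocRing B] [Module k B] [SMulCommClass k B B] [IsScalarTower k B B] where
  act : L →ₗ[k] B →ₗ[k] B
  mul_act : ∀ (x y : L) (b : B), act (x * y) b = act y (act x b)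
  unital : Submodule.span k {c : B | ∃ (x : L) (b : B), act x b = c} = ⊤
  act_mul : ∀ (x z : L) (b b' : B),
    act x (act z b * b') =
      LinearMap.mul' k B (TensorProduct.map (act.flip b) (act.flip b') (H.T₂ (z ⊗ₜ x)))

/-- A `Q`-`L`-bimodule algebra. -/
structure BimoduleAlgebra (HQ : MultiplierHopfAlgebra k Q) (HL : MultiplierHopfAlgebra k L)
    (D : Type*) [NonUnitalNonAssocRing D] [Module k D] [SMulCommClass k D D]
    [IsScalarTower k D D] where
  left : LeftModuleAlgebra HQ D
  right : RightModuleAlgebra HL D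
  act_comm : ∀ (x : Q) (y : L) (d : D), right.act y (left.act x d) = left.act x (right.act y d)

/-! ### Comodule algebras -/

/-- A left `Q`-comodule algebra structure on an associative algebra `C` with nondegenerate product:
an injective homomorphism `Γ : C → M(Q ⊗ C)` such that `Γ(c)(x ⊗ 1)` and `(x ⊗ 1)Γ(c)` lie in
`Q ⊗ C` and `(ι ⊗ Γ)Γ = (Δ ⊗ ι)Γ`. The elements `Γ(c)(x ⊗ 1)` and `(x ⊗ 1)Γ(c)` of `Q ⊗ C` are
`covR x c` and `covL x c`; as the product of `Q ⊗ C` is nondegenerate they are determined by `Γ`.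
Coassociativity is the equality of multipliers of `Q ⊗ Q ⊗ C`, tested after right multiplication by
`Δ(p)(1 ⊗ y) ⊗ 1`: the elements `u ⊗ v ⊗ 1` with `u ⊗ v = Δ(p)(1 ⊗ y)` cover `(ι ⊗ Γ)Γ(c)`, and
`(Δ ⊗ ι)(Γ(c))(Δ(p)(1 ⊗ y) ⊗ 1) = (Δ ⊗ ι)(Γ(c)(p ⊗ 1))(1 ⊗ y ⊗ 1)`. As `T₁` is bijective, these are
all elements of `Q ⊗ Q ⊗ 1`. -/
structure LeftComoduleAlgebra (H : MultiplierHopfAlgebra k Q) (C : Type*)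
    [NonUnitalNonAssocRing C] [Module k C] [SMulCommClass k C C] [IsScalarTower k C C] where
  assoc : ∀ a b c : C, a * b * c = a * (b * c)
  nondeg : NondegenerateProduct C
  coact : C →ₙₐ[k] Multiplier k (Q ⊗[k] C)
  injective : Function.Injective coact
  covR : Q →ₗ[k] C →ₗ[k] Q ⊗[k] C
  covL : Q →ₗ[k] C →ₗ[k] Q ⊗[k] C
  covR_spec : ∀ (x : Q) (c : C) (u : Q ⊗[k] C), Multiplier.left (coact c) (fstMul x u) = covR x c * u
  covL_spec : ∀ (x : Q) (c : C) (u : Q ⊗[k] C), Multiplier.right (coact c) (mulFst x u) = u * covL x c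
  coassoc : ∀ (p y : Q) (c : C),
    TensorProduct.lift
        ((LinearMap.lTensorHom Q ∘ₗ covR).flip ∘ₗ covR.flip c) (H.T₁ (p ⊗ₜ y)) =
      TensorProduct.assoc k Q Q C
        (LinearMap.rTensor C (H.T₁.toLinearMap ∘ₗ (TensorProduct.mk k Q Q).flip y) (covR p c))

/-- A right `L`-comodule algebra structure on an associative algebra `C` with nondegenerate product:
an injective homomorphism `Υ : C → M(C ⊗ L)` such that `Υ(c)(1 ⊗ x) = covR x c` and
`(1 ⊗ x)Υ(c) = covL x c` lie in `C ⊗ L` and `(Υ ⊗ ι)Υ = (ι ⊗ Δ)Υ`; the latter is tested after left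
multiplication by `1 ⊗ (y ⊗ 1)Δ(p)`. -/
structure RightComoduleAlgebra (H : MultiplierHopfAlgebra k L) (C : Type*)
    [NonUnitalNonAssocRing C] [Module k C] [SMulCommClass k C C] [IsScalarTower k C C] where
  assoc : ∀ a b c : C, a * b * c = a * (b * c)
  nondeg : NondegenerateProduct C
  coact : C →ₙₐ[k] Multiplier k (C ⊗[k] L)
  injective : Function.Injective coact
  covR : L →ₗ[k] C →ₗ[k] C ⊗[k] L
  covL : L →ₗ[k] C →ₗ[k] C ⊗[k] L
  covR_spec : ∀ (x : L) (c : C) (u : C ⊗[k] L), Multiplier.left (coact c) (sndMul x u) = covR x c * u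
  covL_spec : ∀ (x : L) (c : C) (u : C ⊗[k] L), Multiplier.right (coact c) (mulSnd x u) = u * covL x c
  coassoc : ∀ (p y : L) (c : C),
    TensorProduct.assoc k C L L
        (TensorProduct.lift
          ((LinearMap.rTensorHom L ∘ₗ covL).compl₂ (covL.flip c)) (H.T₂ (y ⊗ₜ p))) =
      LinearMap.lTensor C (H.T₂.toLinearMap ∘ₗ TensorProduct.mk k L L y) (covL p c)

/-- A `Q`-`L`-bicomodule algebra: the coactions satisfy
`(1 ⊗ 1 ⊗ x)((ι ⊗ Υ)(Γ(c)(y ⊗ 1))) = ((Γ ⊗ ι)((1 ⊗ x)Υ(c)))(y ⊗ 1 ⊗ 1)`. -/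
structure BicomoduleAlgebra (HQ : MultiplierHopfAlgebra k Q) (HL : MultiplierHopfAlgebra k L)
    (C : Type*) [NonUnitalNonAssocRing C] [Module k C] [SMulCommClass k C C]
    [IsScalarTower k C C] where
  left : LeftComoduleAlgebra HQ C
  right : RightComoduleAlgebra HL C
  coact_comm : ∀ (x : L) (y : Q) (c : C),
    LinearMap.lTensor Q (right.covL x) (left.covR y c) =
      TensorProduct.assoc k Q C L (LinearMap.rTensor L (left.covR y) (right.covL x c))

end ModuleAlgebras

/-! ### Twisting maps -/

section Twists

variable {k : Type*} [Field k]

/-- In `Q ⊗ C`, where `Q` has local units and `C` has a nondegenerate product, an element `t` with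
`v (t u) = 0` for all `u`, `v` is zero. -/
theorem eq_zero_of_mul_mul {Q C : Type*}
    [NonUnitalRing Q] [Module k Q] [SMulCommClass k Q Q] [IsScalarTower k Q Q]
    [NonUnitalNonAssocRing C] [Module k C] [SMulCommClass k C C] [IsScalarTower k C C]
    (hQ : HasLocalUnits Q) (hC : NondegenerateProduct C)
    (t : Q ⊗[k] C) (h : ∀ u v : Q ⊗[k] C, v * (t * u) = 0) : t = 0 := by
  classical
  have key : ∀ t : Q ⊗[k] C, ∃ s : Finset Q, ∀ p q : Q, (∀ a ∈ s, p * a = a ∧ a * q = a) →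
      ∀ d d' : C, (p ⊗ₜ[k] d) * (t * (q ⊗ₜ[k] d')) =
        LinearMap.lTensor Q (LinearMap.mul k C d ∘ₗ (LinearMap.mul k C).flip d') t := by
    intro t
    induction t using TensorProduct.induction_on with
    | zero => exact ⟨∅, fun p q _ d d' => by simp⟩
    | tmul a c =>
      refine ⟨{a}, fun p q hpq d d' => ?_⟩
      have := hpq a (by simp)
      simp [this.1, this.2]
    | add x y hx hy =>
      obtain ⟨s, hs⟩ := hx
      obtain ⟨s', hs'⟩ := hy
      refine ⟨s ∪ s', fun p q hpq d d' => ?_⟩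
      rw [add_mul, mul_add, hs p q (fun a ha => hpq a (by simp [ha])),
        hs' p q (fun a ha => hpq a (by simp [ha])), map_add]
  obtain ⟨s, hs⟩ := key t
  obtain ⟨p, q, hpq⟩ := hQ s
  have h0 : ∀ d d' : C,
      LinearMap.lTensor Q (LinearMap.mul k C d ∘ₗ (LinearMap.mul k C).flip d') t = 0 := by
    intro d d'
    rw [← hs p q hpq d d', h]
  let b := Module.Basis.ofVectorSpace k Q
  apply (TensorProduct.equivFinsuppOfBasisLeft b (N := C)).injective
  ext i
  rw [map_zero, TensorProduct.equivFinsuppOfBasisLeft_apply, Finsupp.coe_zero, Pi.zero_apply]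
  apply hC.1
  intro d'
  apply hC.2
  intro d
  have h1 : ∀ t : Q ⊗[k] C,
      d * (TensorProduct.lid k C ((b.coord i).rTensor C t) * d') =
      TensorProduct.lid k C ((b.coord i).rTensor C
        (LinearMap.lTensor Q (LinearMap.mul k C d ∘ₗ (LinearMap.mul k C).flip d') t)) := by
    intro t
    induction t using TensorProduct.induction_on with
    | zero => simp
    | tmul a c => simp [smul_mul_assoc, mul_smul_comm]
    | add x y hx hy => simp only [map_add, add_mul, mul_add, hx, hy]
  rw [h1, h0]
  simp

/-- The twisting map of a covered action. Let `act : Q ⊗ V → V` be a unital action for the product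
`m` of `Q`, i.e. `act (m q x) v = act q (act x v)`, and let `G x c ∈ Q ⊗ C` be covered coactions.
There is a unique linear map `C ⊗ V → V ⊗ C` which sends `c ⊗ act x v` to
`∑ act q v ⊗ d`, where `G x c = ∑ q ⊗ d`. -/
theorem existsUnique_twist {Q C V : Type*}
    [AddCommGroup Q] [Module k Q] [AddCommGroup C] [Module k C] [AddCommGroup V] [Module k V]
    (m : Q →ₗ[k] Q →ₗ[k] Q) (hm : ∀ s : Finset Q, ∃ e : Q, ∀ a ∈ s, m e a = a)
    (act : Q →ₗ[k] V →ₗ[k] V) (hact : ∀ q x v, act (m q x) v = act q (act x v))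
    (hunit : Submodule.span k {w : V | ∃ (x : Q) (v : V), act x v = w} = ⊤)
    (G G' : Q →ₗ[k] C →ₗ[k] Q ⊗[k] C)
    (hG : ∀ f x c, LinearMap.rTensor C (m f) (G x c) = LinearMap.rTensor C (m.flip x) (G' f c)) :
    ∃! R : C ⊗[k] V →ₗ[k] V ⊗[k] C, ∀ (x : Q) (c : C) (v : V),
      R (c ⊗ₜ act x v) = LinearMap.rTensor C (act.flip v) (G x c) := by
  classical
  -- `K c (x ⊗ v) = ∑ act q v ⊗ d`
  let K : C →ₗ[k] Q ⊗[k] V →ₗ[k] V ⊗[k] C :=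
    LinearMap.flip (TensorProduct.lift
      (LinearMap.mk₂ k (fun (x : Q) (v : V) =>
          (LinearMap.rTensor C (act.flip v)) ∘ₗ (G x))
        (by intros; ext; simp) (by intros; ext; simp)
        (by intros; ext; simp [LinearMap.rTensor_add]) (by intros; ext; simp [LinearMap.rTensor_smul])))
  have hK : ∀ c x v, K c (x ⊗ₜ v) = LinearMap.rTensor C (act.flip v) (G x c) := by
    intro c x v; simp [K]
  let ν : Q ⊗[k] V →ₗ[k] V := TensorProduct.lift act
  have hν : Function.Surjective ν := by
    rw [← LinearMap.range_eq_top, eq_top_iff, ← hunit, Submodule.span_le]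
    rintro w ⟨x, v, rfl⟩
    exact ⟨x ⊗ₜ v, by simp [ν]⟩
  have hfix : ∀ t : Q ⊗[k] C, ∃ s : Finset Q, ∀ f : Q, (∀ a ∈ s, m f a = a) →
      LinearMap.rTensor C (m f) t = t := by
    intro t
    induction t using TensorProduct.induction_on with
    | zero => exact ⟨∅, fun f _ => by simp⟩
    | tmul a c => exact ⟨{a}, fun f hf => by simp [hf a (by simp)]⟩
    | add x y hx hy =>
      obtain ⟨s, hs⟩ := hx
      obtain ⟨s', hs'⟩ := hy
      refine ⟨s ∪ s', fun f hf => ?_⟩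
      rw [map_add, hs f (fun a ha => hf a (by simp [ha])), hs' f (fun a ha => hf a (by simp [ha]))]
  have hleg : ∀ (x : Q) (v : V) (t : Q ⊗[k] C),
      LinearMap.rTensor C (act.flip v) (LinearMap.rTensor C (m.flip x) t) =
        LinearMap.rTensor C (act.flip (act x v)) t := by
    intro x v t
    rw [← LinearMap.comp_apply, ← LinearMap.rTensor_comp]
    congr 2
    ext q
    simp [hact]
  have hloc : ∀ (c : C) (z : Q ⊗[k] V), ∃ s : Finset Q, ∀ f : Q, (∀ a ∈ s, m f a = a) →
      K c z = LinearMap.rTensor C (act.flip (ν z)) (G' f c) := by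
    intro c z
    induction z using TensorProduct.induction_on with
    | zero => exact ⟨∅, fun f _ => by simp⟩
    | tmul x v =>
      obtain ⟨s, hs⟩ := hfix (G x c)
      refine ⟨s, fun f hf => ?_⟩
      rw [hK, ← hs f hf, hG, hleg]
      simp [ν]
    | add x y hx hy =>
      obtain ⟨s, hs⟩ := hx
      obtain ⟨s', hs'⟩ := hy
      refine ⟨s ∪ s', fun f hf => ?_⟩
      rw [map_add, hs f (fun a ha => hf a (by simp [ha])), hs' f (fun a ha => hf a (by simp [ha])),
        map_add, map_add, LinearMap.rTensor_add, LinearMap.add_apply]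
  have hker : ∀ (c : C) (z z' : Q ⊗[k] V), ν z = ν z' → K c z = K c z' := by
    intro c z z' h
    obtain ⟨s, hs⟩ := hloc c z
    obtain ⟨s', hs'⟩ := hloc c z'
    obtain ⟨f, hf⟩ := hm (s ∪ s')
    rw [hs f (fun a ha => hf a (by simp [ha])), hs' f (fun a ha => hf a (by simp [ha])), h]
  obtain ⟨σ, hσ⟩ := LinearMap.exists_rightInverse_of_surjective ν (LinearMap.range_eq_top.2 hν)
  have hσ' : ∀ w, ν (σ w) = w := fun w => LinearMap.congr_fun hσ w
  refine ⟨TensorProduct.lift (K.compl₂ σ), fun x c v => ?_, fun R hR => ?_⟩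
  · rw [TensorProduct.lift.tmul, LinearMap.compl₂_apply, ← hK]
    apply hker
    rw [hσ']
    simp [ν]
  · apply TensorProduct.ext'
    intro c w
    rw [TensorProduct.lift.tmul, LinearMap.compl₂_apply]
    conv_lhs => rw [← hσ' w]
    generalize σ w = z
    induction z using TensorProduct.induction_on with
    | zero => simp
    | tmul x v =>
      rw [hK, ← hR]
      simp [ν]
    | add x y hx hy => rw [map_add, TensorProduct.tmul_add, map_add, hx, hy, map_add]

variable {Q L : Type*}
  [NonUnitalRing Q] [Module k Q] [SMulCommClass k Q Q] [IsScalarTower k Q Q]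
  [NonUnitalRing L] [Module k L] [SMulCommClass k L L] [IsScalarTower k L L]
  {HQ : MultiplierHopfAlgebra k Q} {HL : MultiplierHopfAlgebra k L}
  {A B C D : Type*}
  [NonUnitalNonAssocRing A] [Module k A] [SMulCommClass k A A] [IsScalarTower k A A]
  [NonUnitalNonAssocRing B] [Module k B] [SMulCommClass k B B] [IsScalarTower k B B]
  [NonUnitalNonAssocRing C] [Module k C] [SMulCommClass k C C] [IsScalarTower k C C]
  [NonUnitalNonAssocRing D] [Module k D] [SMulCommClass k D D] [IsScalarTower k D D]

theorem HasLocalUnits.left (h : HasLocalUnits Q) :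
    ∀ s : Finset Q, ∃ e : Q, ∀ a ∈ s, LinearMap.mul k Q e a = a := by
  intro s
  obtain ⟨e, f, hef⟩ := h s
  exact ⟨e, fun a ha => (hef a ha).1⟩

theorem HasLocalUnits.right (h : HasLocalUnits Q) :
    ∀ s : Finset Q, ∃ e : Q, ∀ a ∈ s, (LinearMap.mul k Q).flip e a = a := by
  intro s
  obtain ⟨e, f, hef⟩ := h s
  exact ⟨f, fun a ha => (hef a ha).2⟩

theorem tensor_mul_assoc {X Y : Type*}
    [NonUnitalNonAssocRing X] [Module k X] [SMulCommClass k X X] [IsScalarTower k X X]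
    [NonUnitalNonAssocRing Y] [Module k Y] [SMulCommClass k Y Y] [IsScalarTower k Y Y]
    (hX : ∀ a b c : X, a * b * c = a * (b * c)) (hY : ∀ a b c : Y, a * b * c = a * (b * c))
    (u v w : X ⊗[k] Y) : u * v * w = u * (v * w) := by
  induction u using TensorProduct.induction_on with
  | zero => simp
  | add u u' h h' => rw [add_mul, add_mul, add_mul, h, h']
  | tmul a b =>
    induction v using TensorProduct.induction_on with
    | zero => simp
    | add u u' h h' => rw [mul_add, add_mul, add_mul, mul_add, h, h']
    | tmul a' b' =>
      induction w using TensorProduct.induction_on with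
      | zero => simp
      | add u u' h h' => rw [mul_add, mul_add, mul_add, h, h']
      | tmul a'' b'' => simp [hX, hY]

theorem mul_fstMul (f : Q) (v t : Q ⊗[k] C) :
    v * fstMul f t = mulFst f v * t := by
  induction v using TensorProduct.induction_on with
  | zero => simp
  | add u u' h h' => rw [add_mul, map_add, add_mul, h, h']
  | tmul a b =>
    induction t using TensorProduct.induction_on with
    | zero => simp
    | add u u' h h' => rw [map_add, mul_add, mul_add, h, h']
    | tmul a' b' => simp [fstMul, mulFst, mul_assoc]

theorem fstMul_mul (f : Q) (v t : Q ⊗[k] C) :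
    fstMul f v * t = fstMul f (v * t) := by
  induction v using TensorProduct.induction_on with
  | zero => simp
  | add u u' h h' => rw [add_mul, map_add, map_add, add_mul, h, h']
  | tmul a b =>
    induction t using TensorProduct.induction_on with
    | zero => simp
    | add u u' h h' => rw [mul_add, mul_add, map_add, h, h']
    | tmul a' b' => simp [fstMul, mul_assoc]

theorem mul_fstMul' (f : Q) (v t : Q ⊗[k] C) :
    mulFst f v * t = v * fstMul f t := (mul_fstMul f v t).symm

theorem comm_mul (u v : C ⊗[k] L) :
    TensorProduct.comm k C L (u * v) =
      TensorProduct.comm k C L u * TensorProduct.comm k C L v := by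
  induction u using TensorProduct.induction_on with
  | zero => simp
  | add u u' h h' => rw [add_mul, map_add, map_add, add_mul, h, h']
  | tmul a b =>
    induction v using TensorProduct.induction_on with
    | zero => simp
    | add u u' h h' => rw [mul_add, map_add, map_add, mul_add, h, h']
    | tmul a' b' => simp

theorem mul_sndMul (f : L) (v t : C ⊗[k] L) :
    v * sndMul f t = mulSnd f v * t := by
  induction v using TensorProduct.induction_on with
  | zero => simp
  | add u u' h h' => rw [add_mul, map_add, add_mul, h, h']
  | tmul a b =>
    induction t using TensorProduct.induction_on with
    | zero => simp
    | add u u' h h' => rw [map_add, mul_add, mul_add, h, h']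
    | tmul a' b' => simp [sndMul, mulSnd, mul_assoc]

theorem mul_sndMul' (f : L) (v t : C ⊗[k] L) :
    mulSnd f v * t = v * sndMul f t := (mul_sndMul f v t).symm

theorem sndMul_mul (f : L) (v t : C ⊗[k] L) :
    sndMul f v * t = sndMul f (v * t) := by
  induction v using TensorProduct.induction_on with
  | zero => simp
  | add u u' h h' => rw [add_mul, map_add, map_add, add_mul, h, h']
  | tmul a b =>
    induction t using TensorProduct.induction_on with
    | zero => simp
    | add u u' h h' => rw [mul_add, mul_add, map_add, h, h']
    | tmul a' b' => simp [sndMul, mul_assoc]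

theorem rTensor_comm {L C : Type*} [AddCommGroup L] [Module k L] [AddCommGroup C] [Module k C]
    (g : L →ₗ[k] L) (t : C ⊗[k] L) :
    LinearMap.rTensor C g (TensorProduct.comm k C L t) =
      TensorProduct.comm k C L (LinearMap.lTensor C g t) := by
  induction t using TensorProduct.induction_on with
  | zero => simp
  | tmul a b => simp
  | add u u' h h' => simp only [map_add, h, h']

theorem Antipode.symm_mul (S : Antipode HQ) (a b : Q) :
    S.S.symm (a * b) = S.S.symm b * S.S.symm a := by
  apply S.S.injective
  simp [S.map_mul]

/-- `(f ⊗ 1)(Γ(c)(x ⊗ 1)) = ((f ⊗ 1)Γ(c))(x ⊗ 1)`. -/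
theorem LeftComoduleAlgebra.cover_compat (Γ : LeftComoduleAlgebra HQ C) (f x : Q) (c : C) :
    fstMul f (Γ.covR x c) = mulFst x (Γ.covL f c) := by
  have hass := tensor_mul_assoc (k := k) (X := Q) (Y := C) mul_assoc Γ.assoc
  rw [← sub_eq_zero]
  refine eq_zero_of_mul_mul HQ.localUnits Γ.nondeg _ fun u v => ?_
  rw [sub_mul, mul_sub, sub_eq_zero, fstMul_mul, mul_fstMul f v, ← Γ.covR_spec,
    ← Multiplier.right_mul, Γ.covL_spec, hass v, mul_fstMul' x]

/-- `(1 ⊗ f)(Υ(c)(1 ⊗ x)) = ((1 ⊗ f)Υ(c))(1 ⊗ x)`. -/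
theorem RightComoduleAlgebra.cover_compat (Υ : RightComoduleAlgebra HL C) (f x : L) (c : C) :
    sndMul f (Υ.covR x c) = mulSnd x (Υ.covL f c) := by
  have hass := tensor_mul_assoc (k := k) (X := C) (Y := L) Υ.assoc mul_assoc
  rw [← sub_eq_zero]
  apply (TensorProduct.comm k C L).injective
  rw [map_zero]
  refine eq_zero_of_mul_mul HL.localUnits Υ.nondeg _ fun u v => ?_
  obtain ⟨u, rfl⟩ := (TensorProduct.comm k C L).surjective u
  obtain ⟨v, rfl⟩ := (TensorProduct.comm k C L).surjective v
  rw [← comm_mul, ← comm_mul, sub_mul, mul_sub]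
  refine (TensorProduct.comm k C L).map_eq_zero_iff.2 ?_
  rw [sub_eq_zero, sndMul_mul, mul_sndMul f v, ← Υ.covR_spec,
    ← Multiplier.right_mul, Υ.covL_spec, hass v, mul_sndMul' x]

theorem LeftModuleAlgebra.existsUnique_twist (M : LeftModuleAlgebra HQ A)
    (Γ : LeftComoduleAlgebra HQ C) :
    ∃! R : C ⊗[k] A →ₗ[k] A ⊗[k] C, ∀ (x : Q) (c : C) (a : A),
      R (c ⊗ₜ M.act x a) = LinearMap.rTensor C (M.act.flip a) (Γ.covR x c) :=
  MultHopf.existsUnique_twist (LinearMap.mul k Q) HQ.localUnits.left M.act M.mul_act M.unital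
    Γ.covR Γ.covL Γ.cover_compat

theorem RightModuleAlgebra.existsUnique_twist (N : RightModuleAlgebra HL B)
    (Υ : RightComoduleAlgebra HL C) :
    ∃! R : C ⊗[k] B →ₗ[k] B ⊗[k] C, ∀ (x : L) (c : C) (b : B),
      R (c ⊗ₜ N.act x b) =
        LinearMap.rTensor C (N.act.flip b) (TensorProduct.comm k C L (Υ.covL x c)) :=
  MultHopf.existsUnique_twist (LinearMap.mul k L).flip HL.localUnits.right N.act
    (fun q x v => N.mul_act x q v) N.unital
    (Υ.covL.compr₂ (TensorProduct.comm k C L).toLinearMap)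
    (Υ.covR.compr₂ (TensorProduct.comm k C L).toLinearMap)
    (fun f x c => (rTensor_comm _ _).trans
      ((congrArg _ (Υ.cover_compat x f c).symm).trans (rTensor_comm _ _).symm))

theorem LeftModuleAlgebra.existsUnique_twistInv (S : Antipode HQ) (M : LeftModuleAlgebra HQ A)
    (Γ : LeftComoduleAlgebra HQ C) :
    ∃! R : C ⊗[k] A →ₗ[k] A ⊗[k] C, ∀ (x : Q) (c : C) (a : A),
      R (c ⊗ₜ M.act (S.S.symm x) a) =
        LinearMap.rTensor C (M.act.flip a ∘ₗ S.S.symm.toLinearMap) (Γ.covL x c) :=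
  MultHopf.existsUnique_twist (LinearMap.mul k Q).flip HQ.localUnits.right
    (M.act ∘ₗ S.S.symm.toLinearMap)
    (fun q x v => by simp [S.symm_mul, M.mul_act])
    (by
      rw [← M.unital]
      congr 1
      ext w
      exact ⟨fun ⟨x, v, h⟩ => ⟨S.S.symm x, v, h⟩, fun ⟨x, v, h⟩ => ⟨S.S x, v, by simpa using h⟩⟩)
    Γ.covL Γ.covR (fun f x c => (Γ.cover_compat x f c).symm)

theorem RightModuleAlgebra.existsUnique_twistInv (S : Antipode HL) (N : RightModuleAlgebra HL B)
    (Υ : RightComoduleAlgebra HL C) :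
    ∃! R : C ⊗[k] B →ₗ[k] B ⊗[k] C, ∀ (x : L) (c : C) (b : B),
      R (c ⊗ₜ N.act (S.S.symm x) b) =
        LinearMap.rTensor C (N.act.flip b ∘ₗ S.S.symm.toLinearMap)
          (TensorProduct.comm k C L (Υ.covR x c)) :=
  MultHopf.existsUnique_twist (LinearMap.mul k L) HL.localUnits.left
    (N.act ∘ₗ S.S.symm.toLinearMap)
    (fun q x v => by simp [S.symm_mul, N.mul_act])
    (by
      rw [← N.unital]
      congr 1
      ext w
      exact ⟨fun ⟨x, v, h⟩ => ⟨S.S.symm x, v, h⟩, fun ⟨x, v, h⟩ => ⟨S.S x, v, by simpa using h⟩⟩)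
    (Υ.covR.compr₂ (TensorProduct.comm k C L).toLinearMap)
    (Υ.covL.compr₂ (TensorProduct.comm k C L).toLinearMap)
    (fun f x c => (rTensor_comm _ _).trans
      ((congrArg _ (Υ.cover_compat f x c)).trans (rTensor_comm _ _).symm))

/-- `c ⊗ a ↦ ∑ c₍₋₁₎ ▷ a ⊗ c₀`: the unique linear map sending `c ⊗ (x ▷ a)` to `∑ q ▷ a ⊗ d`, where
`Γ(c)(x ⊗ 1) = ∑ q ⊗ d`. -/
def leftTwist (M : LeftModuleAlgebra HQ A) (Γ : LeftComoduleAlgebra HQ C) :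
    C ⊗[k] A →ₗ[k] A ⊗[k] C := (M.existsUnique_twist Γ).choose

/-- `c ⊗ b ↦ ∑ b ◁ c₍₁₎ ⊗ c₀`: the unique linear map sending `c ⊗ (b ◁ x)` to `∑ b ◁ q ⊗ d`, where
`(1 ⊗ x)Υ(c) = ∑ d ⊗ q`. -/
def rightTwist (N : RightModuleAlgebra HL B) (Υ : RightComoduleAlgebra HL C) :
    C ⊗[k] B →ₗ[k] B ⊗[k] C := (N.existsUnique_twist Υ).choose

/-- `c ⊗ a ↦ ∑ S⁻¹(c₍₋₁₎) ▷ a ⊗ c₀`: the unique linear map sending `c ⊗ (S⁻¹(x) ▷ a)` to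
`∑ S⁻¹(q) ▷ a ⊗ d`, where `(x ⊗ 1)Γ(c) = ∑ q ⊗ d`. -/
def leftTwistInv (S : Antipode HQ) (M : LeftModuleAlgebra HQ A) (Γ : LeftComoduleAlgebra HQ C) :
    C ⊗[k] A →ₗ[k] A ⊗[k] C := (M.existsUnique_twistInv S Γ).choose

/-- `c ⊗ b ↦ ∑ b ◁ S⁻¹(c₍₁₎) ⊗ c₀`: the unique linear map sending `c ⊗ (b ◁ S⁻¹(x))` to
`∑ b ◁ S⁻¹(q) ⊗ d`, where `Υ(c)(1 ⊗ x) = ∑ d ⊗ q`. -/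
def rightTwistInv (S : Antipode HL) (N : RightModuleAlgebra HL B)
    (Υ : RightComoduleAlgebra HL C) :
    C ⊗[k] B →ₗ[k] B ⊗[k] C := (N.existsUnique_twistInv S Υ).choose

end Twists

/-! ### Twisted products -/

/-- The vector space `V` with the bilinear product `μ`. -/
def WithProduct {k V : Type*} [Field k] [AddCommGroup V] [Module k V]
    (_μ : V →ₗ[k] V →ₗ[k] V) : Type _ := V

namespace WithProduct

variable {k V : Type*} [Field k] [AddCommGroup V] [Module k V] (μ : V →ₗ[k] V →ₗ[k] V)

instance : AddCommGroup (WithProduct μ) := inferInstanceAs (AddCommGroup V)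

instance : Module k (WithProduct μ) := inferInstanceAs (Module k V)

/-- The identity map from `V` to `V` with the product `μ`. -/
def of : V ≃ₗ[k] WithProduct μ := LinearEquiv.refl k V

instance : NonUnitalNonAssocRing (WithProduct μ) where
  mul x y := of μ (μ ((of μ).symm x) ((of μ).symm y))
  left_distrib x y z := by
    change of μ (μ ((of μ).symm x) ((of μ).symm (y + z))) =
      of μ (μ ((of μ).symm x) ((of μ).symm y)) + of μ (μ ((of μ).symm x) ((of μ).symm z))
    simp
  right_distrib x y z := by
    change of μ (μ ((of μ).symm (x + y)) ((of μ).symm z)) =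
      of μ (μ ((of μ).symm x) ((of μ).symm z)) + of μ (μ ((of μ).symm y) ((of μ).symm z))
    simp
  zero_mul x := by
    change of μ (μ ((of μ).symm 0) ((of μ).symm x)) = 0
    simp
  mul_zero x := by
    change of μ (μ ((of μ).symm x) ((of μ).symm 0)) = 0
    simp

theorem mul_def (x y : WithProduct μ) : x * y = of μ (μ ((of μ).symm x) ((of μ).symm y)) := rfl

instance : SMulCommClass k (WithProduct μ) (WithProduct μ) where
  smul_comm r x y := by simp [mul_def]

instance : IsScalarTower k (WithProduct μ) (WithProduct μ) where
  smul_assoc r x y := by simp [mul_def]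

end WithProduct

section Products

variable {k : Type*} [Field k] {A B C : Type*}
  [NonUnitalNonAssocRing A] [Module k A] [SMulCommClass k A A] [IsScalarTower k A A]
  [NonUnitalNonAssocRing B] [Module k B] [SMulCommClass k B B] [IsScalarTower k B B]
  [NonUnitalNonAssocRing C] [Module k C] [SMulCommClass k C C] [IsScalarTower k C C]

/-- The L-R-twisted product on `A ⊗ B`: `(a ⊗ b)(c ⊗ d) = a_T c_R ⊗ b_R d_T`, where
`R(b ⊗ c) = c_R ⊗ b_R` and `T(a ⊗ d) = a_T ⊗ d_T`. -/
def lrProduct (R : B ⊗[k] A →ₗ[k] A ⊗[k] B) (T : A ⊗[k] B →ₗ[k] A ⊗[k] B) :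
    A ⊗[k] B →ₗ[k] A ⊗[k] B →ₗ[k] A ⊗[k] B :=
  TensorProduct.curry <|
    -- `(a_T ⊗ d_T) ⊗ (c_R ⊗ b_R) ↦ a_T c_R ⊗ b_R d_T`
    TensorProduct.map (LinearMap.mul' k A)
        (LinearMap.mul' k B ∘ₗ (TensorProduct.comm k B B).toLinearMap) ∘ₗ
    (TensorProduct.tensorTensorTensorComm k A B A B).toLinearMap ∘ₗ
    TensorProduct.map T R ∘ₗ
    -- `(a ⊗ b) ⊗ (c ⊗ d) ↦ (a ⊗ d) ⊗ (b ⊗ c)`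
    (TensorProduct.tensorTensorTensorComm k A B B A).toLinearMap ∘ₗ
    LinearMap.lTensor (A ⊗[k] B) (TensorProduct.comm k A B).toLinearMap

/-- The twisted product on `A ⊗ B`: `(a ⊗ b)(c ⊗ d) = a c_R ⊗ b_R d`. -/
def twistedProduct (R : B ⊗[k] A →ₗ[k] A ⊗[k] B) :
    A ⊗[k] B →ₗ[k] A ⊗[k] B →ₗ[k] A ⊗[k] B :=
  lrProduct R LinearMap.id

/-- The two-sided twisted product on `A ⊗ C ⊗ B`:
`(a ⊗ c ⊗ b)(a' ⊗ c' ⊗ b') = a a'_R ⊗ c_R c'_T ⊗ b_T b'`, where `R(c ⊗ a') = a'_R ⊗ c_R` and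
`T(b ⊗ c') = c'_T ⊗ b_T`. -/
def twoSidedProduct (R : C ⊗[k] A →ₗ[k] A ⊗[k] C) (T : B ⊗[k] C →ₗ[k] C ⊗[k] B) :
    A ⊗[k] (C ⊗[k] B) →ₗ[k] A ⊗[k] (C ⊗[k] B) →ₗ[k] A ⊗[k] (C ⊗[k] B) :=
  TensorProduct.curry <|
    -- multiply the two middle factors
    LinearMap.lTensor A
        (LinearMap.rTensor B (LinearMap.mul' k C) ∘ₗ (TensorProduct.assoc k C C B).symm.toLinearMap)
      ∘ₗ (TensorProduct.assoc k A C (C ⊗[k] B)).toLinearMap ∘ₗ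
    -- `(a ⊗ (a'_R ⊗ c_R)) ⊗ ((c'_T ⊗ b_T) ⊗ b') ↦ (a a'_R ⊗ c_R) ⊗ (c'_T ⊗ b_T b')`
    TensorProduct.map
        (LinearMap.rTensor C (LinearMap.mul' k A) ∘ₗ (TensorProduct.assoc k A A C).symm.toLinearMap)
        (LinearMap.lTensor C (LinearMap.mul' k B) ∘ₗ (TensorProduct.assoc k C B B).toLinearMap) ∘ₗ
    -- apply `R` and `T`
    TensorProduct.map (LinearMap.lTensor A R) (LinearMap.rTensor B T) ∘ₗ
    -- `(a ⊗ (c ⊗ b)) ⊗ (a' ⊗ (c' ⊗ b')) ↦ (a ⊗ (c ⊗ a')) ⊗ ((b ⊗ c') ⊗ b')`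
    TensorProduct.map (TensorProduct.assoc k A C A).toLinearMap
        (TensorProduct.assoc k B C B).symm.toLinearMap ∘ₗ
    (TensorProduct.tensorTensorTensorComm k (A ⊗[k] C) B A (C ⊗[k] B)).toLinearMap ∘ₗ
    LinearMap.rTensor (A ⊗[k] (C ⊗[k] B)) (TensorProduct.assoc k A C B).symm.toLinearMap

end Products

section Algebras

variable {k : Type*} [Field k] {Q L : Type*}
  [NonUnitalRing Q] [Module k Q] [SMulCommClass k Q Q] [IsScalarTower k Q Q]
  [NonUnitalRing L] [Module k L] [SMulCommClass k L L] [IsScalarTower k L L]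
  {HQ : MultiplierHopfAlgebra k Q} {HL : MultiplierHopfAlgebra k L}
  {A B C D : Type*}
  [NonUnitalNonAssocRing A] [Module k A] [SMulCommClass k A A] [IsScalarTower k A A]
  [NonUnitalNonAssocRing B] [Module k B] [SMulCommClass k B B] [IsScalarTower k B B]
  [NonUnitalNonAssocRing C] [Module k C] [SMulCommClass k C C] [IsScalarTower k C C]
  [NonUnitalNonAssocRing D] [Module k D] [SMulCommClass k D D] [IsScalarTower k D D]

/-- The twisting map `b ⊗ c ↦ ∑ c₀ ⊗ b ◁ c₍₁₎`. -/
def rightTwist' (N : RightModuleAlgebra HL B) (Υ : RightComoduleAlgebra HL C) :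
    B ⊗[k] C →ₗ[k] C ⊗[k] B :=
  (TensorProduct.comm k B C).toLinearMap ∘ₗ rightTwist N Υ ∘ₗ
    (TensorProduct.comm k B C).toLinearMap

/-- The left smash product `A #_l C`: `(a # c)(a' # c') = ∑ a (c₍₋₁₎ ▷ a') # c₀ c'`. -/
abbrev SmashL (M : LeftModuleAlgebra HQ A) (Γ : LeftComoduleAlgebra HQ C) : Type _ :=
  WithProduct (twistedProduct (leftTwist M Γ))

/-- The right smash product `C #_r B`: `(c # b)(c' # b') = ∑ c c'₀ # (b ◁ c'₍₁₎) b'`. -/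
abbrev SmashR (Υ : RightComoduleAlgebra HL C) (N : RightModuleAlgebra HL B) : Type _ :=
  WithProduct (twistedProduct (rightTwist' N Υ))

/-- The L-R-smash product `D ⋄_l C` on `D ⊗ C`:
`(a ⋄ b)(c ⋄ d) = ∑ (a ◁ d₍₁₎)(b₍₋₁₎ ▷ c) ⋄ b₀ d₀`. -/
abbrev DiamondL (M : BimoduleAlgebra HQ HL D) (Γ : BicomoduleAlgebra HQ HL C) : Type _ :=
  WithProduct (lrProduct (leftTwist M.left Γ.left)
    (rightTwist M.right Γ.right ∘ₗ (TensorProduct.comm k D C).toLinearMap))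

/-- The L-R-smash product `C ⋄_r D` on `C ⊗ D`:
`(b' ⋄ a')(b ⋄ a) = ∑ b'₀ b₀ ⋄ (a' ◁ b₍₁₎)(b'₍₋₁₎ ▷ a)`. -/
abbrev DiamondR (Γ : BicomoduleAlgebra HQ HL C) (M : BimoduleAlgebra HQ HL D) : Type _ :=
  WithProduct (lrProduct (rightTwist' M.right Γ.right)
    ((TensorProduct.comm k D C).toLinearMap ∘ₗ leftTwist M.left Γ.left))

/-- The generalized twisted smash product `D ⋆_l C` on `D ⊗ C`:
`(a ⋆ b)(a' ⋆ b') = ∑ a (b₍₋₁₎ ▷ a' ◁ S⁻¹(b₍₁₎)) ⋆ b₀ b'`, with the antipode `S` of `L`. -/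
abbrev StarL (S : Antipode HL) (M : BimoduleAlgebra HQ HL D) (Γ : BicomoduleAlgebra HQ HL C) :
    Type _ :=
  WithProduct (twistedProduct
    (rightTwistInv S M.right Γ.right ∘ₗ (TensorProduct.comm k D C).toLinearMap ∘ₗ
      leftTwist M.left Γ.left))

/-- The generalized twisted smash product `C ⋆_r D` on `C ⊗ D`:
`(b' ⋆ a')(b ⋆ a) = ∑ b' b₀ ⋆ (S⁻¹(b₍₋₁₎) ▷ a' ◁ b₍₁₎) a`, with the antipode `S` of `Q`. -/
abbrev StarR (S : Antipode HQ) (Γ : BicomoduleAlgebra HQ HL C) (M : BimoduleAlgebra HQ HL D) :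
    Type _ :=
  WithProduct (twistedProduct
    ((TensorProduct.comm k D C).toLinearMap ∘ₗ leftTwistInv S M.left Γ.left ∘ₗ
      rightTwist' M.right Γ.right))

/-- The two-sided twisted tensor product `A ⋈_l C ⋈_r B` on `A ⊗ C ⊗ B`:
`(a ⋈ c ⋈ b)(a' ⋈ c' ⋈ b') = ∑ a (c₍₋₁₎ ▷ a') ⋈ c₀ c'₀ ⋈ (b ◁ c'₍₁₎) b'`. -/
abbrev TwoSided (M : LeftModuleAlgebra HQ A) (Γ : BicomoduleAlgebra HQ HL C)
    (N : RightModuleAlgebra HL B) : Type _ :=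
  WithProduct (twoSidedProduct (leftTwist M Γ.left) (rightTwist' N Γ.right))

/-- The left `Q`-module algebra `A ⊗ B`: `x ▷ (a ⊗ b) = x ▷ a ⊗ b`. -/
def tensorLeft (M : LeftModuleAlgebra HQ A) : LeftModuleAlgebra HQ (A ⊗[k] B) where
  act := LinearMap.rTensorHom B ∘ₗ M.act
  mul_act x y t := by
    induction t using TensorProduct.induction_on with
    | zero => simp
    | tmul a b => simp [M.mul_act]
    | add u v hu hv => rw [map_add, map_add, map_add, hu, hv]
  unital := by
    rw [eq_top_iff, ← TensorProduct.span_tmul_eq_top, Submodule.span_le]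
    rintro _ ⟨a, b, rfl⟩
    have ha : a ∈ Submodule.span k {b : A | ∃ (x : Q) (a : A), M.act x a = b} := by
      rw [M.unital]; trivial
    induction ha using Submodule.span_induction with
    | mem w hw =>
      obtain ⟨x, a', rfl⟩ := hw
      exact Submodule.subset_span ⟨x, a' ⊗ₜ b, by simp⟩
    | zero => simp
    | add u v _ _ hu hv => rw [TensorProduct.add_tmul]; exact Submodule.add_mem _ hu hv
    | smul r u _ hu => rw [← TensorProduct.smul_tmul']; exact Submodule.smul_mem _ r hu
  act_mul x z s t := by
    induction s using TensorProduct.induction_on with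
    | zero => simp
    | add u v hu hv =>
      rw [add_mul, map_add, hu, hv, map_add, TensorProduct.map_add_left, LinearMap.add_apply,
        map_add]
    | tmul a b =>
      induction t using TensorProduct.induction_on with
      | zero => simp
      | add u v hu hv =>
        rw [map_add, mul_add, map_add, hu, hv, map_add, TensorProduct.map_add_right,
          LinearMap.add_apply, map_add]
      | tmul a' b' =>
        have key : ∀ r : Q ⊗[k] Q,
            LinearMap.mul' k (A ⊗[k] B) (TensorProduct.map
              ((LinearMap.rTensorHom B ∘ₗ M.act).flip (a ⊗ₜ[k] b))
              ((LinearMap.rTensorHom B ∘ₗ M.act).flip (a' ⊗ₜ[k] b')) r) =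
            (LinearMap.mul' k A (TensorProduct.map (M.act.flip a) (M.act.flip a') r)) ⊗ₜ[k]
              (b * b') := by
          intro r
          induction r using TensorProduct.induction_on with
          | zero => simp
          | tmul p q => simp
          | add u v hu hv => simp only [map_add, hu, hv, TensorProduct.add_tmul]
        rw [key, ← M.act_mul]
        simp

/-- The right `L`-module algebra `A ⊗ B`: `(a ⊗ b) ◁ y = a ⊗ b ◁ y`. -/
def tensorRight (N : RightModuleAlgebra HL B) : RightModuleAlgebra HL (A ⊗[k] B) where
  act := LinearMap.lTensorHom A ∘ₗ N.act
  mul_act x y t := by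
    induction t using TensorProduct.induction_on with
    | zero => simp
    | tmul a b => simp [N.mul_act]
    | add u v hu hv => rw [map_add, map_add, map_add, hu, hv]
  unital := by
    rw [eq_top_iff, ← TensorProduct.span_tmul_eq_top, Submodule.span_le]
    rintro _ ⟨a, b, rfl⟩
    have hb : b ∈ Submodule.span k {c : B | ∃ (x : L) (b : B), N.act x b = c} := by
      rw [N.unital]; trivial
    induction hb using Submodule.span_induction with
    | mem w hw =>
      obtain ⟨x, b', rfl⟩ := hw
      exact Submodule.subset_span ⟨x, a ⊗ₜ b', by simp⟩
    | zero => simp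
    | add u v _ _ hu hv => rw [TensorProduct.tmul_add]; exact Submodule.add_mem _ hu hv
    | smul r u _ hu => rw [TensorProduct.tmul_smul]; exact Submodule.smul_mem _ r hu
  act_mul x z s t := by
    induction s using TensorProduct.induction_on with
    | zero => simp
    | add u v hu hv =>
      rw [map_add, add_mul, map_add, hu, hv, map_add, TensorProduct.map_add_left,
        LinearMap.add_apply, map_add]
    | tmul a b =>
      induction t using TensorProduct.induction_on with
      | zero => simp
      | add u v hu hv =>
        rw [mul_add, map_add, hu, hv, map_add, TensorProduct.map_add_right,
          LinearMap.add_apply, map_add]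
      | tmul a' b' =>
        have key : ∀ r : L ⊗[k] L,
            LinearMap.mul' k (A ⊗[k] B) (TensorProduct.map
              ((LinearMap.lTensorHom A ∘ₗ N.act).flip (a ⊗ₜ[k] b))
              ((LinearMap.lTensorHom A ∘ₗ N.act).flip (a' ⊗ₜ[k] b')) r) =
            (a * a') ⊗ₜ[k]
              (LinearMap.mul' k B (TensorProduct.map (N.act.flip b) (N.act.flip b') r)) := by
          intro r
          induction r using TensorProduct.induction_on with
          | zero => simp
          | tmul p q => simp
          | add u v hu hv => simp only [map_add, hu, hv, TensorProduct.tmul_add]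
        rw [key, ← N.act_mul]
        simp

/-- The `Q`-`L`-bimodule algebra `A ⊗ B`: `x ▷ (a ⊗ b) ◁ y = x ▷ a ⊗ b ◁ y`. -/
def tensorBimodule (M : LeftModuleAlgebra HQ A) (N : RightModuleAlgebra HL B) :
    BimoduleAlgebra HQ HL (A ⊗[k] B) where
  left := tensorLeft M
  right := tensorRight N
  act_comm x y t := by
    induction t using TensorProduct.induction_on with
    | zero => simp
    | tmul a b => simp [tensorLeft, tensorRight]
    | add u v hu hv => simp only [map_add, hu, hv]

/-- The linear isomorphism `e` is multiplicative. -/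
def IsAlgebraIso {k X Y : Type*} [Field k] [NonUnitalNonAssocRing X] [Module k X]
    [NonUnitalNonAssocRing Y] [Module k Y] (e : X ≃ₗ[k] Y) : Prop :=
  ∀ x y : X, e (x * y) = e x * e y

/-- The coaction `Υ'` of `L` on `A #_l C` is the one induced by the coaction `Υ` of `L` on `C`:
`Υ'(a # c) = ∑ (a # c₀) ⊗ c₍₁₎`. -/
def IsInducedRight (M : LeftModuleAlgebra HQ A) (Γ : LeftComoduleAlgebra HQ C)
    (Υ : RightComoduleAlgebra HL C) (Υ' : RightComoduleAlgebra HL (SmashL M Γ)) : Prop :=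
  ∀ (x : L) (a : A) (c : C),
    Υ'.covR x (WithProduct.of _ (a ⊗ₜ c)) =
      LinearMap.rTensor L ((WithProduct.of (twistedProduct (leftTwist M Γ))).toLinearMap ∘ₗ
        TensorProduct.mk k A C a) (Υ.covR x c) ∧
    Υ'.covL x (WithProduct.of _ (a ⊗ₜ c)) =
      LinearMap.rTensor L ((WithProduct.of (twistedProduct (leftTwist M Γ))).toLinearMap ∘ₗ
        TensorProduct.mk k A C a) (Υ.covL x c)

/-- The coaction `Γ'` of `Q` on `C #_r B` is the one induced by the coaction `Γ` of `Q` on `C`: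
`Γ'(c # b) = ∑ c₍₋₁₎ ⊗ (c₀ # b)`. -/
def IsInducedLeft (Γ : LeftComoduleAlgebra HQ C) (Υ : RightComoduleAlgebra HL C)
    (N : RightModuleAlgebra HL B) (Γ' : LeftComoduleAlgebra HQ (SmashR Υ N)) : Prop :=
  ∀ (x : Q) (c : C) (b : B),
    Γ'.covR x (WithProduct.of _ (c ⊗ₜ b)) =
      LinearMap.lTensor Q ((WithProduct.of (twistedProduct (rightTwist' N Υ))).toLinearMap ∘ₗ
        (TensorProduct.mk k C B).flip b) (Γ.covR x c) ∧
    Γ'.covL x (WithProduct.of _ (c ⊗ₜ b)) =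
      LinearMap.lTensor Q ((WithProduct.of (twistedProduct (rightTwist' N Υ))).toLinearMap ∘ₗ
        (TensorProduct.mk k C B).flip b) (Γ.covL x c)

end Algebras

end

end MultHopf

open MultHopf

/-! Every product in the statement is built from two twisting maps, R(c ⊗ a) = ∑ c₍₋₁₎ ▷ a ⊗ c₀ and
T(c ⊗ b) = ∑ b ◁ c₍₁₎ ⊗ c₀, and everything follows from four facts about them. (i) They respect the
product of the module algebra (`TwistsFst`): this is coassociativity of the coaction together with
the module algebra law (`IsTwist.twistsFst`). (ii) They respect the product of `C` (`TwistsSnd`),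
because a coaction is a homomorphism (`IsTwist.twistsSnd`). (iii) They commute, on the `C` leg
because the two coactions commute (`IsTwist.commute`), and on the leg of a bimodule algebra because
the two actions commute (`IsTwist.rightComm`). (iv) They are bijective, with inverses given by S⁻¹
(`CoactionCover.twist_twistInv`, `CoactionCover.twistInv_twist`).

By (i) and (ii) a twisted product is associative (`twistedProduct_assoc`), and with (iv) it is
nondegenerate (`twistedProduct_nondegenerate`). Hence A # C is an associative algebra with
nondegenerate product; by (iii) the coaction of `L` on `C` extends to it, and symmetrically for C #
B. The twisting map of the extended coaction moves only the `C` leg, so (A # C) # B and A # (C # B)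
have the two-sided product on pure tensors. This gives (4), and associativity of the two-sided
product is inherited from the iterated smash product. Parts (1) and (2) hold because `Q` acts only
on `A` and `L` only on `B`. For (3), the map d ⊗ c ↦ T(c ⊗ d) undoes the inverse twist in the
product of the generalized twisted smash product (`twistedProduct_lrProduct`).

Sweedler notation has no literal meaning here: only the covers Γ(c)(x ⊗ 1) and (x ⊗ 1)Γ(c) are
elements of a tensor product. An identity between twisting maps is reduced by `unital_induction` to
arguments x ▷ v, where it becomes an identity between covers. Those are verified after
multiplication by further elements, using local units, nondegeneracy and the bijectivity of T₁ and
T₂.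

Right-handed statements come from left-handed ones by passing to opposite products and the flipped
comultiplication (`flipT`, `swapTwist`, `Antipode.hopfCoverOp`). This is why the lemmas on twists
and covers take arbitrary bilinear products. The bijective antipode is itself constructed from
regularity, following Van Daele (`IsFlip.exists_isAntipode`, `IsFlip.antipode_antipode`). -/

namespace MultHopf

noncomputable section

/-! ### Tensor products of vector spaces -/

section TensorLemmas

variable {k M N P : Type*} [Field k] [AddCommGroup M] [Module k M] [AddCommGroup N] [Module k N]
  [AddCommGroup P] [Module k P]

/-- A jointly injective family of linear maps stays jointly injective after tensoring. -/
theorem eq_zero_of_forall_lTensor {ι : Sort*} (f : ι → N →ₗ[k] P)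
    (hf : ∀ n, (∀ i, f i n = 0) → n = 0) (z : M ⊗[k] N)
    (h : ∀ i, LinearMap.lTensor M (f i) z = 0) : z = 0 := by
  classical
  let b := Module.Basis.ofVectorSpace k M
  apply (TensorProduct.equivFinsuppOfBasisLeft b (N := N)).injective
  ext j
  rw [map_zero, TensorProduct.equivFinsuppOfBasisLeft_apply, Finsupp.coe_zero, Pi.zero_apply]
  apply hf
  intro i
  have key : ∀ z : M ⊗[k] N, f i (TensorProduct.lid k N ((b.coord j).rTensor N z)) =
      TensorProduct.lid k P ((b.coord j).rTensor P (LinearMap.lTensor M (f i) z)) := by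
    intro z
    induction z using TensorProduct.induction_on with
    | zero => simp
    | tmul a c => simp
    | add x y hx hy => simp only [map_add, hx, hy]
  rw [key, h]
  simp

theorem eq_zero_of_forall_rTensor {ι : Sort*} (f : ι → N →ₗ[k] P)
    (hf : ∀ n, (∀ i, f i n = 0) → n = 0) (z : N ⊗[k] M)
    (h : ∀ i, LinearMap.rTensor M (f i) z = 0) : z = 0 := by
  apply (TensorProduct.comm k N M).injective
  rw [map_zero]
  refine eq_zero_of_forall_lTensor f hf _ fun i => ?_
  have key : ∀ z : N ⊗[k] M, LinearMap.lTensor M (f i) (TensorProduct.comm k N M z) =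
      TensorProduct.comm k P M (LinearMap.rTensor M (f i) z) := by
    intro z
    induction z using TensorProduct.induction_on with
    | zero => simp
    | tmul a c => simp
    | add x y hx hy => simp only [map_add, hx, hy]
  rw [key, h, map_zero]

end TensorLemmas

/-! ### Twisting maps between vector spaces and their mirror images -/

section Twists

variable {k C V W : Type*} [Field k] [AddCommGroup C] [Module k C] [AddCommGroup V] [Module k V]
  [AddCommGroup W] [Module k W]

/-- `a ⊗ (a' ⊗ c) ↦ ν a a' ⊗ c`. -/
def mulL (ν : V →ₗ[k] V →ₗ[k] V) : V ⊗[k] (V ⊗[k] C) →ₗ[k] V ⊗[k] C :=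
  LinearMap.rTensor C (TensorProduct.lift ν) ∘ₗ (TensorProduct.assoc k V V C).symm.toLinearMap

/-- `(a ⊗ c) ⊗ c' ↦ a ⊗ μ c c'`. -/
def mulR (μ : C →ₗ[k] C →ₗ[k] C) : (V ⊗[k] C) ⊗[k] C →ₗ[k] V ⊗[k] C :=
  LinearMap.lTensor V (TensorProduct.lift μ) ∘ₗ (TensorProduct.assoc k V C C).toLinearMap

@[simp]
theorem mulL_tmul (ν : V →ₗ[k] V →ₗ[k] V) (a : V) (t : V ⊗[k] C) :
    mulL ν (a ⊗ₜ t) = LinearMap.rTensor C (ν a) t := by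
  induction t using TensorProduct.induction_on with
  | zero => simp
  | tmul a c => simp [mulL]
  | add x y hx hy => simp only [TensorProduct.tmul_add, map_add, hx, hy]

@[simp]
theorem mulR_tmul (μ : C →ₗ[k] C →ₗ[k] C) (c : C) (t : V ⊗[k] C) :
    mulR μ (t ⊗ₜ c) = LinearMap.lTensor V (μ.flip c) t := by
  induction t using TensorProduct.induction_on with
  | zero => simp
  | tmul a c => simp [mulR]
  | add x y hx hy => simp only [TensorProduct.add_tmul, map_add, hx, hy]

/-- The twisting map `R(c ⊗ a) = a_R ⊗ c_R` is compatible with the product `ν`: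
`R(c ⊗ a a') = a_R a'_R' ⊗ c_{R R'}`. -/
def TwistsFst (ν : V →ₗ[k] V →ₗ[k] V) (R : C ⊗[k] V →ₗ[k] V ⊗[k] C) : Prop :=
  ∀ c a a', R (c ⊗ₜ ν a a') =
    mulL ν (LinearMap.lTensor V (R ∘ₗ (TensorProduct.mk k C V).flip a') (R (c ⊗ₜ a)))

/-- The twisting map `R(c ⊗ a) = a_R ⊗ c_R` is compatible with the product `μ`:
`R(c c' ⊗ a) = a_{R' R} ⊗ c_R c'_R'`. -/
def TwistsSnd (μ : C →ₗ[k] C →ₗ[k] C) (R : C ⊗[k] V →ₗ[k] V ⊗[k] C) : Prop :=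
  ∀ c c' a, R (μ c c' ⊗ₜ a) =
    mulR μ (LinearMap.rTensor C (R ∘ₗ TensorProduct.mk k C V c) (R (c' ⊗ₜ a)))

/-- The twisting map read from the other side. -/
def swapTwist (R : C ⊗[k] V →ₗ[k] V ⊗[k] C) : V ⊗[k] C →ₗ[k] C ⊗[k] V :=
  (TensorProduct.comm k V C).toLinearMap ∘ₗ R ∘ₗ (TensorProduct.comm k V C).toLinearMap

theorem swapTwist_tmul (R : C ⊗[k] V →ₗ[k] V ⊗[k] C) (v : V) (c : C) :
    swapTwist R (v ⊗ₜ c) = TensorProduct.comm k V C (R (c ⊗ₜ v)) := rfl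

/-- Exchanging the roles of `C` and `V` reverses the order of multiplication and interchanges the
two compatibility conditions. Together with `TwistsFst.swap` this transfers left-handed results to
right-handed twists. -/
theorem TwistsSnd.swap {μ : C →ₗ[k] C →ₗ[k] C} {R : C ⊗[k] V →ₗ[k] V ⊗[k] C}
    (h : TwistsSnd μ R) : TwistsFst μ.flip (swapTwist R) := by
  intro v c c'
  rw [LinearMap.flip_apply, swapTwist_tmul, h, swapTwist_tmul]
  generalize R (c ⊗ₜ v) = t
  induction t using TensorProduct.induction_on with
  | zero => simp
  | add x y hx hy => simp only [map_add, hx, hy]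
  | tmul v' d =>
    simp only [LinearMap.rTensor_tmul, mulR_tmul, TensorProduct.comm_tmul, LinearMap.lTensor_tmul,
      mulL_tmul, LinearMap.comp_apply, TensorProduct.mk_apply, LinearMap.flip_apply, swapTwist_tmul]
    generalize R (c' ⊗ₜ v') = t
    induction t using TensorProduct.induction_on with
    | zero => simp
    | add x y hx hy => simp only [map_add, hx, hy]
    | tmul v' d => simp

theorem TwistsFst.swap {ν : V →ₗ[k] V →ₗ[k] V} {R : C ⊗[k] V →ₗ[k] V ⊗[k] C}
    (h : TwistsFst ν R) : TwistsSnd ν.flip (swapTwist R) := by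
  intro a a' c
  rw [LinearMap.flip_apply, swapTwist_tmul, h, swapTwist_tmul]
  generalize R (c ⊗ₜ a') = t
  induction t using TensorProduct.induction_on with
  | zero => simp
  | add x y hx hy => simp only [map_add, hx, hy]
  | tmul v' d =>
    simp only [LinearMap.rTensor_tmul, mulR_tmul, TensorProduct.comm_tmul, LinearMap.lTensor_tmul,
      mulL_tmul, LinearMap.comp_apply, TensorProduct.mk_apply, LinearMap.flip_apply, swapTwist_tmul]
    generalize R (d ⊗ₜ a) = t
    induction t using TensorProduct.induction_on with
    | zero => simp
    | add x y hx hy => simp only [map_add, hx, hy]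
    | tmul v' d => simp

theorem swapTwist_bijective {R : C ⊗[k] V →ₗ[k] V ⊗[k] C} (h : Function.Bijective R) :
    Function.Bijective (swapTwist R) :=
  (TensorProduct.comm k V C).bijective.comp (h.comp (TensorProduct.comm k V C).bijective)

/-- The twisting maps `R` and `T` of `C` with `V` and `W` commute. -/
def TwistsCommute (R : C ⊗[k] V →ₗ[k] V ⊗[k] C) (T : C ⊗[k] W →ₗ[k] W ⊗[k] C) : Prop :=
  ∀ c v w, LinearMap.lTensor W (R ∘ₗ (TensorProduct.mk k C V).flip v) (T (c ⊗ₜ w)) =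
    TensorProduct.leftComm k V W C
      (LinearMap.lTensor V (T ∘ₗ (TensorProduct.mk k C W).flip w) (R (c ⊗ₜ v)))

/-- `TwistsCommute` for twisting maps read from the other side. -/
theorem TwistsCommute.swap {R : C ⊗[k] V →ₗ[k] V ⊗[k] C} {T : C ⊗[k] W →ₗ[k] W ⊗[k] C}
    (h : TwistsCommute R T) (c : C) (v : V) (w : W) :
    LinearMap.rTensor W (swapTwist R ∘ₗ TensorProduct.mk k V C v) (swapTwist T (w ⊗ₜ c)) =
      TensorProduct.rightComm k C W V
        (LinearMap.rTensor V (swapTwist T ∘ₗ TensorProduct.mk k W C w) (swapTwist R (v ⊗ₜ c))) := by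
  let e : W ⊗[k] (V ⊗[k] C) →ₗ[k] (C ⊗[k] V) ⊗[k] W :=
    LinearMap.rTensor W (TensorProduct.comm k V C).toLinearMap ∘ₗ
      (TensorProduct.comm k W (V ⊗[k] C)).toLinearMap
  have h1 := congrArg e (h c v w)
  have e1 : ∀ t : W ⊗[k] C,
      e (LinearMap.lTensor W (R ∘ₗ (TensorProduct.mk k C V).flip v) t) =
      LinearMap.rTensor W (swapTwist R ∘ₗ TensorProduct.mk k V C v)
        (TensorProduct.comm k W C t) := by
    intro t
    induction t using TensorProduct.induction_on with
    | zero => simp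
    | add x y hx hy => simp only [map_add, hx, hy]
    | tmul v' d => simp [e, swapTwist]
  have e2 : ∀ t : V ⊗[k] C,
      e (TensorProduct.leftComm k V W C
        (LinearMap.lTensor V (T ∘ₗ (TensorProduct.mk k C W).flip w) t)) =
      TensorProduct.rightComm k C W V
        (LinearMap.rTensor V (swapTwist T ∘ₗ TensorProduct.mk k W C w)
          (TensorProduct.comm k V C t)) := by
    intro t
    induction t using TensorProduct.induction_on with
    | zero => simp
    | add x y hx hy => simp only [map_add, hx, hy]
    | tmul v' d =>
      simp only [LinearMap.lTensor_tmul, TensorProduct.comm_tmul, LinearMap.rTensor_tmul,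
        LinearMap.comp_apply, TensorProduct.mk_apply, LinearMap.flip_apply, swapTwist_tmul]
      generalize T (d ⊗ₜ w) = s
      induction s using TensorProduct.induction_on with
      | zero => simp
      | add x y hx hy => simp only [map_add, TensorProduct.tmul_add, TensorProduct.add_tmul, hx, hy]
      | tmul w' d' => simp [e]
  rw [e1, e2] at h1
  exact h1

theorem TwistsCommute.symm {R : C ⊗[k] V →ₗ[k] V ⊗[k] C} {T : C ⊗[k] W →ₗ[k] W ⊗[k] C}
    (h : TwistsCommute R T) : TwistsCommute T R := fun c w v =>
  (TensorProduct.leftComm k V W C).eq_symm_apply.2 (h c v w).symm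

/-- Puts the commutation supplied by `IsTwist.rightComm` into the form of hypothesis `hB` of
`twistedProduct_lrProduct`, for twists read from the other side. -/
theorem leftComm_swapTwist_of_rightComm {R T : C ⊗[k] V →ₗ[k] V ⊗[k] C}
    (h : ∀ c c' v, LinearMap.rTensor C (R ∘ₗ TensorProduct.mk k C V c) (T (c' ⊗ₜ v)) =
      TensorProduct.rightComm k V C C
        (LinearMap.rTensor C (T ∘ₗ TensorProduct.mk k C V c') (R (c ⊗ₜ v)))) (c c' : C) (v : V) :
    LinearMap.lTensor C (swapTwist R ∘ₗ (TensorProduct.mk k V C).flip c) (swapTwist T (v ⊗ₜ c')) =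
      TensorProduct.leftComm k C C V
        (LinearMap.lTensor C (swapTwist T ∘ₗ (TensorProduct.mk k V C).flip c')
          (swapTwist R (v ⊗ₜ c))) := by
  let e : (V ⊗[k] C) ⊗[k] C →ₗ[k] C ⊗[k] (C ⊗[k] V) :=
    LinearMap.lTensor C (TensorProduct.comm k V C).toLinearMap ∘ₗ
      (TensorProduct.comm k (V ⊗[k] C) C).toLinearMap
  have e₁ : ∀ (R : C ⊗[k] V →ₗ[k] V ⊗[k] C) (c : C) (t : V ⊗[k] C),
      LinearMap.lTensor C (swapTwist R ∘ₗ (TensorProduct.mk k V C).flip c)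
        (TensorProduct.comm k V C t) =
      e (LinearMap.rTensor C (R ∘ₗ TensorProduct.mk k C V c) t) := by
    intro R c t
    induction t using TensorProduct.induction_on with
    | zero => simp
    | add x y hx hy => simp only [map_add, hx, hy]
    | tmul v d => simp [e, swapTwist_tmul]
  have e₂ : ∀ t : (V ⊗[k] C) ⊗[k] C, e (TensorProduct.rightComm k V C C t) =
      TensorProduct.leftComm k C C V (e t) := by
    intro t
    induction t using TensorProduct.induction_on with
    | zero => simp
    | add x y hx hy => simp only [map_add, hx, hy]
    | tmul t d =>
      induction t using TensorProduct.induction_on with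
      | zero => simp
      | add x y hx hy => simp only [map_add, TensorProduct.add_tmul, hx, hy]
      | tmul v d => simp [e]
  rw [swapTwist_tmul, swapTwist_tmul, e₁, e₁, h, e₂]

theorem swapTwist_comm (R : C ⊗[k] V →ₗ[k] V ⊗[k] C) (z : C ⊗[k] V) :
    swapTwist R (TensorProduct.comm k C V z) = TensorProduct.comm k V C (R z) := by
  have e : TensorProduct.comm k V C (TensorProduct.comm k C V z) = z :=
    (TensorProduct.comm k C V).symm_apply_apply z
  simp only [swapTwist, LinearMap.comp_apply, LinearEquiv.coe_coe, e]

theorem swapTwist_comp_comm (R : C ⊗[k] V →ₗ[k] V ⊗[k] C) :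
    swapTwist R ∘ₗ (TensorProduct.comm k C V).toLinearMap =
      (TensorProduct.comm k V C).toLinearMap ∘ₗ R :=
  LinearMap.ext (swapTwist_comm R)

/-- One-sided inverses survive the passage to mirror images, because the two flips in the middle
cancel. -/
theorem swapTwist_comm_swapTwist {R R' : C ⊗[k] V →ₗ[k] V ⊗[k] C}
    (h : ∀ z, R (TensorProduct.comm k V C (R' z)) = TensorProduct.comm k C V z) (z : V ⊗[k] C) :
    swapTwist R (TensorProduct.comm k C V (swapTwist R' z)) = TensorProduct.comm k V C z := by
  rw [swapTwist_comm, swapTwist, LinearMap.comp_apply, LinearMap.comp_apply]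
  exact congrArg (TensorProduct.comm k V C) ((h _).trans
    ((TensorProduct.comm k V C).symm_apply_apply z))

end Twists

/-! ### Twisted products -/

section Products

variable {k : Type*} [Field k] {A B : Type*}
  [NonUnitalNonAssocRing A] [Module k A] [SMulCommClass k A A] [IsScalarTower k A A]
  [NonUnitalNonAssocRing B] [Module k B] [SMulCommClass k B B] [IsScalarTower k B B]

theorem lrProduct_tmul (R : B ⊗[k] A →ₗ[k] A ⊗[k] B) (T : A ⊗[k] B →ₗ[k] A ⊗[k] B)
    (a a' : A) (b b' : B) :
    lrProduct R T (a ⊗ₜ b) (a' ⊗ₜ b') =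
      TensorProduct.map₂ (LinearMap.mul k A) (LinearMap.mul k B).flip
        (T (a ⊗ₜ b')) (R (b ⊗ₜ a')) := by
  simp only [lrProduct, TensorProduct.curry_apply, LinearMap.comp_apply, LinearMap.lTensor_tmul,
    LinearEquiv.coe_coe, TensorProduct.comm_tmul, TensorProduct.tensorTensorTensorComm_tmul,
    TensorProduct.map_tmul]
  generalize T (a ⊗ₜ b') = s
  generalize R (b ⊗ₜ a') = t
  induction s using TensorProduct.induction_on with
  | zero => simp
  | add x y hx hy => simp only [map_add, TensorProduct.add_tmul, LinearMap.add_apply, hx, hy]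
  | tmul α β =>
    induction t using TensorProduct.induction_on with
    | zero => simp
    | add x y hx hy => simp only [map_add, TensorProduct.tmul_add, hx, hy]
    | tmul α' β' => simp

theorem twistedProduct_tmul (R : B ⊗[k] A →ₗ[k] A ⊗[k] B) (a a' : A) (b b' : B) :
    twistedProduct R (a ⊗ₜ b) (a' ⊗ₜ b') =
      TensorProduct.map (LinearMap.mul k A a) ((LinearMap.mul k B).flip b') (R (b ⊗ₜ a')) := by
  rw [twistedProduct, lrProduct_tmul]
  rfl

/-- Left multiplication by a ⊗ b factors as an action of `a` after an action of `b` on A ⊗ B.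
Associativity becomes a statement about these two actions. -/
theorem twistedProduct_tmul_eq_comp (R : B ⊗[k] A →ₗ[k] A ⊗[k] B) (a : A) (b : B) :
    twistedProduct R (a ⊗ₜ b) = LinearMap.rTensor B (LinearMap.mul k A a) ∘ₗ
      mulR (LinearMap.mul k B) ∘ₗ LinearMap.rTensor B (R ∘ₗ TensorProduct.mk k B A b) := by
  ext a' b'
  change twistedProduct R (a ⊗ₜ b) (a' ⊗ₜ b') = _
  rw [twistedProduct_tmul]
  simp [← LinearMap.rTensor_comp_lTensor]

/-- Associativity says that left multiplication is a homomorphism into the endomorphisms of A ⊗ B.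
Left multiplication by a ⊗ b is `lam a ∘ pi b`, so it suffices that `lam` and `pi` are
multiplicative and that `pi b ∘ lam a'` is left multiplication by R(b ⊗ a'). -/
theorem twistedProduct_assoc (hA : ∀ a b c : A, a * b * c = a * (b * c))
    (hB : ∀ a b c : B, a * b * c = a * (b * c)) {R : B ⊗[k] A →ₗ[k] A ⊗[k] B}
    (h₁ : TwistsFst (LinearMap.mul k A) R) (h₂ : TwistsSnd (LinearMap.mul k B) R)
    (x y z : A ⊗[k] B) :
    twistedProduct R (twistedProduct R x y) z = twistedProduct R x (twistedProduct R y z) := by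
  let lam : A → A ⊗[k] B →ₗ[k] A ⊗[k] B := fun a => LinearMap.rTensor B (LinearMap.mul k A a)
  let pi : B → A ⊗[k] B →ₗ[k] A ⊗[k] B := fun b =>
    mulR (LinearMap.mul k B) ∘ₗ LinearMap.rTensor B (R ∘ₗ TensorProduct.mk k B A b)
  have hpi : ∀ b a' b', pi b (a' ⊗ₜ b') =
      LinearMap.lTensor A ((LinearMap.mul k B).flip b') (R (b ⊗ₜ a')) := by
    intro b a' b'
    simp [pi]
  -- `pi b` acts from the left, so it commutes with right multiplication on the `B` leg; this is
  -- associativity of `B`.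
  have hpR : ∀ (b b' : B) (t : A ⊗[k] B),
      pi b (LinearMap.lTensor A ((LinearMap.mul k B).flip b') t) =
        LinearMap.lTensor A ((LinearMap.mul k B).flip b') (pi b t) := by
    intro b b' t
    induction t using TensorProduct.induction_on with
    | zero => simp
    | add x y hx hy => simp only [map_add, hx, hy]
    | tmul a c =>
      simp only [LinearMap.lTensor_tmul, hpi, LinearMap.flip_apply, LinearMap.mul_apply']
      rw [← LinearMap.lTensor_comp_apply]
      congr 2
      ext d
      simp [hB]
  have hpm : ∀ b b', pi (b * b') = pi b ∘ₗ pi b' := by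
    intro b b'
    ext a c
    have h := h₂ b b' a
    simp only [LinearMap.mul_apply'] at h
    change pi (b * b') (a ⊗ₜ c) = pi b (pi b' (a ⊗ₜ c))
    rw [hpi, h, hpi, hpR]
    rfl
  have hlam : ∀ a a', lam (a * a') = lam a ∘ₗ lam a' := by
    intro a a'
    ext a'' c
    simp [lam, hA]
  have hμ : ∀ a b, twistedProduct R (a ⊗ₜ b) = lam a ∘ₗ pi b := twistedProduct_tmul_eq_comp R
  have hmap : ∀ a b' (t : A ⊗[k] B), twistedProduct R
      (TensorProduct.map (LinearMap.mul k A a) ((LinearMap.mul k B).flip b') t) =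
      lam a ∘ₗ twistedProduct R t ∘ₗ pi b' := by
    intro a b' t
    induction t using TensorProduct.induction_on with
    | zero => simp
    | add x y hx hy => simp only [map_add, hx, hy, LinearMap.add_comp, LinearMap.comp_add]
    | tmul α β =>
      simp only [TensorProduct.map_tmul, hμ, LinearMap.mul_apply', LinearMap.flip_apply, hlam, hpm]
      rfl
  -- The exchange rule: it is `TwistsFst` read as an identity of operators.
  have hcross : ∀ b a', pi b ∘ₗ lam a' = twistedProduct R (R (b ⊗ₜ a')) := by
    intro b a'
    ext a'' b''
    have h := h₁ b a' a''
    simp only [LinearMap.mul_apply'] at h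
    change pi b ((a' * a'') ⊗ₜ b'') = twistedProduct R (R (b ⊗ₜ a')) (a'' ⊗ₜ b'')
    rw [hpi, h]
    generalize R (b ⊗ₜ a') = t
    induction t using TensorProduct.induction_on with
    | zero => simp
    | add x y hx hy => simp only [map_add, hx, hy, LinearMap.add_apply]
    | tmul α β =>
      simp only [twistedProduct_tmul, LinearMap.lTensor_tmul, mulL_tmul, LinearMap.comp_apply,
        LinearMap.flip_apply, TensorProduct.mk_apply]
      rw [← LinearMap.comp_apply, LinearMap.lTensor_comp_rTensor]
  induction x using TensorProduct.induction_on with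
  | zero => simp
  | add x y hx hy => simp only [map_add, LinearMap.add_apply, hx, hy]
  | tmul a b =>
    induction y using TensorProduct.induction_on with
    | zero => simp
    | add x y hx hy => simp only [map_add, LinearMap.add_apply, hx, hy]
    | tmul a' b' =>
      rw [twistedProduct_tmul, hmap, ← hcross, hμ, hμ]
      rfl

/-- In a product with R(y), the compatibility conditions pull the multiplication by a' (or b')
inside `R`, where it acts on one leg of `y`. Since `R` is surjective every element is some R(y), and
an annihilated one vanishes by nondegeneracy of one factor, injectivity of `R`, and nondegeneracy of
the other factor. -/
theorem twistedProduct_nondegenerate (hA : NondegenerateProduct A) (hB : NondegenerateProduct B)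
    {R : B ⊗[k] A →ₗ[k] A ⊗[k] B} (hR : Function.Bijective R)
    (h₁ : TwistsFst (LinearMap.mul k A) R) (h₂ : TwistsSnd (LinearMap.mul k B) R) :
    NondegenerateProduct (WithProduct (twistedProduct R)) := by
  have e₁ : ∀ (y : B ⊗[k] A) (a' : A) (b' : B), twistedProduct R (R y) (a' ⊗ₜ b') =
      LinearMap.lTensor A ((LinearMap.mul k B).flip b')
        (R (LinearMap.lTensor B ((LinearMap.mul k A).flip a') y)) := by
    intro y a' b'
    induction y using TensorProduct.induction_on with
    | zero => simp
    | add x y hx hy => simp only [map_add, LinearMap.add_apply, hx, hy]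
    | tmul b a =>
      have h := h₁ b a a'
      rw [LinearMap.lTensor_tmul, LinearMap.flip_apply, h]
      generalize R (b ⊗ₜ a) = t
      induction t using TensorProduct.induction_on with
      | zero => simp
      | add x y hx hy => simp only [map_add, LinearMap.add_apply, hx, hy]
      | tmul α β =>
        simp only [twistedProduct_tmul, LinearMap.lTensor_tmul, mulL_tmul, LinearMap.comp_apply,
          LinearMap.flip_apply, TensorProduct.mk_apply]
        rw [← LinearMap.lTensor_comp_rTensor]
        rfl
  have e₂ : ∀ (y : B ⊗[k] A) (a' : A) (b' : B), twistedProduct R (a' ⊗ₜ b') (R y) =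
      LinearMap.rTensor B (LinearMap.mul k A a')
        (R (LinearMap.rTensor A (LinearMap.mul k B b') y)) := by
    intro y a' b'
    induction y using TensorProduct.induction_on with
    | zero => simp
    | add x y hx hy => simp only [map_add, hx, hy]
    | tmul b a =>
      rw [twistedProduct_tmul_eq_comp, LinearMap.rTensor_tmul, h₂ b' b a]
      rfl
  constructor
  · intro x hx
    obtain ⟨y, hy⟩ := hR.2 ((WithProduct.of _).symm x)
    have hy0 : y = 0 := by
      refine eq_zero_of_forall_lTensor (fun a' => (LinearMap.mul k A).flip a')
        (fun n hn => hA.1 n hn) y fun a' => ?_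
      refine (map_eq_zero_iff R hR.1).1 ?_
      refine eq_zero_of_forall_lTensor (fun b' => (LinearMap.mul k B).flip b')
        (fun n hn => hB.1 n hn) _ fun b' => ?_
      rw [← e₁, hy]
      exact hx (WithProduct.of _ (a' ⊗ₜ b'))
    rw [hy0, map_zero] at hy
    exact (WithProduct.of _).symm.map_eq_zero_iff.1 hy.symm
  · intro x hx
    obtain ⟨y, hy⟩ := hR.2 ((WithProduct.of _).symm x)
    have hy0 : y = 0 := by
      refine eq_zero_of_forall_rTensor (fun b' => LinearMap.mul k B b')
        (fun n hn => hB.2 n hn) y fun b' => ?_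
      refine (map_eq_zero_iff R hR.1).1 ?_
      refine eq_zero_of_forall_rTensor (fun a' => LinearMap.mul k A a')
        (fun n hn => hA.2 n hn) _ fun a' => ?_
      rw [← e₂, hy]
      exact hx (WithProduct.of _ (a' ⊗ₜ b'))
    rw [hy0, map_zero] at hy
    exact (WithProduct.of _).symm.map_eq_zero_iff.1 hy.symm

/-- A bijective twisting map `T` untwists one half of an L-R-twisted product. -/
theorem twistedProduct_lrProduct {R T T' : B ⊗[k] A →ₗ[k] A ⊗[k] B}
    (hT : ∀ z, T (TensorProduct.comm k A B (T' z)) = TensorProduct.comm k B A z)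
    (h₁ : TwistsFst (LinearMap.mul k A).flip T) (h₂ : TwistsSnd (LinearMap.mul k B).flip T)
    (hB : ∀ a a' b, LinearMap.lTensor A (R ∘ₗ (TensorProduct.mk k B A).flip a') (T (b ⊗ₜ a)) =
      TensorProduct.leftComm k A A B
        (LinearMap.lTensor A (T ∘ₗ (TensorProduct.mk k B A).flip a) (R (b ⊗ₜ a'))))
    (hA : ∀ b b' a, LinearMap.rTensor B (R ∘ₗ TensorProduct.mk k B A b) (T (b' ⊗ₜ a)) =
      TensorProduct.rightComm k A B B
        (LinearMap.rTensor B (T ∘ₗ TensorProduct.mk k B A b') (R (b ⊗ₜ a))))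
    (x y : A ⊗[k] B) :
    T (TensorProduct.comm k A B
      (twistedProduct (T' ∘ₗ (TensorProduct.comm k A B).toLinearMap ∘ₗ R) x y)) =
      lrProduct R (T ∘ₗ (TensorProduct.comm k A B).toLinearMap)
        (T (TensorProduct.comm k A B x)) (T (TensorProduct.comm k A B y)) := by
  let mm := TensorProduct.map₂ (LinearMap.mul k A) (LinearMap.mul k B).flip
  -- `K₁ a (α ⊗ β) = T(β ⊗ a) (α ⊗ 1)` and `K₂ b (α ⊗ β) = (1 ⊗ β) T(b ⊗ α)`
  let K₁ : A → A ⊗[k] B →ₗ[k] A ⊗[k] B := fun a =>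
    mulL (LinearMap.mul k A).flip ∘ₗ LinearMap.lTensor A (T ∘ₗ (TensorProduct.mk k B A).flip a)
  let K₂ : B → A ⊗[k] B →ₗ[k] A ⊗[k] B := fun b =>
    mulR (LinearMap.mul k B).flip ∘ₗ LinearMap.rTensor B (T ∘ₗ TensorProduct.mk k B A b)
  have hK₁ : ∀ b a a', T (b ⊗ₜ (a' * a)) = K₁ a' (T (b ⊗ₜ a)) := fun b a a' => h₁ b a a'
  have hK₂ : ∀ b b' a, T ((b' * b) ⊗ₜ a) = K₂ b (T (b' ⊗ₜ a)) := fun b b' a => h₂ b b' a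
  -- `h₁` and `h₂` turn the outer multiplications by `a` and b' into the operators `K₁ a` and `K₂
  -- b'` outside `T`.
  have hK : ∀ a b' (t : A ⊗[k] B), T (TensorProduct.comm k A B
      (TensorProduct.map (LinearMap.mul k A a) ((LinearMap.mul k B).flip b') t)) =
      K₁ a (K₂ b' (T (TensorProduct.comm k A B t))) := by
    intro a b' t
    induction t using TensorProduct.induction_on with
    | zero => simp
    | add x y hx hy => simp only [map_add, hx, hy]
    | tmul α β =>
      simp only [TensorProduct.map_tmul, LinearMap.mul_apply', LinearMap.flip_apply,
        TensorProduct.comm_tmul, hK₁, hK₂]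
  -- `ψ (α ⊗ (s ⊗ β')) = mm (T(β' ⊗ α)) s`
  let ψ : A ⊗[k] ((A ⊗[k] B) ⊗[k] B) →ₗ[k] A ⊗[k] B :=
    TensorProduct.lift mm.flip ∘ₗ LinearMap.lTensor (A ⊗[k] B) T ∘ₗ
      (TensorProduct.assoc k (A ⊗[k] B) B A).toLinearMap ∘ₗ
      (TensorProduct.comm k A ((A ⊗[k] B) ⊗[k] B)).toLinearMap
  have hψ : ∀ α s β', ψ (α ⊗ₜ (s ⊗ₜ β')) = mm (T (β' ⊗ₜ α)) s := by
    intro α s β'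
    simp [ψ]
  let χ : B → A ⊗[k] (A ⊗[k] B) →ₗ[k] A ⊗[k] B := fun b' =>
    ψ ∘ₗ LinearMap.lTensor A ((TensorProduct.rightComm k A B B).toLinearMap ∘ₗ
      LinearMap.rTensor B (T ∘ₗ TensorProduct.mk k B A b'))
  -- Here `hA` interchanges `R` and `T` on the right-hand factor, so that `R` meets only the
  -- left-hand factor `t`, and a' only through `R`.
  have step₁ : ∀ (a' : A) (b' : B) (t : A ⊗[k] B),
      lrProduct R (T ∘ₗ (TensorProduct.comm k A B).toLinearMap) t (T (b' ⊗ₜ a')) =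
        χ b' (LinearMap.lTensor A (R ∘ₗ (TensorProduct.mk k B A).flip a') t) := by
    intro a' b' t
    induction t using TensorProduct.induction_on with
    | zero => simp
    | add x y hx hy => simp only [map_add, LinearMap.add_apply, hx, hy]
    | tmul α β =>
      have e : ∀ s : A ⊗[k] B,
          lrProduct R (T ∘ₗ (TensorProduct.comm k A B).toLinearMap) (α ⊗ₜ β) s =
            ψ (α ⊗ₜ LinearMap.rTensor B (R ∘ₗ TensorProduct.mk k B A β) s) := by
        intro s
        induction s using TensorProduct.induction_on with
        | zero => simp
        | add x y hx hy => simp only [map_add, TensorProduct.tmul_add, hx, hy]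
        | tmul α' β' =>
          rw [lrProduct_tmul, LinearMap.rTensor_tmul, hψ]
          rfl
      rw [e, hA]
      rfl
  -- Once `hB` has moved `T` outside `R` as well, what remains are two applications of `T` to
  -- products, which `hK₁` and `hK₂` resolve.
  have step₂ : ∀ (a : A) (b' : B) (t : A ⊗[k] B),
      χ b' (TensorProduct.leftComm k A A B
        (LinearMap.lTensor A (T ∘ₗ (TensorProduct.mk k B A).flip a) t)) = K₁ a (K₂ b' t) := by
    intro a b' t
    induction t using TensorProduct.induction_on with
    | zero => simp
    | add x y hx hy => simp only [map_add, hx, hy]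
    | tmul ρ σ =>
      simp only [LinearMap.lTensor_tmul, LinearMap.comp_apply, LinearMap.flip_apply,
        TensorProduct.mk_apply, K₂, LinearMap.rTensor_tmul, mulR_tmul]
      have e : ∀ s : A ⊗[k] B, χ b' (TensorProduct.leftComm k A A B (ρ ⊗ₜ s)) =
          ψ (LinearMap.lTensor A ((TensorProduct.rightComm k A B B).toLinearMap ∘ₗ
            TensorProduct.mk k (A ⊗[k] B) B (T (b' ⊗ₜ ρ))) s) := by
        intro s
        induction s using TensorProduct.induction_on with
        | zero => simp
        | add x y hx hy => simp only [map_add, TensorProduct.tmul_add, hx, hy]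
        | tmul δ τ => simp [χ]
      rw [e]
      generalize T (b' ⊗ₜ ρ) = s'
      induction s' using TensorProduct.induction_on with
      | zero => simp
      | add x y hx hy =>
        simp only [map_add, LinearMap.comp_add, LinearMap.lTensor_add, LinearMap.add_apply, hx, hy]
      | tmul ρ' γ' =>
        simp only [LinearMap.lTensor_tmul, LinearMap.flip_flip, LinearMap.mul_apply', K₁,
          LinearMap.comp_apply, mulL_tmul, LinearMap.flip_apply, TensorProduct.mk_apply, hK₂]
        generalize T (σ ⊗ₜ a) = s
        induction s using TensorProduct.induction_on with
        | zero => simp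
        | add x y hx hy => simp only [map_add, hx, hy]
        | tmul δ τ =>
          simp only [LinearMap.lTensor_tmul, LinearMap.comp_apply, TensorProduct.mk_apply,
            LinearEquiv.coe_coe, TensorProduct.rightComm_tmul, hψ, K₂, LinearMap.rTensor_tmul,
            mulR_tmul]
          generalize T (γ' ⊗ₜ δ) = s
          induction s using TensorProduct.induction_on with
          | zero => simp
          | add x y hx hy => simp only [map_add, LinearMap.add_apply, hx, hy]
          | tmul x y => simp [mm]
  induction x using TensorProduct.induction_on with
  | zero => simp
  | add x y hx hy => simp only [map_add, LinearMap.add_apply, hx, hy]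
  | tmul a b =>
    induction y using TensorProduct.induction_on with
    | zero => simp
    | add x y hx hy => simp only [map_add, hx, hy]
    | tmul a' b' =>
      -- Both sides become `K₁ a (K₂ b' (R (b ⊗ a')))`; on the left this uses that the outer `T`
      -- cancels T' by `hT`.
      rw [twistedProduct_tmul, hK, TensorProduct.comm_tmul, TensorProduct.comm_tmul, step₁, hB,
        step₂]
      congr 2
      exact (hT _).trans ((TensorProduct.comm k A B).symm_apply_apply _)

end Products

/-! ### Twisting maps of covered coactions -/

section CoveredTwists

variable {k Q L C V W : Type*} [Field k] [AddCommGroup Q] [Module k Q] [AddCommGroup L] [Module k L]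
  [AddCommGroup C] [Module k C] [AddCommGroup V] [Module k V] [AddCommGroup W] [Module k W]

theorem rTensor_lTensor_comm (f : Q →ₗ[k] V) (g : C →ₗ[k] W) (t : Q ⊗[k] C) :
    LinearMap.rTensor W f (LinearMap.lTensor Q g t) =
      LinearMap.lTensor V g (LinearMap.rTensor C f t) := by
  rw [← LinearMap.comp_apply, LinearMap.rTensor_comp_lTensor, ← LinearMap.lTensor_comp_rTensor]
  rfl

/-- The defining formula of a twisting map evaluates it only on elements x ▷ v. A unital action
makes this enough for any additive property. -/
theorem unital_induction {act : Q →ₗ[k] V →ₗ[k] V}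
    (hunit : Submodule.span k {w : V | ∃ (x : Q) (v : V), act x v = w} = ⊤) {p : V → Prop}
    (zero : p 0) (add : ∀ v w, p v → p w → p (v + w)) (mem : ∀ x v, p (act x v)) (v : V) : p v := by
  have hv : v ∈ Submodule.span k {w : V | ∃ (x : Q) (v : V), act x v = w} := by
    rw [hunit]; trivial
  -- `p` is assumed additive but not homogeneous, so the induction carries all scalar multiples; for
  -- generators the scalar is absorbed into `x`.
  have key : ∀ r : k, p (r • v) := by
    induction hv using Submodule.span_induction with
    | mem w hw =>
      obtain ⟨x, v, rfl⟩ := hw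
      intro r
      rw [← LinearMap.smul_apply, ← map_smul]
      exact mem _ _
    | zero => simpa using zero
    | add v w _ _ hv hw => exact fun r => by rw [smul_add]; exact add _ _ (hv r) (hw r)
    | smul s v _ hv => exact fun r => by rw [smul_smul]; exact hv _
  simpa using key 1

/-- `R(c ⊗ (x ▷ v)) = ∑ q ▷ v ⊗ d` where `G x c = ∑ q ⊗ d`. -/
def IsTwist (act : Q →ₗ[k] V →ₗ[k] V) (G : Q →ₗ[k] C →ₗ[k] Q ⊗[k] C)
    (R : C ⊗[k] V →ₗ[k] V ⊗[k] C) : Prop :=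
  ∀ x c v, R (c ⊗ₜ act x v) = LinearMap.rTensor C (act.flip v) (G x c)

/-- On x ▷ v both sides are obtained from covers by letting the `Q` leg act on `v`, and `hG` is
multiplicativity of the coaction in covered form. -/
theorem IsTwist.twistsSnd {act : Q →ₗ[k] V →ₗ[k] V} {G : Q →ₗ[k] C →ₗ[k] Q ⊗[k] C}
    {R : C ⊗[k] V →ₗ[k] V ⊗[k] C} (hR : IsTwist act G R)
    (hunit : Submodule.span k {w : V | ∃ (x : Q) (v : V), act x v = w} = ⊤)
    {μ : C →ₗ[k] C →ₗ[k] C}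
    (hG : ∀ x c c', G x (μ c c') = mulR μ (LinearMap.rTensor C (G.flip c) (G x c'))) :
    TwistsSnd μ R := by
  intro c c' v
  induction v using unital_induction hunit with
  | zero => simp
  | add v w hv hw => simp only [TensorProduct.tmul_add, map_add, hv, hw]
  | mem x v =>
    rw [hR, hR, hG]
    generalize G x c' = t
    induction t using TensorProduct.induction_on with
    | zero => simp
    | add x y hx hy => simp only [map_add, hx, hy]
    | tmul q d =>
      simp only [LinearMap.rTensor_tmul, mulR_tmul, LinearMap.flip_apply, LinearMap.comp_apply,
        TensorProduct.mk_apply, hR q c v]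
      exact rTensor_lTensor_comm _ _ _

/-- The product (u ▷ a)(v ▷ a') can be written as an action on a product once u ⊗ v is in the form
T(p ⊗ y): it is then p ▷ (a (y ▷ a')). In this form the claim is coassociativity `hG`, and
surjectivity of `T` makes the form general. -/
theorem IsTwist.twistsFst {act : Q →ₗ[k] V →ₗ[k] V} {G : Q →ₗ[k] C →ₗ[k] Q ⊗[k] C}
    {R : C ⊗[k] V →ₗ[k] V ⊗[k] C} (hR : IsTwist act G R)
    (hunit : Submodule.span k {w : V | ∃ (x : Q) (v : V), act x v = w} = ⊤)
    {T : Q ⊗[k] Q →ₗ[k] Q ⊗[k] Q} (hT : Function.Surjective T)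
    (hG : ∀ p y c,
      TensorProduct.lift ((LinearMap.lTensorHom Q ∘ₗ G).flip ∘ₗ G.flip c) (T (p ⊗ₜ y)) =
      TensorProduct.assoc k Q Q C
        (LinearMap.rTensor C (T ∘ₗ (TensorProduct.mk k Q Q).flip y) (G p c)))
    {ν : V →ₗ[k] V →ₗ[k] V}
    (hν : ∀ x z a a', act x (ν a (act z a')) =
      TensorProduct.lift ν (TensorProduct.map (act.flip a) (act.flip a') (T (x ⊗ₜ z)))) :
    TwistsFst ν R := by
  intro c a a'
  induction a using unital_induction hunit with
  | zero => simp
  | add v w hv hw => simp only [TensorProduct.tmul_add, map_add, LinearMap.add_apply, hv, hw]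
  | mem u a =>
  induction a' using unital_induction hunit with
  | zero => simp
  | add v w hv hw =>
    simp only [TensorProduct.tmul_add, map_add, LinearMap.comp_add, LinearMap.lTensor_add,
      LinearMap.add_apply, hv, hw]
  | mem v a' =>
  let Φ : Q ⊗[k] (Q ⊗[k] C) →ₗ[k] V ⊗[k] C :=
    LinearMap.rTensor C (TensorProduct.lift ν ∘ₗ TensorProduct.map (act.flip a) (act.flip a')) ∘ₗ
      (TensorProduct.assoc k Q Q C).symm.toLinearMap
  have hΦ : ∀ q s, Φ (q ⊗ₜ s) =
      LinearMap.rTensor C (ν (act q a)) (LinearMap.rTensor C (act.flip a') s) := by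
    intro q s
    induction s using TensorProduct.induction_on with
    | zero => simp
    | add x y hx hy => simp only [TensorProduct.tmul_add, map_add, hx, hy]
    | tmul q' d => simp [Φ]
  -- Both sides are linear in u ⊗ v, so equality may be tested on the image of `T`; there `hν` is
  -- used once before applying the coaction and once after it.
  have key : R ∘ₗ TensorProduct.mk k C V c ∘ₗ TensorProduct.lift ν ∘ₗ
        TensorProduct.map (act.flip a) (act.flip a') =
      Φ ∘ₗ TensorProduct.lift ((LinearMap.lTensorHom Q ∘ₗ G).flip ∘ₗ G.flip c) := by
    rw [← LinearMap.cancel_right hT]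
    apply TensorProduct.ext'
    intro p y
    change R (c ⊗ₜ TensorProduct.lift ν (TensorProduct.map (act.flip a) (act.flip a')
      (T (p ⊗ₜ y)))) = Φ (TensorProduct.lift _ (T (p ⊗ₜ y)))
    rw [← hν, hR, hG]
    generalize G p c = t
    induction t using TensorProduct.induction_on with
    | zero => simp
    | add x y hx hy => simp only [map_add, hx, hy]
    | tmul q d =>
      simp only [LinearMap.rTensor_tmul, LinearMap.flip_apply, LinearMap.comp_apply,
        TensorProduct.mk_apply, hν]
      simp [Φ]
  have h := LinearMap.congr_fun key (u ⊗ₜ v)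
  simp only [LinearMap.comp_apply, TensorProduct.map_tmul, LinearMap.flip_apply,
    TensorProduct.lift.tmul, TensorProduct.mk_apply] at h
  rw [h, hR]
  generalize G u c = t
  induction t using TensorProduct.induction_on with
  | zero => simp
  | add x y hx hy => simp only [map_add, hx, hy]
  | tmul q d =>
    simp only [LinearMap.rTensor_tmul, LinearMap.lTensor_tmul, mulL_tmul, LinearMap.comp_apply,
      LinearMap.flip_apply, TensorProduct.mk_apply, hR v d a', LinearMap.coe_lTensorHom, hΦ]

/-- On y ▷ v and x ▷ w the two composites are the images of the two iterated covers of `c` under the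
actions on `v` and `w`, and `hG` equates those covers up to a permutation of the legs. -/
theorem IsTwist.commute {actV : Q →ₗ[k] V →ₗ[k] V} {G : Q →ₗ[k] C →ₗ[k] Q ⊗[k] C}
    {R : C ⊗[k] V →ₗ[k] V ⊗[k] C} (hR : IsTwist actV G R)
    (hV : Submodule.span k {w : V | ∃ (x : Q) (v : V), actV x v = w} = ⊤)
    {actW : L →ₗ[k] W →ₗ[k] W} {G' : L →ₗ[k] C →ₗ[k] L ⊗[k] C}
    {T : C ⊗[k] W →ₗ[k] W ⊗[k] C} (hT : IsTwist actW G' T)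
    (hW : Submodule.span k {w : W | ∃ (x : L) (v : W), actW x v = w} = ⊤)
    (hG : ∀ x y c, LinearMap.lTensor L (G y) (G' x c) =
      TensorProduct.leftComm k Q L C (LinearMap.lTensor Q (G' x) (G y c))) :
    TwistsCommute R T := by
  intro c v w
  induction v using unital_induction hV with
  | zero => simp
  | add v w hv hw =>
    simp only [TensorProduct.tmul_add, map_add, LinearMap.comp_add, LinearMap.lTensor_add,
      LinearMap.add_apply, hv, hw]
  | mem y v =>
  induction w using unital_induction hW with
  | zero => simp
  | add v w hv hw =>
    simp only [TensorProduct.tmul_add, map_add, LinearMap.comp_add, LinearMap.lTensor_add,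
      LinearMap.add_apply, hv, hw]
  | mem x w =>
  have h := congrArg (TensorProduct.map (actW.flip w) (LinearMap.rTensor C (actV.flip v)))
    (hG x y c)
  have e₁ : ∀ t : L ⊗[k] C,
      TensorProduct.map (actW.flip w) (LinearMap.rTensor C (actV.flip v))
        (LinearMap.lTensor L (G y) t) =
      LinearMap.lTensor W (R ∘ₗ (TensorProduct.mk k C V).flip (actV y v))
        (LinearMap.rTensor C (actW.flip w) t) := by
    intro t
    induction t using TensorProduct.induction_on with
    | zero => simp
    | add x y hx hy => simp only [map_add, hx, hy]
    | tmul q d => simp [hR y d v]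
  have e₂ : ∀ t : Q ⊗[k] C,
      TensorProduct.map (actW.flip w) (LinearMap.rTensor C (actV.flip v))
        (TensorProduct.leftComm k Q L C (LinearMap.lTensor Q (G' x) t)) =
      TensorProduct.leftComm k V W C
        (LinearMap.lTensor V (T ∘ₗ (TensorProduct.mk k C W).flip (actW x w))
        (LinearMap.rTensor C (actV.flip v) t)) := by
    intro t
    induction t using TensorProduct.induction_on with
    | zero => simp
    | add x y hx hy => simp only [map_add, hx, hy]
    | tmul q d =>
      simp only [LinearMap.rTensor_tmul, LinearMap.lTensor_tmul, LinearMap.comp_apply,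
        LinearMap.flip_apply, TensorProduct.mk_apply, hT x d w]
      generalize G' x d = s
      induction s using TensorProduct.induction_on with
      | zero => simp
      | add x y hx hy => simp only [map_add, TensorProduct.tmul_add, hx, hy]
      | tmul q' d' => simp
  rw [e₁, e₂, ← hR, ← hT] at h
  exact h

/-- Two twisting maps given by commuting actions on `V`. -/
theorem IsTwist.rightComm {C' : Type*} [AddCommGroup C'] [Module k C']
    {actQ : Q →ₗ[k] V →ₗ[k] V} {G : Q →ₗ[k] C →ₗ[k] Q ⊗[k] C}
    {R : C ⊗[k] V →ₗ[k] V ⊗[k] C} (hR : IsTwist actQ G R)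
    (hQ : Submodule.span k {w : V | ∃ (x : Q) (v : V), actQ x v = w} = ⊤)
    {actL : L →ₗ[k] V →ₗ[k] V} {G' : L →ₗ[k] C' →ₗ[k] L ⊗[k] C'}
    {T : C' ⊗[k] V →ₗ[k] V ⊗[k] C'} (hT : IsTwist actL G' T)
    (hL : Submodule.span k {w : V | ∃ (x : L) (v : V), actL x v = w} = ⊤)
    (hact : ∀ x y v, actL y (actQ x v) = actQ x (actL y v)) (c : C) (c' : C') (v : V) :
    LinearMap.rTensor C' (R ∘ₗ TensorProduct.mk k C V c) (T (c' ⊗ₜ v)) =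
      TensorProduct.rightComm k V C' C
        (LinearMap.rTensor C (T ∘ₗ TensorProduct.mk k C' V c') (R (c ⊗ₜ v))) := by
  -- Unitality of both actions allows vectors x ▷ (v ◁ y), and `hact` lets either action be the
  -- outermost, so that either twist can be evaluated.
  induction v using unital_induction hQ with
  | zero => simp
  | add v w hv hw => simp only [TensorProduct.tmul_add, map_add, hv, hw]
  | mem x v =>
  induction v using unital_induction hL with
  | zero => simp
  | add v w hv hw => simp only [TensorProduct.tmul_add, map_add, hv, hw]
  | mem y v =>
  -- `Ξ ((p ⊗ d) ⊗ (q ⊗ d')) = (p ▷ v ◁ q ⊗ d) ⊗ d'`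
  let Ξ : (Q ⊗[k] C) ⊗[k] (L ⊗[k] C') →ₗ[k] (V ⊗[k] C) ⊗[k] C' :=
    (TensorProduct.assoc k V C C').symm.toLinearMap ∘ₗ
      LinearMap.rTensor (C ⊗[k] C') (TensorProduct.lift (actQ.compl₂ (actL.flip v))) ∘ₗ
      (TensorProduct.tensorTensorTensorComm k Q C L C').toLinearMap
  have e₁ : ∀ t : L ⊗[k] C', LinearMap.rTensor C' (R ∘ₗ TensorProduct.mk k C V c)
      (LinearMap.rTensor C' (actL.flip (actQ x v)) t) = Ξ (G x c ⊗ₜ t) := by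
    intro t
    induction t using TensorProduct.induction_on with
    | zero => simp
    | add x y hx hy => simp only [map_add, TensorProduct.tmul_add, hx, hy]
    | tmul q d =>
      simp only [LinearMap.rTensor_tmul, LinearMap.flip_apply, LinearMap.comp_apply,
        TensorProduct.mk_apply, hact, hR x c]
      generalize G x c = s
      induction s using TensorProduct.induction_on with
      | zero => simp
      | add x y hx hy => simp only [map_add, TensorProduct.add_tmul, hx, hy]
      | tmul p e => simp [Ξ]
  have e₂ : ∀ s : Q ⊗[k] C, TensorProduct.rightComm k V C' C
      (LinearMap.rTensor C (T ∘ₗ TensorProduct.mk k C' V c')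
      (LinearMap.rTensor C (actQ.flip (actL y v)) s)) = Ξ (s ⊗ₜ G' y c') := by
    intro s
    induction s using TensorProduct.induction_on with
    | zero => simp
    | add x y hx hy => simp only [map_add, TensorProduct.add_tmul, hx, hy]
    | tmul q d =>
      simp only [LinearMap.rTensor_tmul, LinearMap.flip_apply, LinearMap.comp_apply,
        TensorProduct.mk_apply, ← hact, hT y c']
      generalize G' y c' = t
      induction t using TensorProduct.induction_on with
      | zero => simp
      | add x y hx hy => simp only [map_add, TensorProduct.tmul_add, TensorProduct.add_tmul, hx, hy]
      | tmul p e => simp [Ξ, hact]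
  rw [hR, e₂, ← hact, hT, e₁]

end CoveredTwists

/-! ### Covered coactions -/

section Covers

variable {k Q L : Type*} [Field k]
  [NonUnitalRing Q] [Module k Q] [SMulCommClass k Q Q] [IsScalarTower k Q Q]
  [NonUnitalRing L] [Module k L] [SMulCommClass k L L] [IsScalarTower k L L]
  {HQ : MultiplierHopfAlgebra k Q} {HL : MultiplierHopfAlgebra k L}
  {A B C : Type*}
  [NonUnitalNonAssocRing A] [Module k A] [SMulCommClass k A A] [IsScalarTower k A A]
  [NonUnitalNonAssocRing B] [Module k B] [SMulCommClass k B B] [IsScalarTower k B B]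
  [NonUnitalNonAssocRing C] [Module k C] [SMulCommClass k C C] [IsScalarTower k C C]

theorem NondegenerateProduct.tensor_left (hQ : HasLocalUnits Q) (hC : NondegenerateProduct C)
    (hass : ∀ a b c : C, a * b * c = a * (b * c)) : NondegenerateProduct (Q ⊗[k] C) := by
  refine ⟨fun t h => eq_zero_of_mul_mul hQ hC t fun u v => ?_,
    fun t h => eq_zero_of_mul_mul hQ hC t fun u v => ?_⟩
  · rw [h, mul_zero]
  · rw [← tensor_mul_assoc mul_assoc hass, h, zero_mul]

theorem NondegenerateProduct.tensor_right (hL : HasLocalUnits L) (hC : NondegenerateProduct C)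
    (hass : ∀ a b c : C, a * b * c = a * (b * c)) : NondegenerateProduct (C ⊗[k] L) := by
  have h := NondegenerateProduct.tensor_left (k := k) hL hC hass
  constructor
  · intro t ht
    refine (TensorProduct.comm k C L).map_eq_zero_iff.1 (h.1 _ fun u => ?_)
    obtain ⟨u, rfl⟩ := (TensorProduct.comm k C L).surjective u
    rw [← comm_mul, ht, map_zero]
  · intro t ht
    refine (TensorProduct.comm k C L).map_eq_zero_iff.1 (h.2 _ fun u => ?_)
    obtain ⟨u, rfl⟩ := (TensorProduct.comm k C L).surjective u
    rw [← comm_mul, ht, map_zero]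

theorem NondegenerateProduct.eq_of_mul_right {X : Type*} [NonUnitalNonAssocRing X]
    (h : NondegenerateProduct X) {s t : X} (hst : ∀ u, s * u = t * u) : s = t := by
  rw [← sub_eq_zero]
  exact h.1 _ fun u => by rw [sub_mul, hst, sub_self]

theorem NondegenerateProduct.eq_of_mul_left {X : Type*} [NonUnitalNonAssocRing X]
    (h : NondegenerateProduct X) {s t : X} (hst : ∀ u, u * s = u * t) : s = t := by
  rw [← sub_eq_zero]
  exact h.2 _ fun u => by rw [mul_sub, hst, sub_self]

theorem lTensor_mul_mul (hass : ∀ a b c : C, a * b * c = a * (b * c)) (d : C) (s t : Q ⊗[k] C) :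
    s * LinearMap.lTensor Q (LinearMap.mul k C d) t =
      LinearMap.lTensor Q ((LinearMap.mul k C).flip d) s * t := by
  induction s using TensorProduct.induction_on with
  | zero => simp
  | add x y hx hy => simp only [map_add, add_mul, hx, hy]
  | tmul p e =>
    induction t using TensorProduct.induction_on with
    | zero => simp
    | add x y hx hy => simp only [map_add, mul_add, hx, hy]
    | tmul p e => simp [hass]

theorem rTensor_mul_mul (hass : ∀ a b c : C, a * b * c = a * (b * c)) (d : C) (s t : C ⊗[k] L) :
    s * LinearMap.rTensor L (LinearMap.mul k C d) t =
      LinearMap.rTensor L ((LinearMap.mul k C).flip d) s * t := by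
  induction s using TensorProduct.induction_on with
  | zero => simp
  | add x y hx hy => simp only [map_add, add_mul, hx, hy]
  | tmul p e =>
    induction t using TensorProduct.induction_on with
    | zero => simp
    | add x y hx hy => simp only [map_add, mul_add, hx, hy]
    | tmul p e => simp [hass]

theorem tmul_mul_eq_fstMul (q : Q) (d : C)
    (u : Q ⊗[k] C) :
    (q ⊗ₜ d) * u = fstMul q (LinearMap.lTensor Q (LinearMap.mul k C d) u) := by
  induction u using TensorProduct.induction_on with
  | zero => simp
  | add x y hx hy => simp only [map_add, mul_add, hx, hy]
  | tmul p e => simp [fstMul]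

theorem mul_tmul_eq_mulSnd (q : L) (d : C)
    (u : C ⊗[k] L) :
    u * (d ⊗ₜ q) = mulSnd q (LinearMap.rTensor L ((LinearMap.mul k C).flip d) u) := by
  induction u using TensorProduct.induction_on with
  | zero => simp
  | add x y hx hy => simp only [map_add, add_mul, hx, hy]
  | tmul p e => simp [mulSnd]

/-- If t = ∑ q ⊗ d, then m t = ∑ r(q)(1 ⊗ d): a multiplier is known on products as soon as its
covers are. -/
theorem left_mul_of_cover (hass : ∀ a b c : C, a * b * c = a * (b * c))
    (m : Multiplier k (Q ⊗[k] C)) (r : Q →ₗ[k] Q ⊗[k] C)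
    (hm : ∀ x u, Multiplier.left m (fstMul x u) = r x * u) (t u : Q ⊗[k] C) :
    Multiplier.left m (t * u) = mulR (LinearMap.mul k C) (LinearMap.rTensor C r t) * u := by
  induction t using TensorProduct.induction_on with
  | zero => simp
  | add x y hx hy => simp only [map_add, add_mul, hx, hy]
  | tmul q d =>
    rw [tmul_mul_eq_fstMul, hm, lTensor_mul_mul hass, LinearMap.rTensor_tmul, mulR_tmul]

theorem right_mul_of_cover (hass : ∀ a b c : C, a * b * c = a * (b * c))
    (m : Multiplier k (C ⊗[k] L)) (r : L →ₗ[k] C ⊗[k] L)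
    (hm : ∀ x u, Multiplier.right m (mulSnd x u) = u * r x) (t u : C ⊗[k] L) :
    Multiplier.right m (u * t) = u * mulL (LinearMap.mul k C) (LinearMap.lTensor C r t) := by
  induction t using TensorProduct.induction_on with
  | zero => simp
  | add x y hx hy => simp only [map_add, mul_add, hx, hy]
  | tmul q d =>
    rw [mul_tmul_eq_mulSnd, hm, ← rTensor_mul_mul hass, LinearMap.lTensor_tmul, mulL_tmul]

/-- Γ(cc')(x ⊗ 1) = Γ(c)(Γ(c')(x ⊗ 1)), tested by right multiplication in the nondegenerate algebra
Q ⊗ C. -/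
theorem LeftComoduleAlgebra.covR_mul (Γ : LeftComoduleAlgebra HQ C) (x : Q) (c c' : C) :
    Γ.covR x (c * c') =
      mulR (LinearMap.mul k C) (LinearMap.rTensor C (Γ.covR.flip c) (Γ.covR x c')) := by
  refine (NondegenerateProduct.tensor_left HQ.localUnits Γ.nondeg Γ.assoc).eq_of_mul_right
    fun u => ?_
  rw [← left_mul_of_cover Γ.assoc _ _ fun x u => Γ.covR_spec x c u, ← Γ.covR_spec, ← Γ.covR_spec,
    map_mul]
  rfl

theorem RightComoduleAlgebra.covL_mul (Υ : RightComoduleAlgebra HL C) (x : L) (c c' : C) :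
    Υ.covL x (c * c') =
      mulL (LinearMap.mul k C) (LinearMap.lTensor C (Υ.covL.flip c') (Υ.covL x c)) := by
  refine (NondegenerateProduct.tensor_right HL.localUnits Υ.nondeg Υ.assoc).eq_of_mul_left
    fun u => ?_
  rw [← right_mul_of_cover Υ.assoc _ _ fun x u => Υ.covL_spec x c' u, ← Υ.covL_spec,
    ← Υ.covL_spec, map_mul]
  rfl

/-! ### The twisting maps of module algebras and comodule algebras -/

theorem leftTwist_isTwist (M : LeftModuleAlgebra HQ A) (Γ : LeftComoduleAlgebra HQ C) :
    IsTwist M.act Γ.covR (leftTwist M Γ) :=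
  (M.existsUnique_twist Γ).choose_spec.1

theorem rightTwist_isTwist (N : RightModuleAlgebra HL B) (Υ : RightComoduleAlgebra HL C) :
    IsTwist N.act (Υ.covL.compr₂ (TensorProduct.comm k C L).toLinearMap) (rightTwist N Υ) :=
  (N.existsUnique_twist Υ).choose_spec.1

theorem rightTwist'_eq (N : RightModuleAlgebra HL B) (Υ : RightComoduleAlgebra HL C) :
    rightTwist' N Υ = swapTwist (rightTwist N Υ) := rfl

theorem leftTwist_twistsFst (M : LeftModuleAlgebra HQ A) (Γ : LeftComoduleAlgebra HQ C) :
    TwistsFst (LinearMap.mul k A) (leftTwist M Γ) :=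
  (leftTwist_isTwist M Γ).twistsFst M.unital (T := HQ.T₁.toLinearMap) HQ.T₁.surjective
    Γ.coassoc M.act_mul

theorem leftTwist_twistsSnd (M : LeftModuleAlgebra HQ A) (Γ : LeftComoduleAlgebra HQ C) :
    TwistsSnd (LinearMap.mul k C) (leftTwist M Γ) :=
  (leftTwist_isTwist M Γ).twistsSnd M.unital Γ.covR_mul

/-- `x ⊗ y ↦ τ T₂(y ⊗ x)`, the map `T₁` of the opposite algebra with the flipped
comultiplication. -/
def flipT {X : Type*} [AddCommGroup X] [Module k X] (T : X ⊗[k] X ≃ₗ[k] X ⊗[k] X) :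
    X ⊗[k] X ≃ₗ[k] X ⊗[k] X :=
  TensorProduct.comm k X X ≪≫ₗ T ≪≫ₗ TensorProduct.comm k X X

theorem flipT_tmul {X : Type*} [AddCommGroup X] [Module k X]
    (T : X ⊗[k] X ≃ₗ[k] X ⊗[k] X) (x y : X) :
    flipT T (x ⊗ₜ y) = TensorProduct.comm k X X (T (y ⊗ₜ x)) := rfl

/-- Reversing the order of the three tensor legs turns a right coaction of `L` into a left coaction
of the opposite algebra with flipped comultiplication. The result has the shape required by
`IsTwist.twistsFst` and `CoactionCover`. -/
theorem RightComoduleAlgebra.coassoc_flip (Υ : RightComoduleAlgebra HL C) (p y : L) (c : C) :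
    TensorProduct.lift
        ((LinearMap.lTensorHom L ∘ₗ (Υ.covL.compr₂ (TensorProduct.comm k C L).toLinearMap)).flip ∘ₗ
          (Υ.covL.compr₂ (TensorProduct.comm k C L).toLinearMap).flip c)
        (flipT HL.T₂ (p ⊗ₜ y)) =
      TensorProduct.assoc k L L C
        (LinearMap.rTensor C ((flipT HL.T₂).toLinearMap ∘ₗ (TensorProduct.mk k L L).flip y)
          (Υ.covL.compr₂ (TensorProduct.comm k C L).toLinearMap p c)) := by
  -- The order-reversing map c ⊗ (u ⊗ v) ↦ v ⊗ (u ⊗ c).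
  let e : C ⊗[k] (L ⊗[k] L) →ₗ[k] L ⊗[k] (L ⊗[k] C) :=
    (TensorProduct.assoc k L L C).toLinearMap ∘ₗ
      LinearMap.rTensor C (TensorProduct.comm k L L).toLinearMap ∘ₗ
      (TensorProduct.comm k C (L ⊗[k] L)).toLinearMap
  have h := congrArg e (Υ.coassoc p y c)
  have e₁ : ∀ t : L ⊗[k] L,
      e (TensorProduct.assoc k C L L (TensorProduct.lift
          ((LinearMap.rTensorHom L ∘ₗ Υ.covL).compl₂ (Υ.covL.flip c)) t)) =
        TensorProduct.lift
        ((LinearMap.lTensorHom L ∘ₗ (Υ.covL.compr₂ (TensorProduct.comm k C L).toLinearMap)).flip ∘ₗ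
          (Υ.covL.compr₂ (TensorProduct.comm k C L).toLinearMap).flip c)
        (TensorProduct.comm k L L t) := by
    intro t
    induction t using TensorProduct.induction_on with
    | zero => simp
    | add x y hx hy => simp only [map_add, hx, hy]
    | tmul u v =>
      simp only [TensorProduct.lift.tmul, TensorProduct.comm_tmul, LinearMap.compl₂_apply,
        LinearMap.comp_apply, LinearMap.flip_apply, LinearMap.coe_rTensorHom,
        LinearMap.coe_lTensorHom, LinearMap.compr₂_apply, LinearEquiv.coe_coe]
      generalize Υ.covL v c = s
      induction s using TensorProduct.induction_on with
      | zero => simp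
      | add x y hx hy => simp only [map_add, hx, hy]
      | tmul d q =>
        simp only [LinearMap.rTensor_tmul, TensorProduct.comm_tmul, LinearMap.lTensor_tmul,
          LinearMap.compr₂_apply, LinearEquiv.coe_coe]
        generalize Υ.covL u d = s
        induction s using TensorProduct.induction_on with
        | zero => simp
        | add x y hx hy =>
          simp only [map_add, TensorProduct.add_tmul, TensorProduct.tmul_add, hx, hy]
        | tmul d q => simp [e]
  have e₂ : ∀ t : C ⊗[k] L,
      e (LinearMap.lTensor C (HL.T₂.toLinearMap ∘ₗ TensorProduct.mk k L L y) t) =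
      TensorProduct.assoc k L L C
        (LinearMap.rTensor C ((flipT HL.T₂).toLinearMap ∘ₗ (TensorProduct.mk k L L).flip y)
          (TensorProduct.comm k C L t)) := by
    intro t
    induction t using TensorProduct.induction_on with
    | zero => simp
    | add x y hx hy => simp only [map_add, hx, hy]
    | tmul u v => simp [e, flipT]
  rw [e₁, e₂] at h
  exact h

theorem RightComoduleAlgebra.covL_mul_flip (Υ : RightComoduleAlgebra HL C) (x : L) (c c' : C) :
    Υ.covL.compr₂ (TensorProduct.comm k C L).toLinearMap x ((LinearMap.mul k C).flip c c') =
      mulR (LinearMap.mul k C).flip (LinearMap.rTensor C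
        ((Υ.covL.compr₂ (TensorProduct.comm k C L).toLinearMap).flip c)
        (Υ.covL.compr₂ (TensorProduct.comm k C L).toLinearMap x c')) := by
  simp only [LinearMap.compr₂_apply, LinearMap.flip_apply, LinearMap.mul_apply', Υ.covL_mul,
    LinearEquiv.coe_coe]
  generalize Υ.covL x c' = s
  induction s using TensorProduct.induction_on with
  | zero => simp
  | add x y hx hy => simp only [map_add, hx, hy]
  | tmul d q =>
    simp only [LinearMap.lTensor_tmul, mulL_tmul, LinearMap.flip_apply, TensorProduct.comm_tmul,
      LinearMap.rTensor_tmul, mulR_tmul, LinearMap.compr₂_apply, LinearEquiv.coe_coe,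
      LinearMap.flip_flip]
    generalize Υ.covL q c = s
    induction s using TensorProduct.induction_on with
    | zero => simp
    | add x y hx hy => simp only [map_add, hx, hy]
    | tmul d q => simp

/-- A right module algebra over `L` is a left module algebra over the opposite structure, with the
product of `B` reversed; the left-handed lemma then applies. -/
theorem rightTwist_twistsFst (N : RightModuleAlgebra HL B) (Υ : RightComoduleAlgebra HL C) :
    TwistsFst (LinearMap.mul k B).flip (rightTwist N Υ) := by
  refine (rightTwist_isTwist N Υ).twistsFst N.unital (T := (flipT HL.T₂).toLinearMap)
    (flipT HL.T₂).surjective Υ.coassoc_flip fun x z b b' => ?_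
  rw [LinearMap.flip_apply, LinearMap.mul_apply', N.act_mul, LinearEquiv.coe_coe, flipT_tmul]
  generalize HL.T₂ (z ⊗ₜ x) = s
  induction s using TensorProduct.induction_on with
  | zero => simp
  | add x y hx hy => simp only [map_add, hx, hy]
  | tmul d q => simp

theorem rightTwist_twistsSnd (N : RightModuleAlgebra HL B) (Υ : RightComoduleAlgebra HL C) :
    TwistsSnd (LinearMap.mul k C).flip (rightTwist N Υ) :=
  (rightTwist_isTwist N Υ).twistsSnd N.unital Υ.covL_mul_flip

theorem rightTwist'_twistsFst (N : RightModuleAlgebra HL B) (Υ : RightComoduleAlgebra HL C) :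
    TwistsFst (LinearMap.mul k C) (rightTwist' N Υ) :=
  (rightTwist_twistsSnd N Υ).swap

theorem rightTwist'_twistsSnd (N : RightModuleAlgebra HL B) (Υ : RightComoduleAlgebra HL C) :
    TwistsSnd (LinearMap.mul k B) (rightTwist' N Υ) :=
  (rightTwist_twistsFst N Υ).swap

/-- `coact_comm` is the hypothesis of `IsTwist.commute` after the leg `L` has been moved to the
front. -/
theorem BicomoduleAlgebra.twistsCommute (Γ : BicomoduleAlgebra HQ HL C)
    (M : LeftModuleAlgebra HQ A) (N : RightModuleAlgebra HL B) :
    TwistsCommute (leftTwist M Γ.left) (rightTwist N Γ.right) := by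
  refine (leftTwist_isTwist M Γ.left).commute M.unital (rightTwist_isTwist N Γ.right) N.unital
    fun x y c => ?_
  -- move `L` to the front in `coact_comm`
  let e : Q ⊗[k] (C ⊗[k] L) →ₗ[k] L ⊗[k] (Q ⊗[k] C) :=
    (TensorProduct.leftComm k Q L C).toLinearMap ∘ₗ
      LinearMap.lTensor Q (TensorProduct.comm k C L).toLinearMap
  have h := congrArg e (Γ.coact_comm x y c)
  have e₁ : ∀ t : C ⊗[k] L,
      e (TensorProduct.assoc k Q C L (LinearMap.rTensor L (Γ.left.covR y) t)) =
      LinearMap.lTensor L (Γ.left.covR y) (TensorProduct.comm k C L t) := by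
    intro t
    induction t using TensorProduct.induction_on with
    | zero => simp
    | add x y hx hy => simp only [map_add, hx, hy]
    | tmul d q =>
      simp only [LinearMap.rTensor_tmul, TensorProduct.comm_tmul, LinearMap.lTensor_tmul]
      generalize Γ.left.covR y d = s
      induction s using TensorProduct.induction_on with
      | zero => simp
      | add x y hx hy => simp only [map_add, TensorProduct.add_tmul, TensorProduct.tmul_add, hx, hy]
      | tmul d q => simp [e]
  rw [e₁] at h
  rw [LinearMap.compr₂_apply, LinearEquiv.coe_coe, ← h]
  generalize Γ.left.covR y c = s
  induction s using TensorProduct.induction_on with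
  | zero => simp
  | add x y hx hy => simp only [map_add, hx, hy]
  | tmul d q => simp [e]

end Covers

/-! ### The antipode and covered coactions -/

/-- The maps `T₁(x ⊗ y) = Δ(x)(1 ⊗ y)` and `T₂(x ⊗ y) = (x ⊗ 1)Δ(y)` of a multiplier Hopf algebra
with product `m`, counit `ε` and invertible antipode `S`. -/
structure HopfCover (k Q : Type*) [Field k] [AddCommGroup Q] [Module k Q] where
  m : Q →ₗ[k] Q →ₗ[k] Q
  T₁ : Q ⊗[k] Q ≃ₗ[k] Q ⊗[k] Q
  T₂ : Q ⊗[k] Q ≃ₗ[k] Q ⊗[k] Q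
  S : Q ≃ₗ[k] Q
  counit : Q →ₗ[k] k
  assoc : ∀ x y z, m (m x y) z = m x (m y z)
  units : ∀ x, ∃ e f, m e x = x ∧ m x f = x
  T₂_mul_T₁ : ∀ x w p y, TensorProduct.map₂ m m (T₂ (x ⊗ₜ w)) (T₁ (p ⊗ₜ y)) =
    LinearMap.rTensor Q (m x) (T₁ (m w p ⊗ₜ y))
  counit_mul : ∀ x y, counit (m x y) = counit x * counit y
  counit_ne_zero : Nontrivial Q → counit ≠ 0
  counit_T₁_left : ∀ x y, TensorProduct.lid k Q (LinearMap.rTensor Q counit (T₁ (x ⊗ₜ y))) = m x y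
  antipode_T₁ : ∀ x y, TensorProduct.lift (m ∘ₗ S.toLinearMap) (T₁ (x ⊗ₜ y)) = counit x • y
  antipode_T₂ : ∀ x y,
    TensorProduct.lift (m.flip ∘ₗ S.symm.toLinearMap) (T₂ (x ⊗ₜ y)) = counit y • S.symm x

/-- A covered coaction of a multiplier Hopf algebra: `G x c = Γ(c)(x ⊗ 1)` and
`G' x c = (x ⊗ 1)Γ(c)`. -/
structure CoactionCover {k Q : Type*} [Field k] [AddCommGroup Q] [Module k Q] (H : HopfCover k Q)
    (C : Type*) [AddCommGroup C] [Module k C] where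
  G : Q →ₗ[k] C →ₗ[k] Q ⊗[k] C
  G' : Q →ₗ[k] C →ₗ[k] Q ⊗[k] C
  compat : ∀ f x c,
    LinearMap.rTensor C (H.m f) (G x c) = LinearMap.rTensor C (H.m.flip x) (G' f c)
  coassoc : ∀ p y c,
    TensorProduct.lift ((LinearMap.lTensorHom Q ∘ₗ G).flip ∘ₗ G.flip c) (H.T₁ (p ⊗ₜ y)) =
      TensorProduct.assoc k Q Q C
        (LinearMap.rTensor C (H.T₁.toLinearMap ∘ₗ (TensorProduct.mk k Q Q).flip y) (G p c))
  injective : ∀ c, (∀ x, G x c = 0) → c = 0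

namespace CoactionCover

variable {k Q C : Type*} [Field k] [AddCommGroup Q] [Module k Q] [AddCommGroup C] [Module k C]
  {H : HopfCover k Q} (Γ : CoactionCover H C)

/-- Apply the counit to the first leg. -/
def slice (H : HopfCover k Q) (C : Type*) [AddCommGroup C] [Module k C] : Q ⊗[k] C →ₗ[k] C :=
  (TensorProduct.lid k C).toLinearMap ∘ₗ LinearMap.rTensor C H.counit

@[simp]
theorem slice_tmul (x : Q) (c : C) : slice H C (x ⊗ₜ c) = H.counit x • c := by
  simp [slice]

theorem slice_rTensor_mul (x : Q) (t : Q ⊗[k] C) :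
    slice H C (LinearMap.rTensor C (H.m x) t) = H.counit x • slice H C t := by
  induction t using TensorProduct.induction_on with
  | zero => simp
  | add x y hx hy => simp only [map_add, smul_add, hx, hy]
  | tmul q d => simp [H.counit_mul, mul_smul]

theorem slice_rTensor_mul_flip (x : Q) (t : Q ⊗[k] C) :
    slice H C (LinearMap.rTensor C (H.m.flip x) t) = H.counit x • slice H C t := by
  induction t using TensorProduct.induction_on with
  | zero => simp
  | add x y hx hy => simp only [map_add, smul_add, hx, hy]
  | tmul q d => simp [H.counit_mul, smul_smul, mul_comm]

/-- The counit is multiplicative, so applying it to (x ⊗ 1)Γ(c)(y ⊗ 1) splits off either outer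
factor. -/
theorem slice_compat (x y : Q) (c : C) :
    H.counit x • slice H C (Γ.G y c) = H.counit y • slice H C (Γ.G' x c) := by
  rw [← slice_rTensor_mul, ← slice_rTensor_mul_flip, Γ.compat]

/-- This disposes of the case Q = 0, where there is no element of counit one. -/
theorem subsingleton (Γ : CoactionCover H C) (hQ : ¬ Nontrivial Q) (c : C) : c = 0 := by
  rw [not_nontrivial_iff_subsingleton] at hQ
  refine Γ.injective c fun x => ?_
  rw [Subsingleton.elim x 0]
  simp

theorem eq_of_rTensor_mul {s t : Q ⊗[k] C}
    (h : ∀ f, LinearMap.rTensor C (H.m f) s = LinearMap.rTensor C (H.m f) t) : s = t := by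
  rw [← sub_eq_zero]
  refine eq_zero_of_forall_rTensor (fun f => H.m f) (fun x hx => ?_) _ fun f => ?_
  · obtain ⟨e, _, he, _⟩ := H.units x
    rw [← he, hx]
  · rw [map_sub, h, sub_self]

theorem eq_of_rTensor_mul_flip {s t : Q ⊗[k] C}
    (h : ∀ f, LinearMap.rTensor C (H.m.flip f) s = LinearMap.rTensor C (H.m.flip f) t) :
    s = t := by
  rw [← sub_eq_zero]
  refine eq_zero_of_forall_rTensor (fun f => H.m.flip f) (fun x hx => ?_) _ fun f => ?_
  · obtain ⟨_, e, _, he⟩ := H.units x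
    rw [← he]
    exact hx e
  · rw [map_sub, h, sub_self]

theorem rTensor_mul_mul_flip (x y : Q) (t : Q ⊗[k] C) :
    LinearMap.rTensor C (H.m x) (LinearMap.rTensor C (H.m.flip y) t) =
      LinearMap.rTensor C (H.m.flip y) (LinearMap.rTensor C (H.m x) t) := by
  rw [← LinearMap.rTensor_comp_apply, ← LinearMap.rTensor_comp_apply]
  congr 2
  ext z
  simp [H.assoc]

theorem G_mul (p y : Q) (c : C) :
    Γ.G (H.m p y) c = LinearMap.rTensor C (H.m.flip y) (Γ.G p c) := by
  refine eq_of_rTensor_mul (H := H) fun f => ?_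
  rw [rTensor_mul_mul_flip, Γ.compat, Γ.compat, ← LinearMap.rTensor_comp_apply]
  congr 2
  ext z
  simp [H.assoc]

/-- The counit axiom (ε ⊗ ι)Γ(c) = c is not part of a coaction; it follows from injectivity.
Applying ε to the first leg of coassociativity shows that `c` and its slice have the same covers,
hence coincide. -/
theorem slice_G (x : Q) (c : C) : slice H C (Γ.G x c) = H.counit x • c := by
  by_cases hQ : Nontrivial Q
  swap
  · rw [Γ.subsingleton hQ c]
    simp
  obtain ⟨z, hz⟩ : ∃ z, H.counit z = 1 := by
    by_contra! h
    apply H.counit_ne_zero hQ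
    ext z
    by_contra hz
    exact h ((H.counit z)⁻¹ • z) (by simp [inv_mul_cancel₀ (show H.counit z ≠ 0 from hz)])
  -- `E` is the only candidate for (ε ⊗ ι)Γ: since ε(z) = 1, `slice_compat` shows that each slice of
  -- a cover is a multiple of it.
  let E : C →ₗ[k] C := slice H C ∘ₗ Γ.G' z
  have hE : ∀ v c, slice H C (Γ.G v c) = H.counit v • E c := by
    intro v c
    have := Γ.slice_compat z v c
    rwa [hz, one_smul] at this
  suffices h : E c = c by rw [hE, h]
  rw [← sub_eq_zero]
  refine Γ.injective _ fun x => ?_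
  -- apply the counit to the first leg of the coassociativity
  have h₁ : ∀ p y : Q, Γ.G (H.m p y) (E c) = Γ.G (H.m p y) c := by
    intro p y
    have h := congrArg (slice H (Q ⊗[k] C)) (Γ.coassoc p y c)
    have e₁ : ∀ t : Q ⊗[k] Q, slice H (Q ⊗[k] C) (TensorProduct.lift
        ((LinearMap.lTensorHom Q ∘ₗ Γ.G).flip ∘ₗ Γ.G.flip c) t) =
        Γ.G (TensorProduct.lid k Q (LinearMap.rTensor Q H.counit t)) (E c) := by
      intro t
      induction t using TensorProduct.induction_on with
      | zero => simp
      | add x y hx hy => simp only [map_add, LinearMap.add_apply, hx, hy]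
      | tmul u v =>
        simp only [TensorProduct.lift.tmul, LinearMap.comp_apply, LinearMap.flip_apply,
          LinearMap.coe_lTensorHom, LinearMap.rTensor_tmul, TensorProduct.lid_tmul, map_smul,
          LinearMap.smul_apply]
        rw [← map_smul, ← hE]
        generalize Γ.G u c = s
        induction s using TensorProduct.induction_on with
        | zero => simp
        | add x y hx hy => simp only [map_add, hx, hy]
        | tmul u v => simp
    have e₂ : ∀ t : Q ⊗[k] C, slice H (Q ⊗[k] C) (TensorProduct.assoc k Q Q C
        (LinearMap.rTensor C (H.T₁.toLinearMap ∘ₗ (TensorProduct.mk k Q Q).flip y) t)) =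
        LinearMap.rTensor C (H.m.flip y) t := by
      intro t
      induction t using TensorProduct.induction_on with
      | zero => simp
      | add x y hx hy => simp only [map_add, hx, hy]
      | tmul u v =>
        simp only [LinearMap.rTensor_tmul, LinearMap.comp_apply, LinearMap.flip_apply,
          TensorProduct.mk_apply, LinearEquiv.coe_coe, ← H.counit_T₁_left]
        generalize H.T₁ (u ⊗ₜ y) = s
        induction s using TensorProduct.induction_on with
        | zero => simp
        | add x y hx hy => simp only [map_add, TensorProduct.add_tmul, hx, hy]
        | tmul u v => simp [TensorProduct.smul_tmul']
    rw [e₁, e₂, H.counit_T₁_left] at h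
    rw [h, G_mul]
  obtain ⟨_, e, _, he⟩ := H.units x
  rw [map_sub, ← he, h₁, sub_self]

theorem slice_G' (x : Q) (c : C) : slice H C (Γ.G' x c) = H.counit x • c := by
  by_cases hQ : Nontrivial Q
  swap
  · rw [Γ.subsingleton hQ c]
    simp
  obtain ⟨z, hz⟩ : ∃ z, H.counit z ≠ 0 := by
    by_contra! h
    exact H.counit_ne_zero hQ (LinearMap.ext h)
  have h := Γ.slice_compat x z c
  rw [slice_G, smul_comm] at h
  exact (smul_right_injective C hz h).symm

/-- `∑ (S(q) ⊗ 1) Γ(d) = S(x) ⊗ c` for `Γ(c)(x ⊗ 1) = ∑ q ⊗ d`. -/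
theorem lift_antipode_G (x : Q) (c : C) :
    TensorProduct.lift (Γ.G' ∘ₗ H.S.toLinearMap) (Γ.G x c) = H.S x ⊗ₜ c := by
  refine eq_of_rTensor_mul_flip (H := H) fun v => ?_
  -- Ψ(q ⊗ u ⊗ d) = S(q)u ⊗ d, the antipode equation applied to the first two legs.
  let Ψ : Q ⊗[k] (Q ⊗[k] C) →ₗ[k] Q ⊗[k] C :=
    LinearMap.rTensor C (TensorProduct.lift (H.m ∘ₗ H.S.toLinearMap)) ∘ₗ
      (TensorProduct.assoc k Q Q C).symm.toLinearMap
  have hΨ : ∀ q s, Ψ (q ⊗ₜ s) = LinearMap.rTensor C (H.m (H.S q)) s := by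
    intro q s
    induction s using TensorProduct.induction_on with
    | zero => simp
    | add x y hx hy => simp only [map_add, TensorProduct.tmul_add, hx, hy]
    | tmul u v => simp [Ψ]
  -- Tested on T₁(p ⊗ y): by coassociativity and the antipode equation the left side is y ⊗ ∑ ε(q)d
  -- with Γ(c)(p ⊗ 1) = ∑ q ⊗ d, and the counit property makes this ε(p) y ⊗ c.
  have key : Ψ ∘ₗ TensorProduct.lift ((LinearMap.lTensorHom Q ∘ₗ Γ.G).flip ∘ₗ Γ.G.flip c) =
      (TensorProduct.mk k Q C).flip c ∘ₗ TensorProduct.lift (H.m ∘ₗ H.S.toLinearMap) := by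
    rw [← LinearMap.cancel_right (g := H.T₁.toLinearMap) H.T₁.surjective]
    apply TensorProduct.ext'
    intro p y
    change Ψ (TensorProduct.lift _ (H.T₁ (p ⊗ₜ y))) =
      TensorProduct.lift (H.m ∘ₗ H.S.toLinearMap) (H.T₁ (p ⊗ₜ y)) ⊗ₜ c
    rw [Γ.coassoc, H.antipode_T₁, TensorProduct.smul_tmul, ← Γ.slice_G]
    generalize Γ.G p c = s
    induction s using TensorProduct.induction_on with
    | zero => simp
    | add x y hx hy => simp only [map_add, TensorProduct.tmul_add, hx, hy]
    | tmul u v =>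
      simp only [Ψ, LinearMap.rTensor_tmul, LinearMap.comp_apply, LinearMap.flip_apply,
        TensorProduct.mk_apply, LinearEquiv.coe_coe,
        LinearEquiv.symm_apply_apply, H.antipode_T₁, slice_tmul, TensorProduct.smul_tmul]
  have h := LinearMap.congr_fun key (x ⊗ₜ v)
  simp only [LinearMap.comp_apply, TensorProduct.lift.tmul, LinearMap.flip_apply,
    TensorProduct.mk_apply, LinearEquiv.coe_coe] at h
  rw [LinearMap.rTensor_tmul, LinearMap.flip_apply, ← h]
  generalize Γ.G x c = s
  induction s using TensorProduct.induction_on with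
  | zero => simp
  | add x y hx hy => simp only [map_add, hx, hy]
  | tmul q d => simp [hΨ, Γ.compat]

/-- The elements T₁(p ⊗ y) span Q ⊗ Q, so right multiplication by them includes right multiplication
by pure tensors, which local units make jointly injective. -/
theorem eq_of_map₂_flip {s t : (Q ⊗[k] Q) ⊗[k] C}
    (h : ∀ p y, LinearMap.rTensor C ((TensorProduct.map₂ H.m H.m).flip (H.T₁ (p ⊗ₜ y))) s =
      LinearMap.rTensor C ((TensorProduct.map₂ H.m H.m).flip (H.T₁ (p ⊗ₜ y))) t) : s = t := by
  have h' : ∀ z, LinearMap.rTensor C ((TensorProduct.map₂ H.m H.m).flip z) s =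
      LinearMap.rTensor C ((TensorProduct.map₂ H.m H.m).flip z) t := by
    intro z
    obtain ⟨z, rfl⟩ := H.T₁.surjective z
    induction z using TensorProduct.induction_on with
    | zero => simp
    | add x y hx hy => simp only [map_add, LinearMap.rTensor_add, LinearMap.add_apply, hx, hy]
    | tmul p y => exact h p y
  rw [← sub_eq_zero]
  refine eq_zero_of_forall_rTensor (fun z => (TensorProduct.map₂ H.m H.m).flip z)
    (fun r hr => ?_) _ fun z => ?_
  · refine eq_of_rTensor_mul_flip (H := H) (t := 0) fun f => ?_
    rw [map_zero]
    refine eq_zero_of_forall_lTensor (fun f => H.m.flip f) (fun x hx => ?_) _ fun f' => ?_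
    · obtain ⟨_, e, _, he⟩ := H.units x
      rw [← he]
      exact hx e
    · have := hr (f ⊗ₜ f')
      rw [← this, LinearMap.flip_apply]
      clear hr this
      induction r using TensorProduct.induction_on with
      | zero => simp
      | add x y hx hy => simp only [map_add, LinearMap.add_apply, hx, hy]
      | tmul p y => simp
  · rw [map_sub, h', sub_self]

/-- Both sides are z · (ι ⊗ Γ)Γ(c) · t. For pure tensors `z` and `t` they agree by using `compat`
once on each `Q` leg. -/
theorem rTensor_map₂_coassoc (t z : Q ⊗[k] Q) (c : C) :
    LinearMap.rTensor C ((TensorProduct.map₂ H.m H.m).flip t) ((TensorProduct.assoc k Q Q C).symm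
      (TensorProduct.lift ((LinearMap.lTensorHom Q ∘ₗ Γ.G').flip ∘ₗ Γ.G'.flip c) z)) =
    LinearMap.rTensor C (TensorProduct.map₂ H.m H.m z) ((TensorProduct.assoc k Q Q C).symm
      (TensorProduct.lift ((LinearMap.lTensorHom Q ∘ₗ Γ.G).flip ∘ₗ Γ.G.flip c) t)) := by
  induction z using TensorProduct.induction_on with
  | zero => simp
  | add x y hx hy => simp only [map_add, LinearMap.rTensor_add, LinearMap.add_apply, hx, hy]
  | tmul x s =>
  induction t using TensorProduct.induction_on with
  | zero => simp
  | add x y hx hy => simp only [map_add, LinearMap.rTensor_add, LinearMap.add_apply, hx, hy]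
  | tmul u v =>
  let P : Q ⊗[k] C →ₗ[k] (Q ⊗[k] Q) ⊗[k] C := (TensorProduct.assoc k Q Q C).symm.toLinearMap ∘ₗ
    LinearMap.lTensor Q (LinearMap.rTensor C (H.m s) ∘ₗ Γ.G v)
  have e₁ : ∀ r : Q ⊗[k] C,
      LinearMap.rTensor C ((TensorProduct.map₂ H.m H.m).flip (u ⊗ₜ v))
        ((TensorProduct.assoc k Q Q C).symm (LinearMap.lTensor Q (Γ.G' s) r)) =
      P (LinearMap.rTensor C (H.m.flip u) r) := by
    intro r
    induction r using TensorProduct.induction_on with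
    | zero => simp
    | add x y hx hy => simp only [map_add, hx, hy]
    | tmul q d =>
      simp only [P, LinearMap.rTensor_tmul, LinearMap.lTensor_tmul, LinearMap.comp_apply,
        LinearEquiv.coe_coe, Γ.compat]
      generalize Γ.G' s d = r
      induction r using TensorProduct.induction_on with
      | zero => simp
      | add x y hx hy => simp only [map_add, TensorProduct.tmul_add, hx, hy]
      | tmul q d => simp
  have e₂ : ∀ r : Q ⊗[k] C,
      LinearMap.rTensor C (TensorProduct.map₂ H.m H.m (x ⊗ₜ s))
        ((TensorProduct.assoc k Q Q C).symm (LinearMap.lTensor Q (Γ.G v) r)) =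
      P (LinearMap.rTensor C (H.m x) r) := by
    intro r
    induction r using TensorProduct.induction_on with
    | zero => simp
    | add x y hx hy => simp only [map_add, hx, hy]
    | tmul q d =>
      simp only [P, LinearMap.rTensor_tmul, LinearMap.lTensor_tmul, LinearMap.comp_apply,
        LinearEquiv.coe_coe]
      generalize Γ.G v d = r
      induction r using TensorProduct.induction_on with
      | zero => simp
      | add x y hx hy => simp only [map_add, TensorProduct.tmul_add, hx, hy]
      | tmul q d => simp
  simp only [TensorProduct.lift.tmul, LinearMap.comp_apply, LinearMap.flip_apply,
    LinearMap.coe_lTensorHom]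
  rw [e₁, e₂, Γ.compat]

/-- Coassociativity in terms of `(x ⊗ 1)Γ(c)`. -/
theorem coassoc' (x w : Q) (c : C) :
    TensorProduct.lift ((LinearMap.lTensorHom Q ∘ₗ Γ.G').flip ∘ₗ Γ.G'.flip c) (H.T₂ (x ⊗ₜ w)) =
      TensorProduct.assoc k Q Q C
        (LinearMap.rTensor C (H.T₂.toLinearMap ∘ₗ TensorProduct.mk k Q Q x) (Γ.G' w c)) := by
  apply (TensorProduct.assoc k Q Q C).symm.injective
  -- Multiplication by T₁(p ⊗ y) on the right replaces left covers by right covers, to which the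
  -- known coassociativity applies.
  refine eq_of_map₂_flip (H := H) fun p y => ?_
  rw [rTensor_map₂_coassoc, Γ.coassoc, LinearEquiv.symm_apply_apply, LinearEquiv.symm_apply_apply]
  -- Ξ(q ⊗ d) = (x ⊗ 1)Δ(q)(1 ⊗ y) ⊗ d. The two sides are Ξ of (w ⊗ 1)(Γ(c)(p ⊗ 1)) and of ((w ⊗
  -- 1)Γ(c))(p ⊗ 1), equal by `compat`.
  let Ξ : Q ⊗[k] C →ₗ[k] (Q ⊗[k] Q) ⊗[k] C := LinearMap.rTensor C
    (LinearMap.rTensor Q (H.m x) ∘ₗ H.T₁.toLinearMap ∘ₗ (TensorProduct.mk k Q Q).flip y)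
  have e₁ : ∀ r : Q ⊗[k] C, LinearMap.rTensor C (TensorProduct.map₂ H.m H.m (H.T₂ (x ⊗ₜ w)))
      (LinearMap.rTensor C (H.T₁.toLinearMap ∘ₗ (TensorProduct.mk k Q Q).flip y) r) =
      Ξ (LinearMap.rTensor C (H.m w) r) := by
    intro r
    induction r using TensorProduct.induction_on with
    | zero => simp
    | add x y hx hy => simp only [map_add, hx, hy]
    | tmul q d => simp [Ξ, H.T₂_mul_T₁]
  have e₂ : ∀ r : Q ⊗[k] C,
      LinearMap.rTensor C ((TensorProduct.map₂ H.m H.m).flip (H.T₁ (p ⊗ₜ y)))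
      (LinearMap.rTensor C (H.T₂.toLinearMap ∘ₗ TensorProduct.mk k Q Q x) r) =
      Ξ (LinearMap.rTensor C (H.m.flip p) r) := by
    intro r
    induction r using TensorProduct.induction_on with
    | zero => simp
    | add x y hx hy => simp only [map_add, hx, hy]
    | tmul q d => simp [Ξ, H.T₂_mul_T₁]
  rw [e₁, e₂, Γ.compat]

/-- `∑ Γ(d)(S⁻¹(q) ⊗ 1) = S⁻¹(x) ⊗ c` for `(x ⊗ 1)Γ(c) = ∑ q ⊗ d`. -/
theorem lift_antipode_G' (x : Q) (c : C) :
    TensorProduct.lift (Γ.G ∘ₗ H.S.symm.toLinearMap) (Γ.G' x c) = H.S.symm x ⊗ₜ c := by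
  refine eq_of_rTensor_mul (H := H) fun v => ?_
  let Ψ : Q ⊗[k] (Q ⊗[k] C) →ₗ[k] Q ⊗[k] C :=
    LinearMap.rTensor C (TensorProduct.lift (H.m.flip ∘ₗ H.S.symm.toLinearMap)) ∘ₗ
      (TensorProduct.assoc k Q Q C).symm.toLinearMap
  have hΨ : ∀ q s, Ψ (q ⊗ₜ s) = LinearMap.rTensor C (H.m.flip (H.S.symm q)) s := by
    intro q s
    induction s using TensorProduct.induction_on with
    | zero => simp
    | add x y hx hy => simp only [map_add, TensorProduct.tmul_add, hx, hy]
    | tmul u v => simp [Ψ]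
  have key : Ψ ∘ₗ TensorProduct.lift ((LinearMap.lTensorHom Q ∘ₗ Γ.G').flip ∘ₗ Γ.G'.flip c) =
      (TensorProduct.mk k Q C).flip c ∘ₗ
        TensorProduct.lift (H.m.flip ∘ₗ H.S.symm.toLinearMap) := by
    rw [← LinearMap.cancel_right (g := H.T₂.toLinearMap) H.T₂.surjective]
    apply TensorProduct.ext'
    intro p y
    change Ψ (TensorProduct.lift _ (H.T₂ (p ⊗ₜ y))) =
      TensorProduct.lift (H.m.flip ∘ₗ H.S.symm.toLinearMap) (H.T₂ (p ⊗ₜ y)) ⊗ₜ c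
    rw [Γ.coassoc', H.antipode_T₂, TensorProduct.smul_tmul, ← Γ.slice_G']
    generalize Γ.G' y c = s
    induction s using TensorProduct.induction_on with
    | zero => simp
    | add x y hx hy => simp only [map_add, TensorProduct.tmul_add, hx, hy]
    | tmul u v =>
      simp only [Ψ, LinearMap.rTensor_tmul, LinearMap.comp_apply,
        TensorProduct.mk_apply, LinearEquiv.coe_coe,
        LinearEquiv.symm_apply_apply, H.antipode_T₂, slice_tmul, TensorProduct.smul_tmul]
  have h := LinearMap.congr_fun key (x ⊗ₜ v)
  simp only [LinearMap.comp_apply, TensorProduct.lift.tmul, LinearMap.flip_apply,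
    TensorProduct.mk_apply, LinearEquiv.coe_coe] at h
  rw [LinearMap.rTensor_tmul, ← h]
  generalize Γ.G' x c = s
  induction s using TensorProduct.induction_on with
  | zero => simp
  | add x y hx hy => simp only [map_add, hx, hy]
  | tmul q d => simp [hΨ, Γ.compat]

section Twist

variable {V : Type*} [AddCommGroup V] [Module k V] {act : Q →ₗ[k] V →ₗ[k] V}
  {R R' : C ⊗[k] V →ₗ[k] V ⊗[k] C}

/-- Letting the `Q` leg of `lift_antipode_G'` act on `v` gives the identity on vectors S⁻¹(x) ▷ v,
which are all the x ▷ v because `S` is bijective. -/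
theorem twist_twistInv
    (hunit : Submodule.span k {w : V | ∃ (x : Q) (v : V), act x v = w} = ⊤)
    (hR : IsTwist act Γ.G R)
    (hR' : ∀ x c v, R' (c ⊗ₜ act (H.S.symm x) v) =
      LinearMap.rTensor C (act.flip v ∘ₗ H.S.symm.toLinearMap) (Γ.G' x c)) (z : C ⊗[k] V) :
    R (TensorProduct.comm k V C (R' z)) = TensorProduct.comm k C V z := by
  induction z using TensorProduct.induction_on with
  | zero => simp
  | add x y hx hy => simp only [map_add, hx, hy]
  | tmul c v =>
  induction v using unital_induction hunit with
  | zero => simp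
  | add v w hv hw => simp only [TensorProduct.tmul_add, map_add, hv, hw]
  | mem x v =>
  obtain ⟨x, rfl⟩ := H.S.symm.surjective x
  have h := congrArg (LinearMap.rTensor C (act.flip v)) (Γ.lift_antipode_G' x c)
  rw [hR', TensorProduct.comm_tmul]
  rw [LinearMap.rTensor_tmul, LinearMap.flip_apply] at h
  rw [← h]
  generalize Γ.G' x c = s
  induction s using TensorProduct.induction_on with
  | zero => simp
  | add x y hx hy => simp only [map_add, hx, hy]
  | tmul q d => simp [hR _ d v]

theorem twistInv_twist
    (hunit : Submodule.span k {w : V | ∃ (x : Q) (v : V), act x v = w} = ⊤)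
    (hR : IsTwist act Γ.G R)
    (hR' : ∀ x c v, R' (c ⊗ₜ act (H.S.symm x) v) =
      LinearMap.rTensor C (act.flip v ∘ₗ H.S.symm.toLinearMap) (Γ.G' x c)) (z : C ⊗[k] V) :
    R' (TensorProduct.comm k V C (R z)) = TensorProduct.comm k C V z := by
  induction z using TensorProduct.induction_on with
  | zero => simp
  | add x y hx hy => simp only [map_add, hx, hy]
  | tmul c v =>
  induction v using unital_induction hunit with
  | zero => simp
  | add v w hv hw => simp only [TensorProduct.tmul_add, map_add, hv, hw]
  | mem x v =>
  have h := congrArg (LinearMap.rTensor C (act.flip v ∘ₗ H.S.symm.toLinearMap))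
    (Γ.lift_antipode_G x c)
  rw [hR, TensorProduct.comm_tmul]
  rw [LinearMap.rTensor_tmul, LinearMap.comp_apply, LinearEquiv.coe_coe,
    LinearEquiv.symm_apply_apply, LinearMap.flip_apply] at h
  rw [← h]
  generalize Γ.G x c = s
  induction s using TensorProduct.induction_on with
  | zero => simp
  | add x y hx hy => simp only [map_add, hx, hy]
  | tmul q d =>
    have := hR' (H.S q) d v
    rw [LinearEquiv.symm_apply_apply] at this
    simp [this]

end Twist

end CoactionCover

/-! ### The antipode of a regular multiplier Hopf algebra -/

section Slices

variable {k Q : Type*} [Field k] [AddCommGroup Q] [Module k Q]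

/-- `ε ⊗ ι` -/
def sliceFst (ε : Q →ₗ[k] k) : Q ⊗[k] Q →ₗ[k] Q :=
  (TensorProduct.lid k Q).toLinearMap ∘ₗ LinearMap.rTensor Q ε

/-- `ι ⊗ ε` -/
def sliceSnd (ε : Q →ₗ[k] k) : Q ⊗[k] Q →ₗ[k] Q :=
  (TensorProduct.rid k Q).toLinearMap ∘ₗ LinearMap.lTensor Q ε

@[simp]
theorem sliceFst_tmul (ε : Q →ₗ[k] k) (x y : Q) : sliceFst ε (x ⊗ₜ y) = ε x • y := by
  simp [sliceFst]

@[simp]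
theorem sliceSnd_tmul (ε : Q →ₗ[k] k) (x y : Q) : sliceSnd ε (x ⊗ₜ y) = ε y • x := by
  simp [sliceSnd]

theorem comm_comm_apply (u : Q ⊗[k] Q) :
    TensorProduct.comm k Q Q (TensorProduct.comm k Q Q u) = u :=
  (TensorProduct.comm k Q Q).symm_apply_apply u

end Slices

section Antipode

variable {k Q : Type*} [Field k] [NonUnitalRing Q] [Module k Q]
    [SMulCommClass k Q Q] [IsScalarTower k Q Q]

theorem HasLocalUnits.nondegenerate (h : HasLocalUnits Q) : NondegenerateProduct Q := by
  constructor
  · intro a ha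
    obtain ⟨e, f, hef⟩ := h {a}
    rw [← (hef a (by simp)).2, ha]
  · intro a ha
    obtain ⟨e, f, hef⟩ := h {a}
    rw [← (hef a (by simp)).1, ha]

/-- A multiplier is given by a compatible pair of linear maps only; nondegeneracy makes its left
part a map of right modules. -/
theorem Multiplier.left_mul {X : Type*} [NonUnitalNonAssocRing X] [Module k X]
    [SMulCommClass k X X] [IsScalarTower k X X] (hX : NondegenerateProduct X)
    (hass : ∀ a b c : X, a * b * c = a * (b * c)) (m : Multiplier k X)
    (u v : X) : Multiplier.left m (u * v) = Multiplier.left m u * v := by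
  refine hX.eq_of_mul_left fun w => ?_
  rw [← Multiplier.right_mul, ← hass, ← hass, ← Multiplier.right_mul]

theorem sndMul_fstMul (x y : Q) (u : Q ⊗[k] Q) :
    sndMul y (fstMul x u) = fstMul x (sndMul y u) :=
  (rTensor_lTensor_comm _ _ _).symm

theorem mulSnd_mulFst (x y : Q) (u : Q ⊗[k] Q) :
    mulSnd y (mulFst x u) = mulFst x (mulSnd y u) :=
  (rTensor_lTensor_comm _ _ _).symm

theorem tmul_mul_eq (x y : Q) (u : Q ⊗[k] Q) : (x ⊗ₜ y) * u = sndMul y (fstMul x u) := by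
  induction u using TensorProduct.induction_on with
  | zero => simp
  | add x y hx hy => simp only [map_add, mul_add, hx, hy]
  | tmul a b => simp [sndMul, fstMul]

theorem comm_mulFst (x : Q) (u : Q ⊗[k] Q) :
    TensorProduct.comm k Q Q (mulFst x u) = mulSnd x (TensorProduct.comm k Q Q u) := by
  induction u using TensorProduct.induction_on with
  | zero => simp
  | add x y hx hy => simp only [map_add, hx, hy]
  | tmul a b => simp [mulFst, mulSnd]

theorem comm_fstMul (x : Q) (u : Q ⊗[k] Q) :
    TensorProduct.comm k Q Q (fstMul x u) = sndMul x (TensorProduct.comm k Q Q u) := by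
  induction u using TensorProduct.induction_on with
  | zero => simp
  | add x y hx hy => simp only [map_add, hx, hy]
  | tmul a b => simp [fstMul, sndMul]

namespace MultiplierHopfAlgebra

variable (H : MultiplierHopfAlgebra k Q)

theorem nondegenerate (H : MultiplierHopfAlgebra k Q) : NondegenerateProduct Q :=
  H.localUnits.nondegenerate

theorem nondegenerate_tensor (H : MultiplierHopfAlgebra k Q) :
    NondegenerateProduct (Q ⊗[k] Q) :=
  NondegenerateProduct.tensor_left H.localUnits H.nondegenerate mul_assoc

/-- Δ(a)Δ(b)(1 ⊗ y) = Δ(ab)(1 ⊗ y). Since T₁ is surjective, this describes left multiplication by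
Δ(a) on all of Q ⊗ Q. -/
theorem comul_T₁ (a b y : Q) :
    Multiplier.left (H.comul a) (H.T₁ (b ⊗ₜ y)) = H.T₁ ((a * b) ⊗ₜ y) := by
  refine H.nondegenerate_tensor.eq_of_mul_right fun u => ?_
  rw [← Multiplier.left_mul H.nondegenerate_tensor mul_assoc, ← H.T₁_spec, ← H.T₁_spec, map_mul]
  rfl

theorem T₂_mul (x w : Q) (u : Q ⊗[k] Q) :
    H.T₂ (x ⊗ₜ w) * u = fstMul x (Multiplier.left (H.comul w) u) := by
  refine H.nondegenerate_tensor.eq_of_mul_left fun v => ?_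
  rw [← mul_assoc, ← H.T₂_spec, Multiplier.right_mul, mul_fstMul]

theorem T₂_mul_T₁ (x w p y : Q) :
    H.T₂ (x ⊗ₜ w) * H.T₁ (p ⊗ₜ y) = fstMul x (H.T₁ ((w * p) ⊗ₜ y)) := by
  rw [T₂_mul, comul_T₁]

/-- Both sides are (x ⊗ 1)Δ(y)(1 ⊗ z), covered first on one side or on the other. -/
theorem fstMul_T₁ (x y z : Q) : fstMul x (H.T₁ (y ⊗ₜ z)) = mulSnd z (H.T₂ (x ⊗ₜ y)) := by
  refine H.nondegenerate_tensor.eq_of_mul_right fun u => ?_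
  rw [fstMul_mul, ← H.T₁_spec, ← T₂_mul, mul_sndMul]

theorem T₁_mul (x y z : Q) : H.T₁ (x ⊗ₜ (y * z)) = mulSnd z (H.T₁ (x ⊗ₜ y)) := by
  refine H.nondegenerate_tensor.eq_of_mul_right fun u => ?_
  rw [← H.T₁_spec, ← mul_sndMul, ← H.T₁_spec]
  congr 1
  rw [sndMul, sndMul, sndMul, ← LinearMap.lTensor_comp_apply]
  congr 2
  ext w
  simp [mul_assoc]

theorem comul_tmul (a q r : Q) :
    Multiplier.left (H.comul a) (q ⊗ₜ r) = mulFst q (H.T₁ (a ⊗ₜ r)) := by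
  refine H.nondegenerate_tensor.eq_of_mul_right fun u => ?_
  rw [← Multiplier.left_mul H.nondegenerate_tensor mul_assoc, tmul_mul_eq, H.T₁_spec, mul_fstMul]

theorem sliceSnd_fstMul (ε : Q →ₗ[k] k) (z : Q) (t : Q ⊗[k] Q) :
    sliceSnd ε (fstMul z t) = z * sliceSnd ε t := by
  induction t using TensorProduct.induction_on with
  | zero => simp
  | add x y hx hy => simp only [map_add, mul_add, hx, hy]
  | tmul a b => simp [fstMul, mul_smul_comm]

theorem sliceSnd_mulFst (ε : Q →ₗ[k] k) (z : Q) (t : Q ⊗[k] Q) :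
    sliceSnd ε (mulFst z t) = sliceSnd ε t * z := by
  induction t using TensorProduct.induction_on with
  | zero => simp
  | add x y hx hy => simp only [map_add, add_mul, hx, hy]
  | tmul a b => simp [mulFst, smul_mul_assoc]

section Counit

variable {H} {ε : Q →ₗ[k] k}

theorem sliceFst_comul (hl : ∀ a b, sliceFst ε (H.T₁ (a ⊗ₜ b)) = a * b)
    (a : Q) (t : Q ⊗[k] Q) :
    sliceFst ε (Multiplier.left (H.comul a) t) = a * sliceFst ε t := by
  obtain ⟨t, rfl⟩ := H.T₁.surjective t
  induction t using TensorProduct.induction_on with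
  | zero => simp
  | add x y hx hy => simp only [map_add, mul_add, hx, hy]
  | tmul b c => rw [comul_T₁, hl, hl, mul_assoc]

/-- For t = Δ(b)(1 ⊗ c) one has t(q ⊗ 1) = Δ(b)(q ⊗ c), and ε ⊗ ι turns Δ(b) into left
multiplication by `b`. Taking t = p ⊗ r with r ≠ 0 then gives multiplicativity of ε. -/
theorem sliceFst_mulFst (hl : ∀ a b, sliceFst ε (H.T₁ (a ⊗ₜ b)) = a * b)
    (q : Q) (t : Q ⊗[k] Q) :
    sliceFst ε (mulFst q t) = ε q • sliceFst ε t := by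
  obtain ⟨t, rfl⟩ := H.T₁.surjective t
  induction t using TensorProduct.induction_on with
  | zero => simp
  | add x y hx hy => simp only [map_add, smul_add, hx, hy]
  | tmul b c =>
    rw [← comul_tmul, sliceFst_comul hl, hl, sliceFst_tmul, mul_smul_comm]

theorem counit_mul (hl : ∀ a b, sliceFst ε (H.T₁ (a ⊗ₜ b)) = a * b)
    (p q : Q) : ε (p * q) = ε p * ε q := by
  rcases subsingleton_or_nontrivial Q with h | h
  · rw [Subsingleton.elim (p * q) 0, Subsingleton.elim p 0]
    simp
  obtain ⟨r, hr⟩ := exists_ne (0 : Q)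
  have := sliceFst_mulFst hl q (p ⊗ₜ r)
  simp only [mulFst, LinearMap.rTensor_tmul, sliceFst_tmul, smul_smul, LinearMap.flip_apply,
    LinearMap.mul_apply'] at this
  rw [smul_left_injective k hr this, mul_comm]

theorem counit_ne_zero (hl : ∀ a b, sliceFst ε (H.T₁ (a ⊗ₜ b)) = a * b)
    (hQ : Nontrivial Q) : ε ≠ 0 := by
  rintro rfl
  obtain ⟨r, hr⟩ := exists_ne (0 : Q)
  refine hr (H.nondegenerate.1 r fun b => ?_)
  rw [← hl]
  simp [sliceFst]

theorem exists_counit_eq_one (hl : ∀ a b, sliceFst ε (H.T₁ (a ⊗ₜ b)) = a * b)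
    (hQ : Nontrivial Q) : ∃ p, ε p = 1 := by
  by_contra! h
  refine counit_ne_zero hl hQ (LinearMap.ext fun z => ?_)
  by_contra hz
  exact h ((ε z)⁻¹ • z) (by simp [inv_mul_cancel₀ (show ε z ≠ 0 from hz)])

end Counit

/-- The counit is determined by `m T₁⁻¹ = ε ⊗ ι` and `m T₂⁻¹ = ι ⊗ ε`. -/
theorem exists_counit : ∃ ε : Q →ₗ[k] k,
    (∀ a b, sliceFst ε (H.T₁ (a ⊗ₜ b)) = a * b) ∧ ∀ a b, sliceSnd ε (H.T₂ (a ⊗ₜ b)) = a * b := by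
  rcases subsingleton_or_nontrivial Q with h | h
  · exact ⟨0, fun a b => Subsingleton.elim _ _, fun a b => Subsingleton.elim _ _⟩
  let μ₁ : Q ⊗[k] Q →ₗ[k] Q := LinearMap.mul' k Q ∘ₗ H.T₁.symm.toLinearMap
  let μ₂ : Q ⊗[k] Q →ₗ[k] Q := LinearMap.mul' k Q ∘ₗ H.T₂.symm.toLinearMap
  -- Coassociativity with T₁ undone by `μ₁` on the last two legs.
  have h₁ : ∀ a t, LinearMap.lTensor Q μ₁ (TensorProduct.assoc k Q Q Q
      (LinearMap.rTensor Q H.T₂.toLinearMap ((TensorProduct.assoc k Q Q Q).symm (a ⊗ₜ t)))) =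
      fstMul a t := by
    intro a t
    obtain ⟨t, rfl⟩ := H.T₁.surjective t
    induction t using TensorProduct.induction_on with
    | zero => simp
    | add x y hx hy => simp only [map_add, TensorProduct.tmul_add, hx, hy]
    | tmul y z =>
      rw [H.coassoc, fstMul_T₁]
      generalize H.T₂ (a ⊗ₜ y) = s
      induction s using TensorProduct.induction_on with
      | zero => simp
      | add x y hx hy => simp only [map_add, TensorProduct.add_tmul, hx, hy]
      | tmul u v => simp [μ₁, mulSnd]
  have h₂ : ∀ s c, LinearMap.lTensor Q μ₁ (TensorProduct.assoc k Q Q Q (s ⊗ₜ c)) = μ₂ s ⊗ₜ c := by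
    intro s c
    obtain ⟨s, rfl⟩ := H.T₂.surjective s
    induction s using TensorProduct.induction_on with
    | zero => simp
    | add x y hx hy => simp only [map_add, TensorProduct.add_tmul, hx, hy]
    | tmul a b =>
      have := h₁ a (b ⊗ₜ c)
      rw [TensorProduct.assoc_symm_tmul, LinearMap.rTensor_tmul] at this
      simp only [LinearEquiv.coe_coe] at this
      rw [this]
      simp [μ₂, fstMul]
  -- This identity forces `μ₁` to rescale `c` and `μ₂` to rescale `a`, by one and the same
  -- functional of `b`, which is the counit.
  have h₃ : ∀ a b c, a ⊗ₜ[k] μ₁ (b ⊗ₜ c) = μ₂ (a ⊗ₜ b) ⊗ₜ[k] c := by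
    intro a b c
    rw [← h₂]
    simp
  obtain ⟨a₀, ha₀⟩ := exists_ne (0 : Q)
  -- A functional normalised at a nonzero element reads off the scalar.
  obtain ⟨ω, hω⟩ : ∃ ω : Module.Dual k Q, ω a₀ = 1 := by
    by_contra! h
    refine ha₀ ((Module.forall_dual_apply_eq_zero_iff k a₀).1 fun φ => ?_)
    by_contra hφ
    exact h ((φ a₀)⁻¹ • φ) (by simp [inv_mul_cancel₀ hφ])
  have h₄ : ∀ b c, μ₁ (b ⊗ₜ c) = ω (μ₂ (a₀ ⊗ₜ b)) • c := by
    intro b c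
    have := congrArg (sliceFst ω) (h₃ a₀ b c)
    simpa [hω] using this
  have h₅ : ∀ a b, μ₂ (a ⊗ₜ b) = ω (μ₂ (a₀ ⊗ₜ b)) • a := by
    intro a b
    have := congrArg (sliceSnd ω) (h₃ a b a₀)
    rw [h₄] at this
    simpa [hω] using this.symm
  refine ⟨ω ∘ₗ μ₂ ∘ₗ TensorProduct.mk k Q Q a₀, fun a b => ?_, fun a b => ?_⟩
  · have e : sliceFst (ω ∘ₗ μ₂ ∘ₗ TensorProduct.mk k Q Q a₀) = μ₁ :=
      TensorProduct.ext' fun b c => by simp [h₄]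
    rw [e]
    simp [μ₁]
  · have e : sliceSnd (ω ∘ₗ μ₂ ∘ₗ TensorProduct.mk k Q Q a₀) = μ₂ :=
      TensorProduct.ext' fun b c => by
        rw [sliceSnd_tmul, h₅]
        rfl
    rw [e]
    simp [μ₂]

/-- `ε` and `S` satisfy the counit and antipode equations. -/
structure IsAntipode (ε : Q →ₗ[k] k) (S : Q →ₗ[k] Q) : Prop where
  counit_left : ∀ a b, sliceFst ε (H.T₁ (a ⊗ₜ b)) = a * b
  counit_right : ∀ a b, sliceSnd ε (H.T₂ (a ⊗ₜ b)) = a * b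
  map_mul : ∀ a b, S (a * b) = S b * S a
  antipode_left : ∀ a b,
    LinearMap.mul' k Q (LinearMap.rTensor Q S (H.T₁ (a ⊗ₜ b))) = ε a • b
  antipode_right : ∀ a b,
    LinearMap.mul' k Q (LinearMap.lTensor Q S (H.T₂ (a ⊗ₜ b))) = ε b • a

/-- The comultiplication of `H'` is the flipped comultiplication of `H`. -/
def IsFlip (H H' : MultiplierHopfAlgebra k Q) : Prop := ∀ (x : Q) (u : Q ⊗[k] Q),
  Multiplier.left (H'.comul x) u =
      TensorProduct.comm k Q Q (Multiplier.left (H.comul x) (TensorProduct.comm k Q Q u)) ∧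
  Multiplier.right (H'.comul x) u =
      TensorProduct.comm k Q Q (Multiplier.right (H.comul x) (TensorProduct.comm k Q Q u))

variable {H} {H' : MultiplierHopfAlgebra k Q}

theorem IsFlip.symm (h : IsFlip H H') : IsFlip H' H := by
  intro x u
  rw [(h x _).1, (h x _).2]
  simp only [comm_comm_apply, and_self]

/-- `Δ(x)(y ⊗ 1)` -/
theorem IsFlip.left_fstMul (h : IsFlip H H') (x y : Q) (u : Q ⊗[k] Q) :
    Multiplier.left (H.comul x) (fstMul y u) =
      TensorProduct.comm k Q Q (H'.T₁ (x ⊗ₜ y)) * u := by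
  rw [(h.symm x _).1, comm_fstMul, H'.T₁_spec, comm_mul, comm_comm_apply]

theorem IsFlip.right_mulSnd (h : IsFlip H H') (x y : Q) (u : Q ⊗[k] Q) :
    Multiplier.right (H.comul x) (mulSnd y u) =
      u * TensorProduct.comm k Q Q (H'.T₂ (y ⊗ₜ x)) := by
  obtain ⟨u, rfl⟩ := (TensorProduct.comm k Q Q).surjective u
  rw [(h.symm x _).2, ← comm_mulFst, comm_comm_apply, H'.T₂_spec, comm_mul]

theorem IsFlip.comul_tmul (h : IsFlip H H') (a q c : Q) :
    Multiplier.left (H.comul a) (q ⊗ₜ c) =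
      mulSnd c (TensorProduct.comm k Q Q (H'.T₁ (a ⊗ₜ q))) := by
  refine H.nondegenerate_tensor.eq_of_mul_right fun u => ?_
  rw [← Multiplier.left_mul H.nondegenerate_tensor mul_assoc, tmul_mul_eq, sndMul_fstMul,
    h.left_fstMul,
    mul_sndMul]

/-- The antipode equation prescribes S(q)c = σ(q ⊗ c) with σ = (ε ⊗ ι)T₁⁻¹, which a priori defines
S(q) only as a left multiplication. Regularity puts Δ(p)(q ⊗ 1) into Q ⊗ Q, and applying σ to it
produces ε(p)S(q) as an element of `Q`. -/
theorem IsFlip.exists_isAntipode (h : IsFlip H H') : ∃ ε S, H.IsAntipode ε S := by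
  rcases subsingleton_or_nontrivial Q with hQ | hQ
  · exact ⟨0, 0, by constructor <;> exact fun a b => Subsingleton.elim _ _⟩
  obtain ⟨ε, hl, hr⟩ := H.exists_counit
  obtain ⟨p₀, hp₀⟩ := exists_counit_eq_one hl hQ
  let σ : Q ⊗[k] Q →ₗ[k] Q := sliceFst ε ∘ₗ H.T₁.symm.toLinearMap
  have hσT : ∀ a b, σ (H.T₁ (a ⊗ₜ b)) = ε a • b := by
    intro a b
    simp [σ]
  have hσm : ∀ z t, σ (mulSnd z t) = σ t * z := by
    intro z t
    obtain ⟨t, rfl⟩ := H.T₁.surjective t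
    induction t using TensorProduct.induction_on with
    | zero => simp
    | add x y hx hy => simp only [map_add, add_mul, hx, hy]
    | tmul a b => rw [← T₁_mul, hσT, hσT, smul_mul_assoc]
  have hσΔ : ∀ a t, σ (Multiplier.left (H.comul a) t) = ε a • σ t := by
    intro a t
    obtain ⟨t, rfl⟩ := H.T₁.surjective t
    induction t using TensorProduct.induction_on with
    | zero => simp
    | add x y hx hy => simp only [map_add, smul_add, hx, hy]
    | tmul b c => rw [comul_T₁, hσT, hσT, counit_mul hl, mul_smul]
  -- S(q) = σ(Δ(p₀)(q ⊗ 1)) with ε(p₀) = 1, where Δ(p₀)(q ⊗ 1) is the flip of T₁'(p₀ ⊗ q).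
  let S : Q →ₗ[k] Q := σ ∘ₗ (TensorProduct.comm k Q Q).toLinearMap ∘ₗ H'.T₁.toLinearMap ∘ₗ
    TensorProduct.mk k Q Q p₀
  have hS : ∀ q c, S q * c = σ (q ⊗ₜ c) := by
    intro q c
    have := hσΔ p₀ (q ⊗ₜ c)
    rw [h.comul_tmul, hσm, hp₀, one_smul] at this
    exact this
  have hSσ : ∀ t, LinearMap.mul' k Q (LinearMap.rTensor Q S t) = σ t := by
    intro t
    induction t using TensorProduct.induction_on with
    | zero => simp
    | add x y hx hy => simp only [map_add, hx, hy]
    | tmul b c => simp [hS]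
  refine ⟨ε, S, hl, hr, fun a b => ?_, fun a b => ?_, fun a b => ?_⟩
  -- Anti-multiplicativity is σ(t(b ⊗ 1)) = S(b)σ(t) for t = a ⊗ y, and it is verified on t = Δ(p)(1
  -- ⊗ c).
  · have key : ∀ t, σ (mulFst b t) = S b * σ t := by
      intro t
      obtain ⟨t, rfl⟩ := H.T₁.surjective t
      induction t using TensorProduct.induction_on with
      | zero => simp
      | add x y hx hy => simp only [map_add, mul_add, hx, hy]
      | tmul p c => rw [← MultiplierHopfAlgebra.comul_tmul, hσΔ, hσT, ← hS, mul_smul_comm]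
    refine H.nondegenerate.eq_of_mul_right fun y => ?_
    have := key (a ⊗ₜ y)
    rw [← hS, mulFst, LinearMap.rTensor_tmul, ← hS] at this
    rw [mul_assoc, ← this]
    rfl
  · rw [hSσ, hσT]
  · refine H.nondegenerate.eq_of_mul_right fun c => ?_
    have e₁ : ∀ s, LinearMap.mul' k Q (LinearMap.lTensor Q S s) * c =
        LinearMap.mul' k Q (LinearMap.lTensor Q σ (TensorProduct.assoc k Q Q Q (s ⊗ₜ c))) := by
      intro s
      induction s using TensorProduct.induction_on with
      | zero => simp
      | add x y hx hy => simp only [map_add, add_mul, TensorProduct.add_tmul, hx, hy]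
      | tmul u v => simp [← hS, mul_assoc]
    -- The right antipode equation is extracted from coassociativity: on t = T₁(y ⊗ z) both sides
    -- equal a y z.
    have e₂ : ∀ t, LinearMap.mul' k Q (LinearMap.lTensor Q σ (TensorProduct.assoc k Q Q Q
        (LinearMap.rTensor Q H.T₂.toLinearMap ((TensorProduct.assoc k Q Q Q).symm (a ⊗ₜ t))))) =
        a * sliceFst ε t := by
      intro t
      obtain ⟨t, rfl⟩ := H.T₁.surjective t
      induction t using TensorProduct.induction_on with
      | zero => simp
      | add x y hx hy => simp only [map_add, TensorProduct.tmul_add, mul_add, hx, hy]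
      | tmul y z =>
        rw [H.coassoc, hl, ← mul_assoc, ← hr a y]
        generalize H.T₂ (a ⊗ₜ y) = s
        induction s using TensorProduct.induction_on with
        | zero => simp
        | add x y hx hy => simp only [map_add, add_mul, TensorProduct.add_tmul, hx, hy]
        | tmul u v => simp [hσT, smul_mul_assoc]
    have := e₂ (b ⊗ₜ c)
    rw [TensorProduct.assoc_symm_tmul, LinearMap.rTensor_tmul, LinearEquiv.coe_coe] at this
    rw [e₁, this, sliceFst_tmul, mul_smul_comm, smul_mul_assoc]

/-- Slicing the second leg of Δ(a)(b ⊗ 1) by ε gives ab, and this element is the flip of T₁'(a ⊗ b).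
So ε satisfies the equation determining the counit of H'. -/
theorem IsFlip.counit_eq (h : IsFlip H H') {ε ε' : Q →ₗ[k] k}
    (hr : ∀ a b, sliceSnd ε (H.T₂ (a ⊗ₜ b)) = a * b)
    (hl' : ∀ a b, sliceFst ε' (H'.T₁ (a ⊗ₜ b)) = a * b) : ε = ε' := by
  rcases subsingleton_or_nontrivial Q with hQ | hQ
  · exact Subsingleton.elim _ _
  have e₁ : ∀ a b, sliceSnd ε (TensorProduct.comm k Q Q (H'.T₁ (a ⊗ₜ b))) = a * b := by
    intro a b
    refine H.nondegenerate.eq_of_mul_left fun c => ?_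
    have e : fstMul c (TensorProduct.comm k Q Q (H'.T₁ (a ⊗ₜ b))) =
        mulFst b (H.T₂ (c ⊗ₜ a)) := by
      refine H.nondegenerate_tensor.eq_of_mul_right fun u => ?_
      rw [fstMul_mul, ← h.left_fstMul, ← T₂_mul, mul_fstMul]
    rw [← sliceSnd_fstMul, e, sliceSnd_mulFst, hr, mul_assoc]
  have e₂ : sliceSnd ε ∘ₗ (TensorProduct.comm k Q Q).toLinearMap = sliceFst ε' := by
    rw [← LinearMap.cancel_right (g := H'.T₁.toLinearMap) H'.T₁.surjective]
    refine TensorProduct.ext' fun a b => ?_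
    exact (e₁ a b).trans (hl' a b).symm
  obtain ⟨r, hr⟩ := exists_ne (0 : Q)
  ext q
  have := LinearMap.congr_fun e₂ (q ⊗ₜ r)
  simp only [LinearMap.comp_apply, LinearEquiv.coe_coe, TensorProduct.comm_tmul, sliceSnd_tmul,
    sliceFst_tmul] at this
  exact smul_left_injective k hr this

/-- With κ(u ⊗ v) = v S'(u), both κ and S' ∘ m(ι ⊗ S) send (c ⊗ 1)Δ(b) to ε(b)S'(c), so they agree
on Q ⊗ Q. On u ⊗ x this reads x S'(u) = S'(S(x)) S'(u), and S'(Q)Q = Q allows S'(u) to be cancelled.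
-/
theorem IsFlip.antipode_antipode (h : IsFlip H H') {ε ε' : Q →ₗ[k] k} {S S' : Q →ₗ[k] Q}
    (hS : H.IsAntipode ε S) (hS' : H'.IsAntipode ε' S') (x : Q) : S' (S x) = x := by
  rcases subsingleton_or_nontrivial Q with hQ | hQ
  · exact Subsingleton.elim _ _
  obtain rfl := h.counit_eq hS.counit_right hS'.counit_left
  have e₁ : ∀ a b c, sndMul a (H.T₂ (c ⊗ₜ b)) =
      fstMul c (TensorProduct.comm k Q Q (H'.T₂ (a ⊗ₜ b))) := by
    intro a b c
    refine H.nondegenerate_tensor.eq_of_mul_left fun u => ?_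
    rw [mul_sndMul, ← H.T₂_spec, mul_fstMul, ← h.right_mulSnd, mulSnd_mulFst]
  let κ : Q ⊗[k] Q →ₗ[k] Q :=
    LinearMap.mul' k Q ∘ₗ (TensorProduct.comm k Q Q).toLinearMap ∘ₗ LinearMap.rTensor Q S'
  have hκ : ∀ a t, κ (sndMul a t) = a * κ t := by
    intro a t
    induction t using TensorProduct.induction_on with
    | zero => simp
    | add x y hx hy => simp only [map_add, mul_add, hx, hy]
    | tmul u v => simp [κ, sndMul, mul_assoc]
  have hκ' : ∀ c t, κ (fstMul c (TensorProduct.comm k Q Q t)) =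
      LinearMap.mul' k Q (LinearMap.lTensor Q S' t) * S' c := by
    intro c t
    induction t using TensorProduct.induction_on with
    | zero => simp
    | add x y hx hy => simp only [map_add, add_mul, hx, hy]
    | tmul u v => simp [κ, fstMul, mul_assoc, hS'.map_mul]
  have hκT : ∀ c b, κ (H.T₂ (c ⊗ₜ b)) = ε b • S' c := by
    intro c b
    refine H.nondegenerate.eq_of_mul_left fun a => ?_
    rw [← hκ, e₁, hκ', hS'.antipode_right, smul_mul_assoc, mul_smul_comm]
  have e₂ : κ = S' ∘ₗ LinearMap.mul' k Q ∘ₗ LinearMap.lTensor Q S := by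
    rw [← LinearMap.cancel_right (g := H.T₂.toLinearMap) H.T₂.surjective]
    refine TensorProduct.ext' fun c b => ?_
    change κ (H.T₂ (c ⊗ₜ b)) = S' (LinearMap.mul' k Q (LinearMap.lTensor Q S (H.T₂ (c ⊗ₜ b))))
    rw [hκT, hS.antipode_right, map_smul]
  have e₃ : ∀ u, x * S' u = S' (S x) * S' u := by
    intro u
    have := LinearMap.congr_fun e₂ (u ⊗ₜ x)
    simpa [κ, hS'.map_mul] using this
  -- The antipode equation of H' at p ⊗ z with ε(p) = 1 writes `z` as a sum of products S'(u)v.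
  obtain ⟨p, hp⟩ := exists_counit_eq_one hS'.counit_left hQ
  refine H.nondegenerate.eq_of_mul_right fun z => ?_
  have e₄ : ∀ y t, y * LinearMap.mul' k Q (LinearMap.rTensor Q S' t) =
      LinearMap.mul' k Q (LinearMap.rTensor Q (LinearMap.mul k Q y ∘ₗ S') t) := by
    intro y t
    induction t using TensorProduct.induction_on with
    | zero => simp
    | add x y hx hy => simp only [map_add, mul_add, hx, hy]
    | tmul u v => simp [mul_assoc]
  have e₅ : LinearMap.mul k Q (S' (S x)) ∘ₗ S' = LinearMap.mul k Q x ∘ₗ S' :=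
    LinearMap.ext fun u => (e₃ u).symm
  have hz := hS'.antipode_left p z
  rw [hp, one_smul] at hz
  rw [← hz, e₄, e₄, e₅]

/-- A regular multiplier Hopf algebra has a bijective antipode. -/
theorem IsRegular.nonempty_antipode (hH : H.IsRegular) : Nonempty (Antipode H) := by
  obtain ⟨H', h⟩ := hH
  have h : IsFlip H H' := h
  obtain ⟨ε, S, hS⟩ := h.exists_isAntipode
  obtain ⟨ε', S', hS'⟩ := h.symm.exists_isAntipode
  exact ⟨{
    S := LinearEquiv.ofLinearMap S S' (LinearMap.ext (h.symm.antipode_antipode hS' hS))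
      (LinearMap.ext (h.antipode_antipode hS hS'))
    counit := ε
    counit_left := hS.counit_left
    counit_right := hS.counit_right
    map_mul := hS.map_mul
    antipode_left := hS.antipode_left
    antipode_right := hS.antipode_right }⟩

end MultiplierHopfAlgebra

end Antipode

/-! ### Multipliers and coactions given by covers -/

section Covers

variable {k X E L : Type*} [Field k] [NonUnitalNonAssocRing E] [Module k E]
  [SMulCommClass k E E] [IsScalarTower k E E]

theorem Multiplier.ext_left (hE : NondegenerateProduct E) {m m' : Multiplier k E}
    (h : ∀ u, Multiplier.left m u = Multiplier.left m' u) : m = m' := by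
  apply Subtype.ext
  refine Prod.ext (LinearMap.ext h) (MulOpposite.unop_injective (LinearMap.ext fun u => ?_))
  refine hE.eq_of_mul_right fun v => ?_
  exact (Multiplier.right_mul m u v).trans ((congrArg _ (h v)).trans
    (Multiplier.right_mul m' u v).symm)

theorem Multiplier.ext_right (hE : NondegenerateProduct E) {m m' : Multiplier k E}
    (h : ∀ u, Multiplier.right m u = Multiplier.right m' u) : m = m' := by
  refine Multiplier.ext_left hE fun u => hE.eq_of_mul_left fun v => ?_
  rw [← Multiplier.right_mul, h, Multiplier.right_mul]

/-- Commuting left and right multiplications of `E` by elements of `L`, with local units. -/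
structure OuterMul (lam rho : L → E → E) : Prop where
  lam_mul : ∀ x u v, lam x u * v = lam x (u * v)
  mul_lam : ∀ x u v, u * lam x v = rho x u * v
  exists_lam : ∀ u, ∃ x, lam x u = u
  exists_rho : ∀ u, ∃ x, rho x u = u

/-- The multiplier `m` satisfies `m x = r x` and `x m = l x` for all `x ∈ L`. -/
def IsCover (lam rho : L → E → E) (r l : L → E) (m : Multiplier k E) : Prop :=
  (∀ x u, Multiplier.left m (lam x u) = r x * u) ∧ ∀ x u, Multiplier.right m (rho x u) = u * l x

/-- The multiplier is m u = r(e)u for any `e` with e u = u, and u m = u l(f) for any `f` with u f =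
u. Neither depends on the choice, nor fails to be linear, because (v f)(m u) = v(l(f)u) determines m
u by nondegeneracy; the right part is symmetric. -/
theorem OuterMul.exists_multiplier {lam rho : L → E → E} (h : OuterMul lam rho)
    (hE : NondegenerateProduct E) (hass : ∀ a b c : E, a * b * c = a * (b * c))
    (r l : L → E) (hrl : ∀ f x, lam f (r x) = rho x (l f)) :
    ∃ m : Multiplier k E, IsCover lam rho r l m := by
  -- Both sides are v f m x u; the compatibility `hrl` of the covers is used only here.
  have hmid : ∀ f x u v, rho f v * (r x * u) = v * (l f * lam x u) := by
    intro f x u v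
    rw [← h.mul_lam, ← h.lam_mul, hrl, h.mul_lam]
  have hmid' : ∀ f x u v, u * l f * lam x v = rho f u * (r x * v) := by
    intro f x u v
    rw [hass, hmid]
  have uniq : ∀ u w w', (∀ f v, rho f v * w = v * (l f * u)) →
      (∀ f v, rho f v * w' = v * (l f * u)) → w = w' := by
    intro u w w' hw hw'
    refine hE.eq_of_mul_left fun v => ?_
    obtain ⟨f, hf⟩ := h.exists_rho v
    rw [← hf, hw, hw']
  have uniq' : ∀ u w w', (∀ x v, w * lam x v = u * (r x * v)) →
      (∀ x v, w' * lam x v = u * (r x * v)) → w = w' := by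
    intro u w w' hw hw'
    refine hE.eq_of_mul_right fun v => ?_
    obtain ⟨x, hx⟩ := h.exists_lam v
    rw [← hx, hw, hw']
  have ex : ∀ u, ∃ w, ∀ f v, rho f v * w = v * (l f * u) := by
    intro u
    obtain ⟨e, he⟩ := h.exists_lam u
    exact ⟨r e * u, fun f v => by rw [hmid, he]⟩
  have ex' : ∀ u, ∃ w, ∀ x v, w * lam x v = u * (r x * v) := by
    intro u
    obtain ⟨f, hf⟩ := h.exists_rho u
    exact ⟨u * l f, fun x v => by rw [hmid', hf]⟩
  choose mL hmL using ex
  choose mR hmR using ex'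
  let ML : E →ₗ[k] E :=
    { toFun := mL
      map_add' := fun u u' => uniq _ _ _ (hmL _) fun f v => by
        simp only [mul_add, hmL]
      map_smul' := fun a u => uniq _ _ _ (hmL _) fun f v => by
        simp only [RingHom.id_apply, mul_smul_comm, hmL] }
  let MR : E →ₗ[k] E :=
    { toFun := mR
      map_add' := fun u u' => uniq' _ _ _ (hmR _) fun f v => by
        simp only [add_mul, hmR]
      map_smul' := fun a u => uniq' _ _ _ (hmR _) fun f v => by
        simp only [RingHom.id_apply, smul_mul_assoc, hmR] }
  refine ⟨⟨(ML, MulOpposite.op MR), fun a b => ?_⟩, fun x u => ?_, fun x u => ?_⟩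
  · change mR a * b = a * mL b
    obtain ⟨x, hx⟩ := h.exists_lam b
    have e : mL b = r x * b := uniq b _ _ (hmL b) fun f v => by rw [hmid, hx]
    rw [e, ← hmR a x b, hx]
  · exact uniq _ _ _ (hmL _) fun f v => hmid f x u v
  · exact uniq' _ _ _ (hmR _) fun y v => hmid' x y u v

theorem OuterMul.eq_of_left {lam rho : L → E → E} (h : OuterMul lam rho)
    (hE : NondegenerateProduct E) {m m' : Multiplier k E}
    (hm : ∀ x u, Multiplier.left m (lam x u) = Multiplier.left m' (lam x u)) : m = m' :=
  Multiplier.ext_left hE fun u => by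
    obtain ⟨x, hx⟩ := h.exists_lam u
    rw [← hx, hm]

theorem OuterMul.eq_of_right {lam rho : L → E → E} (h : OuterMul lam rho)
    (hE : NondegenerateProduct E) {m m' : Multiplier k E}
    (hm : ∀ x u, Multiplier.right m (rho x u) = Multiplier.right m' (rho x u)) : m = m' :=
  Multiplier.ext_right hE fun u => by
    obtain ⟨x, hx⟩ := h.exists_rho u
    rw [← hx, hm]

variable [NonUnitalNonAssocRing X] [Module k X] [AddCommGroup L] [Module k L]

/-- Compatible covers suffice to define a coaction. The disjunction in `hmul` lets multiplicativity
be checked on whichever side it is known: through left covers for the induced right coaction,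
through right covers for the induced left one. -/
theorem OuterMul.exists_coaction {lam rho : L → E → E} (h : OuterMul lam rho)
    (hE : NondegenerateProduct E) (hass : ∀ a b c : E, a * b * c = a * (b * c))
    (r l : L →ₗ[k] X →ₗ[k] E) (hrl : ∀ f x z, lam f (r x z) = rho x (l f z))
    (hmul : ∀ z z' (m m' : Multiplier k E), IsCover lam rho (r.flip z) (l.flip z) m →
      IsCover lam rho (r.flip z') (l.flip z') m' →
      (∀ x u, Multiplier.left (m * m') (lam x u) = r x (z * z') * u) ∨
        ∀ x u, Multiplier.right (m * m') (rho x u) = u * l x (z * z'))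
    (hinj : ∀ z, (∀ x, l x z = 0) → z = 0) :
    ∃ coact : X →ₙₐ[k] Multiplier k E, Function.Injective coact ∧
      ∀ z, IsCover lam rho (r.flip z) (l.flip z) (coact z) := by
  have ex : ∀ z, ∃ m : Multiplier k E, IsCover lam rho (r.flip z) (l.flip z) m :=
    fun z => h.exists_multiplier hE hass _ _ fun f x => hrl f x z
  choose μ hμ using ex
  let coact : X →ₙₐ[k] Multiplier k E :=
    { toFun := μ
      map_smul' := fun a z => h.eq_of_left hE fun x u => by
        rw [(hμ _).1]
        change _ = a • Multiplier.left (μ z) (lam x u)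
        rw [(hμ _).1, LinearMap.flip_apply, LinearMap.flip_apply, map_smul, smul_mul_assoc]
      map_zero' := h.eq_of_left hE fun x u => by
        rw [(hμ _).1, LinearMap.flip_apply, map_zero, zero_mul]
        rfl
      map_add' := fun z z' => h.eq_of_left hE fun x u => by
        rw [(hμ _).1]
        change _ = Multiplier.left (μ z) (lam x u) + Multiplier.left (μ z') (lam x u)
        rw [(hμ _).1, (hμ _).1, LinearMap.flip_apply, LinearMap.flip_apply, LinearMap.flip_apply,
          map_add, add_mul]
      map_mul' := fun z z' => by
        rcases hmul z z' _ _ (hμ z) (hμ z') with h' | h'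
        · exact h.eq_of_left hE fun x u => by
            rw [(hμ _).1, h']
            rfl
        · exact h.eq_of_right hE fun x u => by
            rw [(hμ _).2, h']
            rfl }
  refine ⟨coact, (injective_iff_map_eq_zero coact).2 fun z hz => hinj z fun x => ?_, hμ⟩
  refine hE.2 _ fun u => ?_
  have := (hμ z).2 x u
  rw [LinearMap.flip_apply] at this
  rw [← this]
  change Multiplier.right (coact z) _ = 0
  rw [hz]
  rfl

end Covers

/-! ### Local units acting on one tensor leg -/

section TensorLegs

variable {k : Type*} [Field k] {Q L C : Type*}
  [NonUnitalRing Q] [Module k Q] [SMulCommClass k Q Q] [IsScalarTower k Q Q]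
  [NonUnitalRing L] [Module k L] [SMulCommClass k L L] [IsScalarTower k L L]
  [NonUnitalNonAssocRing C] [Module k C]

theorem comm_sndMul' (x : L) (u : C ⊗[k] L) :
    TensorProduct.comm k C L (sndMul x u) = fstMul x (TensorProduct.comm k C L u) :=
  (rTensor_comm _ _).symm

theorem comm_mulSnd' (x : L) (u : C ⊗[k] L) :
    TensorProduct.comm k C L (mulSnd x u) = mulFst x (TensorProduct.comm k C L u) :=
  (rTensor_comm _ _).symm

theorem exists_units_fst (hQ : HasLocalUnits Q) (u : Q ⊗[k] C) :
    ∃ e f : Q, fstMul e u = u ∧ mulFst f u = u := by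
  classical
  have key : ∀ t : Q ⊗[k] C, ∃ s : Finset Q, ∀ e f : Q, (∀ a ∈ s, e * a = a ∧ a * f = a) →
      fstMul e t = t ∧ mulFst f t = t := by
    intro t
    induction t using TensorProduct.induction_on with
    | zero => exact ⟨∅, fun e f _ => by simp⟩
    | tmul a c =>
      refine ⟨{a}, fun e f hef => ?_⟩
      have := hef a (by simp)
      simp [fstMul, mulFst, this.1, this.2]
    | add x y hx hy =>
      obtain ⟨s, hs⟩ := hx
      obtain ⟨s', hs'⟩ := hy
      refine ⟨s ∪ s', fun e f hef => ?_⟩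
      have h := hs e f fun a ha => hef a (by simp [ha])
      have h' := hs' e f fun a ha => hef a (by simp [ha])
      rw [map_add, map_add, h.1, h.2, h'.1, h'.2]
      exact ⟨rfl, rfl⟩
  obtain ⟨s, hs⟩ := key u
  obtain ⟨e, f, hef⟩ := hQ s
  exact ⟨e, f, hs e f hef⟩

variable [SMulCommClass k C C] [IsScalarTower k C C]

theorem outerMul_fst (hQ : HasLocalUnits Q) :
    OuterMul (E := Q ⊗[k] C) (fun x => fstMul (x : Q)) (fun x => mulFst x) where
  lam_mul := fstMul_mul
  mul_lam := mul_fstMul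
  exists_lam u := by
    obtain ⟨e, f, he, hf⟩ := exists_units_fst hQ u
    exact ⟨e, he⟩
  exists_rho u := by
    obtain ⟨e, f, he, hf⟩ := exists_units_fst hQ u
    exact ⟨f, hf⟩

theorem outerMul_snd (hL : HasLocalUnits L) :
    OuterMul (E := C ⊗[k] L) (fun x => sndMul (x : L)) (fun x => mulSnd x) where
  lam_mul := sndMul_mul
  mul_lam := mul_sndMul
  exists_lam u := by
    obtain ⟨e, f, he, hf⟩ := exists_units_fst hL (TensorProduct.comm k C L u)
    exact ⟨e, (TensorProduct.comm k C L).injective ((comm_sndMul' e u).trans he)⟩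
  exists_rho u := by
    obtain ⟨e, f, he, hf⟩ := exists_units_fst hL (TensorProduct.comm k C L u)
    exact ⟨f, (TensorProduct.comm k C L).injective ((comm_mulSnd' f u).trans hf)⟩

end TensorLegs

/-! ### Invertibility of the twisting maps -/

section Hopf

variable {k Q : Type*} [Field k] [NonUnitalRing Q] [Module k Q]
  [SMulCommClass k Q Q] [IsScalarTower k Q Q] {H : MultiplierHopfAlgebra k Q}

theorem map₂_mul (u v : Q ⊗[k] Q) :
    TensorProduct.map₂ (LinearMap.mul k Q) (LinearMap.mul k Q) u v = u * v := by
  induction u using TensorProduct.induction_on with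
  | zero => simp
  | add x y hx hy => simp only [map_add, LinearMap.add_apply, add_mul, hx, hy]
  | tmul a b =>
    induction v using TensorProduct.induction_on with
    | zero => simp
    | add x y hx hy => simp only [map_add, mul_add, hx, hy]
    | tmul c d => simp

theorem map₂_mul_flip (u v : Q ⊗[k] Q) :
    TensorProduct.map₂ (LinearMap.mul k Q).flip (LinearMap.mul k Q).flip u v = v * u := by
  induction u using TensorProduct.induction_on with
  | zero => simp
  | add x y hx hy => simp only [map_add, LinearMap.add_apply, mul_add, hx, hy]
  | tmul a b =>
    induction v using TensorProduct.induction_on with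
    | zero => simp
    | add x y hx hy => simp only [map_add, add_mul, hx, hy]
    | tmul c d => simp

theorem Antipode.counit_mul (S : Antipode H) (x y : Q) :
    S.counit (x * y) = S.counit x * S.counit y :=
  MultiplierHopfAlgebra.counit_mul S.counit_left x y

theorem HasLocalUnits.units (h : HasLocalUnits Q) (x : Q) : ∃ e f : Q, e * x = x ∧ x * f = x := by
  obtain ⟨e, f, hef⟩ := h {x}
  exact ⟨e, f, hef x (by simp)⟩

/-- The maps `T₁`, `T₂` of `H`. -/
def Antipode.hopfCover (S : Antipode H) : HopfCover k Q where
  m := LinearMap.mul k Q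
  T₁ := H.T₁
  T₂ := H.T₂
  S := S.S
  counit := S.counit
  assoc := mul_assoc
  units := H.localUnits.units
  T₂_mul_T₁ x w p y := (map₂_mul _ _).trans (H.T₂_mul_T₁ x w p y)
  counit_mul := S.counit_mul
  counit_ne_zero := MultiplierHopfAlgebra.counit_ne_zero S.counit_left
  counit_T₁_left := S.counit_left
  antipode_T₁ x y := by
    rw [← S.antipode_left]
    generalize H.T₁ (x ⊗ₜ y) = t
    induction t using TensorProduct.induction_on with
    | zero => simp
    | add x y hx hy => simp only [map_add, hx, hy]
    | tmul a b => simp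
  antipode_T₂ x y := by
    -- Applying `S` reduces to the known equation, since S(v S⁻¹(u)) = u S(v).
    apply S.S.injective
    rw [map_smul, LinearEquiv.apply_symm_apply, ← S.antipode_right]
    generalize H.T₂ (x ⊗ₜ y) = t
    induction t using TensorProduct.induction_on with
    | zero => simp
    | add x y hx hy => simp only [map_add, hx, hy]
    | tmul a b => simp [S.map_mul]

/-- The maps `T₁`, `T₂` of the opposite algebra with the flipped comultiplication. -/
def Antipode.hopfCoverOp (S : Antipode H) : HopfCover k Q where
  m := (LinearMap.mul k Q).flip
  T₁ := flipT H.T₂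
  T₂ := flipT H.T₁
  S := S.S
  counit := S.counit
  assoc x y z := by simp [mul_assoc]
  units x := by
    obtain ⟨e, f, he, hf⟩ := H.localUnits.units x
    exact ⟨f, e, hf, he⟩
  T₂_mul_T₁ x w p y := by
    rw [map₂_mul_flip, flipT_tmul, flipT_tmul, flipT_tmul, ← comm_mul, H.T₂_mul_T₁, H.fstMul_T₁]
    exact (rTensor_comm _ _).symm
  counit_mul x y := by
    rw [LinearMap.flip_apply, LinearMap.mul_apply', S.counit_mul, mul_comm]
  counit_ne_zero := MultiplierHopfAlgebra.counit_ne_zero S.counit_left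
  counit_T₁_left x y := by
    rw [flipT_tmul, LinearMap.flip_apply, LinearMap.mul_apply', ← S.counit_right]
    generalize H.T₂ (y ⊗ₜ x) = t
    induction t using TensorProduct.induction_on with
    | zero => simp
    | add x y hx hy => simp only [map_add, hx, hy]
    | tmul a b => simp
  antipode_T₁ x y := by
    rw [flipT_tmul, ← S.antipode_right]
    generalize H.T₂ (y ⊗ₜ x) = t
    induction t using TensorProduct.induction_on with
    | zero => simp
    | add x y hx hy => simp only [map_add, hx, hy]
    | tmul a b => simp
  antipode_T₂ x y := by
    apply S.S.injective
    rw [map_smul, LinearEquiv.apply_symm_apply, flipT_tmul, ← S.antipode_left]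
    generalize H.T₁ (y ⊗ₜ x) = t
    induction t using TensorProduct.induction_on with
    | zero => simp
    | add x y hx hy => simp only [map_add, hx, hy]
    | tmul a b => simp [S.map_mul]

variable {C A : Type*}
  [NonUnitalNonAssocRing C] [Module k C] [SMulCommClass k C C] [IsScalarTower k C C]
  [NonUnitalNonAssocRing A] [Module k A] [SMulCommClass k A A] [IsScalarTower k A A]

/-- Local units make a multiplier determined by its covers, so injectivity of Γ passes to the family
of covers. -/
theorem LeftComoduleAlgebra.eq_zero_of_covR (Γ : LeftComoduleAlgebra H C) (c : C)
    (h : ∀ x, Γ.covR x c = 0) : c = 0 := by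
  refine (injective_iff_map_eq_zero Γ.coact).1 Γ.injective c ?_
  refine (outerMul_fst H.localUnits).eq_of_left
    (NondegenerateProduct.tensor_left H.localUnits Γ.nondeg Γ.assoc) fun x u => ?_
  rw [Γ.covR_spec, h, zero_mul]
  rfl

theorem RightComoduleAlgebra.eq_zero_of_covL (Υ : RightComoduleAlgebra H C) (c : C)
    (h : ∀ x, Υ.covL x c = 0) : c = 0 := by
  refine (injective_iff_map_eq_zero Υ.coact).1 Υ.injective c ?_
  refine (outerMul_snd H.localUnits).eq_of_right
    (NondegenerateProduct.tensor_right H.localUnits Υ.nondeg Υ.assoc) fun x u => ?_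
  rw [Υ.covL_spec, h, mul_zero]
  rfl

/-- The covers of a left coaction. -/
def LeftComoduleAlgebra.coactionCover (Γ : LeftComoduleAlgebra H C) (S : Antipode H) :
    CoactionCover S.hopfCover C where
  G := Γ.covR
  G' := Γ.covL
  compat := Γ.cover_compat
  coassoc := Γ.coassoc
  injective := Γ.eq_zero_of_covR

/-- The covers of a right coaction. -/
def RightComoduleAlgebra.coactionCover (Υ : RightComoduleAlgebra H C) (S : Antipode H) :
    CoactionCover S.hopfCoverOp C where
  G := Υ.covL.compr₂ (TensorProduct.comm k C Q).toLinearMap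
  G' := Υ.covR.compr₂ (TensorProduct.comm k C Q).toLinearMap
  compat f x c := (rTensor_comm _ _).trans
    ((congrArg _ (Υ.cover_compat x f c).symm).trans (rTensor_comm _ _).symm)
  coassoc := Υ.coassoc_flip
  injective c h := Υ.eq_zero_of_covL c fun x => (TensorProduct.comm k C Q).map_eq_zero_iff.1 (h x)

theorem leftTwist_leftTwistInv (S : Antipode H) (M : LeftModuleAlgebra H A)
    (Γ : LeftComoduleAlgebra H C) (z : C ⊗[k] A) :
    leftTwist M Γ (TensorProduct.comm k A C (leftTwistInv S M Γ z)) =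
      TensorProduct.comm k C A z :=
  (Γ.coactionCover S).twist_twistInv M.unital (leftTwist_isTwist M Γ)
    (M.existsUnique_twistInv S Γ).choose_spec.1 z

theorem leftTwistInv_leftTwist (S : Antipode H) (M : LeftModuleAlgebra H A)
    (Γ : LeftComoduleAlgebra H C) (z : C ⊗[k] A) :
    leftTwistInv S M Γ (TensorProduct.comm k A C (leftTwist M Γ z)) =
      TensorProduct.comm k C A z :=
  (Γ.coactionCover S).twistInv_twist M.unital (leftTwist_isTwist M Γ)
    (M.existsUnique_twistInv S Γ).choose_spec.1 z

theorem rightTwist_rightTwistInv (S : Antipode H) (N : RightModuleAlgebra H A)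
    (Υ : RightComoduleAlgebra H C) (z : C ⊗[k] A) :
    rightTwist N Υ (TensorProduct.comm k A C (rightTwistInv S N Υ z)) =
      TensorProduct.comm k C A z :=
  (Υ.coactionCover S).twist_twistInv N.unital (rightTwist_isTwist N Υ)
    (N.existsUnique_twistInv S Υ).choose_spec.1 z

theorem rightTwistInv_rightTwist (S : Antipode H) (N : RightModuleAlgebra H A)
    (Υ : RightComoduleAlgebra H C) (z : C ⊗[k] A) :
    rightTwistInv S N Υ (TensorProduct.comm k A C (rightTwist N Υ z)) =
      TensorProduct.comm k C A z :=
  (Υ.coactionCover S).twistInv_twist N.unital (rightTwist_isTwist N Υ)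
    (N.existsUnique_twistInv S Υ).choose_spec.1 z

theorem leftTwist_bijective (S : Antipode H) (M : LeftModuleAlgebra H A)
    (Γ : LeftComoduleAlgebra H C) : Function.Bijective (leftTwist M Γ) := by
  refine ⟨fun z w h => ?_, fun z => ?_⟩
  · apply (TensorProduct.comm k C A).injective
    rw [← leftTwistInv_leftTwist S M Γ, h, leftTwistInv_leftTwist]
  · refine ⟨_, (leftTwist_leftTwistInv S M Γ (TensorProduct.comm k A C z)).trans ?_⟩
    exact (TensorProduct.comm k A C).symm_apply_apply z

theorem rightTwist_bijective (S : Antipode H) (N : RightModuleAlgebra H A)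
    (Υ : RightComoduleAlgebra H C) : Function.Bijective (rightTwist N Υ) := by
  refine ⟨fun z w h => ?_, fun z => ?_⟩
  · apply (TensorProduct.comm k C A).injective
    rw [← rightTwistInv_rightTwist S N Υ, h, rightTwistInv_rightTwist]
  · refine ⟨_, (rightTwist_rightTwistInv S N Υ (TensorProduct.comm k A C z)).trans ?_⟩
    exact (TensorProduct.comm k A C).symm_apply_apply z

end Hopf

/-! ### Isomorphisms of spaces with bilinear products -/

section AlgebraIso

variable {k X Y Z : Type*} [Field k] [NonUnitalNonAssocRing X] [Module k X]
  [NonUnitalNonAssocRing Y] [Module k Y] [NonUnitalNonAssocRing Z] [Module k Z]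

theorem IsAlgebraIso.symm {e : X ≃ₗ[k] Y} (h : IsAlgebraIso e) : IsAlgebraIso e.symm := by
  intro x y
  apply e.injective
  simp [h _ _]

theorem IsAlgebraIso.trans {e : X ≃ₗ[k] Y} {f : Y ≃ₗ[k] Z} (h : IsAlgebraIso e)
    (h' : IsAlgebraIso f) : IsAlgebraIso (e ≪≫ₗ f) := by
  intro x y
  simp [h _ _, h' _ _]

/-- A multiplicative linear isomorphism between spaces with bilinear products. -/
theorem isAlgebraIso_withProduct {V W : Type*} [AddCommGroup V] [Module k V] [AddCommGroup W]
    [Module k W] {μ : V →ₗ[k] V →ₗ[k] V} {ν : W →ₗ[k] W →ₗ[k] W} (e : V ≃ₗ[k] W)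
    (h : ∀ x y, e (μ x y) = ν (e x) (e y)) :
    IsAlgebraIso ((WithProduct.of μ).symm ≪≫ₗ e ≪≫ₗ WithProduct.of ν) := by
  intro x y
  simp [WithProduct.mul_def, h]

end AlgebraIso

/-! ### Smash products -/

section InducedCovers

variable {k Q L A B C : Type*} [Field k] [AddCommGroup Q] [Module k Q] [AddCommGroup L] [Module k L]
  [AddCommGroup A] [Module k A] [AddCommGroup B] [Module k B] [AddCommGroup C] [Module k C]

/-- The map `x ↦ (a # c ↦ ∑ (a # d) ⊗ q)`, where `G x c = ∑ d ⊗ q`. -/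
def inducedRight (μ : A ⊗[k] C →ₗ[k] A ⊗[k] C →ₗ[k] A ⊗[k] C) (G : L →ₗ[k] C →ₗ[k] C ⊗[k] L) :
    L →ₗ[k] WithProduct μ →ₗ[k] WithProduct μ ⊗[k] L :=
  ((LinearMap.lTensorHom A ∘ₗ G).compr₂
    (LinearMap.rTensor L (WithProduct.of μ).toLinearMap ∘ₗ
      (TensorProduct.assoc k A C L).symm.toLinearMap)).compl₂ (WithProduct.of μ).symm.toLinearMap

theorem inducedRight_tmul (μ : A ⊗[k] C →ₗ[k] A ⊗[k] C →ₗ[k] A ⊗[k] C)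
    (G : L →ₗ[k] C →ₗ[k] C ⊗[k] L) (x : L) (a : A) (c : C) :
    inducedRight μ G x (WithProduct.of μ (a ⊗ₜ c)) =
      LinearMap.rTensor L ((WithProduct.of μ).toLinearMap ∘ₗ TensorProduct.mk k A C a) (G x c) := by
  simp only [inducedRight, LinearMap.compl₂_apply, LinearEquiv.coe_coe,
    LinearEquiv.symm_apply_apply, LinearMap.compr₂_apply, LinearMap.comp_apply,
    LinearMap.coe_lTensorHom, LinearMap.lTensor_tmul]
  generalize G x c = s
  induction s using TensorProduct.induction_on with
  | zero => simp
  | add x y hx hy => simp only [map_add, TensorProduct.tmul_add, hx, hy]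
  | tmul p e => simp

/-- The map `x ↦ (c # b ↦ ∑ q ⊗ (d # b))`, where `G x c = ∑ q ⊗ d`. -/
def inducedLeft (μ : C ⊗[k] B →ₗ[k] C ⊗[k] B →ₗ[k] C ⊗[k] B) (G : Q →ₗ[k] C →ₗ[k] Q ⊗[k] C) :
    Q →ₗ[k] WithProduct μ →ₗ[k] Q ⊗[k] WithProduct μ :=
  ((LinearMap.rTensorHom B ∘ₗ G).compr₂
    (LinearMap.lTensor Q (WithProduct.of μ).toLinearMap ∘ₗ
      (TensorProduct.assoc k Q C B).toLinearMap)).compl₂ (WithProduct.of μ).symm.toLinearMap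

theorem inducedLeft_tmul (μ : C ⊗[k] B →ₗ[k] C ⊗[k] B →ₗ[k] C ⊗[k] B)
    (G : Q →ₗ[k] C →ₗ[k] Q ⊗[k] C) (x : Q) (c : C) (b : B) :
    inducedLeft μ G x (WithProduct.of μ (c ⊗ₜ b)) =
      LinearMap.lTensor Q ((WithProduct.of μ).toLinearMap ∘ₗ (TensorProduct.mk k C B).flip b)
        (G x c) := by
  simp only [inducedLeft, LinearMap.compl₂_apply, LinearEquiv.coe_coe,
    LinearEquiv.symm_apply_apply, LinearMap.compr₂_apply, LinearMap.comp_apply,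
    LinearMap.coe_rTensorHom, LinearMap.rTensor_tmul]
  generalize G x c = s
  induction s using TensorProduct.induction_on with
  | zero => simp
  | add x y hx hy => simp only [map_add, TensorProduct.add_tmul, hx, hy]
  | tmul p e => simp

theorem inducedRight_eq_zero {μ : A ⊗[k] C →ₗ[k] A ⊗[k] C →ₗ[k] A ⊗[k] C}
    {G : L →ₗ[k] C →ₗ[k] C ⊗[k] L} (hG : ∀ c, (∀ x, G x c = 0) → c = 0) (z : WithProduct μ)
    (h : ∀ x, inducedRight μ G x z = 0) : z = 0 := by
  refine (WithProduct.of μ).symm.map_eq_zero_iff.1 ?_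
  refine eq_zero_of_forall_lTensor (fun x => G x) hG _ fun x => ?_
  exact (TensorProduct.assoc k A C L).symm.map_eq_zero_iff.1
    ((LinearEquiv.rTensor L (WithProduct.of μ)).map_eq_zero_iff.1 (h x))

theorem inducedLeft_eq_zero {μ : C ⊗[k] B →ₗ[k] C ⊗[k] B →ₗ[k] C ⊗[k] B}
    {G : Q →ₗ[k] C →ₗ[k] Q ⊗[k] C} (hG : ∀ c, (∀ x, G x c = 0) → c = 0) (z : WithProduct μ)
    (h : ∀ x, inducedLeft μ G x z = 0) : z = 0 := by
  refine (WithProduct.of μ).symm.map_eq_zero_iff.1 ?_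
  refine eq_zero_of_forall_rTensor (fun x => G x) hG _ fun x => ?_
  exact (TensorProduct.assoc k Q C B).map_eq_zero_iff.1
    ((LinearEquiv.lTensor Q (WithProduct.of μ)).map_eq_zero_iff.1 (h x))

end InducedCovers

/-! ### Associativity and nondegeneracy of smash products, multiplicativity of induced coactions -/

section Induced

variable {k : Type*} [Field k] {Q L : Type*}
  [NonUnitalRing Q] [Module k Q] [SMulCommClass k Q Q] [IsScalarTower k Q Q]
  [NonUnitalRing L] [Module k L] [SMulCommClass k L L] [IsScalarTower k L L]
  {HQ : MultiplierHopfAlgebra k Q} {HL : MultiplierHopfAlgebra k L}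
  {A B C : Type*}
  [NonUnitalNonAssocRing A] [Module k A] [SMulCommClass k A A] [IsScalarTower k A A]
  [NonUnitalNonAssocRing B] [Module k B] [SMulCommClass k B B] [IsScalarTower k B B]
  [NonUnitalNonAssocRing C] [Module k C] [SMulCommClass k C C] [IsScalarTower k C C]

theorem smashL_assoc (hA : ∀ a b c : A, a * b * c = a * (b * c)) (M : LeftModuleAlgebra HQ A)
    (Γ : LeftComoduleAlgebra HQ C) (x y z : SmashL M Γ) : x * y * z = x * (y * z) :=
  twistedProduct_assoc hA Γ.assoc (leftTwist_twistsFst M Γ) (leftTwist_twistsSnd M Γ) x y z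

theorem smashR_assoc (hB : ∀ a b c : B, a * b * c = a * (b * c)) (Υ : RightComoduleAlgebra HL C)
    (N : RightModuleAlgebra HL B) (x y z : SmashR Υ N) : x * y * z = x * (y * z) :=
  twistedProduct_assoc Υ.assoc hB (rightTwist'_twistsFst N Υ) (rightTwist'_twistsSnd N Υ) x y z

theorem smashL_nondegenerate (S : Antipode HQ) (hA : NondegenerateProduct A)
    (M : LeftModuleAlgebra HQ A) (Γ : LeftComoduleAlgebra HQ C) :
    NondegenerateProduct (SmashL M Γ) :=
  twistedProduct_nondegenerate hA Γ.nondeg (leftTwist_bijective S M Γ) (leftTwist_twistsFst M Γ)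
    (leftTwist_twistsSnd M Γ)

theorem smashR_nondegenerate (S : Antipode HL) (hB : NondegenerateProduct B)
    (Υ : RightComoduleAlgebra HL C) (N : RightModuleAlgebra HL B) :
    NondegenerateProduct (SmashR Υ N) :=
  twistedProduct_nondegenerate Υ.nondeg hB (swapTwist_bijective (rightTwist_bijective S N Υ))
    (rightTwist'_twistsFst N Υ) (rightTwist'_twistsSnd N Υ)

theorem smashL_mul_tmul (M : LeftModuleAlgebra HQ A) (Γ : LeftComoduleAlgebra HQ C)
    (a a' : A) (c c' : C) :
    (WithProduct.of _ (a ⊗ₜ c) : SmashL M Γ) * WithProduct.of _ (a' ⊗ₜ c') =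
      WithProduct.of _ (TensorProduct.map (LinearMap.mul k A a) ((LinearMap.mul k C).flip c')
        (leftTwist M Γ (c ⊗ₜ a'))) := by
  rw [← twistedProduct_tmul]
  rfl

theorem smashR_mul_tmul (Υ : RightComoduleAlgebra HL C) (N : RightModuleAlgebra HL B)
    (c c' : C) (b b' : B) :
    (WithProduct.of _ (c ⊗ₜ b) : SmashR Υ N) * WithProduct.of _ (c' ⊗ₜ b') =
      WithProduct.of _ (TensorProduct.map (LinearMap.mul k C c) ((LinearMap.mul k B).flip b')
        (rightTwist' N Υ (b ⊗ₜ c'))) := by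
  rw [← twistedProduct_tmul]
  rfl

/-- The twist of `A` with `C` is `L`-colinear because Γ and Υ commute. This makes the coaction
induced on the smash product multiplicative. -/
theorem BicomoduleAlgebra.covL_leftTwist (Γ : BicomoduleAlgebra HQ HL C)
    (M : LeftModuleAlgebra HQ A) (x : L) (c : C) (a : A) :
    LinearMap.lTensor A (Γ.right.covL x) (leftTwist M Γ.left (c ⊗ₜ a)) =
      TensorProduct.assoc k A C L
        (LinearMap.rTensor L (leftTwist M Γ.left ∘ₗ (TensorProduct.mk k C A).flip a)
          (Γ.right.covL x c)) := by
  induction a using unital_induction M.unital with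
  | zero => simp
  | add v w hv hw =>
    simp only [TensorProduct.tmul_add, map_add, LinearMap.comp_add, LinearMap.rTensor_add,
      LinearMap.add_apply, hv, hw]
  | mem y a =>
  rw [leftTwist_isTwist, ← rTensor_lTensor_comm, Γ.coact_comm]
  generalize Γ.right.covL x c = s
  induction s using TensorProduct.induction_on with
  | zero => simp
  | add x y hx hy => simp only [map_add, hx, hy]
  | tmul d q =>
    simp only [LinearMap.rTensor_tmul, LinearMap.comp_apply, LinearMap.flip_apply,
      TensorProduct.mk_apply, leftTwist_isTwist M Γ.left y d a]
    generalize Γ.left.covR y d = s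
    induction s using TensorProduct.induction_on with
    | zero => simp
    | add x y hx hy => simp only [map_add, TensorProduct.add_tmul, hx, hy]
    | tmul p e => simp

theorem BicomoduleAlgebra.covR_rightTwist' (Γ : BicomoduleAlgebra HQ HL C)
    (N : RightModuleAlgebra HL B) (x : Q) (c : C) (b : B) :
    TensorProduct.assoc k Q C B
      (LinearMap.rTensor B (Γ.left.covR x) (rightTwist' N Γ.right (b ⊗ₜ c))) =
        LinearMap.lTensor Q (rightTwist' N Γ.right ∘ₗ TensorProduct.mk k B C b)
          (Γ.left.covR x c) := by
  induction b using unital_induction N.unital with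
  | zero => simp
  | add v w hv hw =>
    simp only [TensorProduct.add_tmul, map_add, LinearMap.comp_add, LinearMap.lTensor_add,
      LinearMap.add_apply, hv, hw]
  | mem y b =>
  have h := congrArg (LinearMap.lTensor Q (LinearMap.lTensor C (N.act.flip b)))
    (Γ.coact_comm y x c)
  have e₁ : ∀ t : Q ⊗[k] C, LinearMap.lTensor Q (LinearMap.lTensor C (N.act.flip b))
      (LinearMap.lTensor Q (Γ.right.covL y) t) =
      LinearMap.lTensor Q (rightTwist' N Γ.right ∘ₗ TensorProduct.mk k B C (N.act y b)) t := by
    intro t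
    induction t using TensorProduct.induction_on with
    | zero => simp
    | add x y hx hy => simp only [map_add, hx, hy]
    | tmul q d =>
      simp only [LinearMap.lTensor_tmul, LinearMap.comp_apply, TensorProduct.mk_apply,
        rightTwist'_eq, swapTwist_tmul, rightTwist_isTwist N Γ.right y d b, LinearMap.compr₂_apply,
        LinearEquiv.coe_coe]
      generalize Γ.right.covL y d = s
      induction s using TensorProduct.induction_on with
      | zero => simp
      | add x y hx hy => simp only [map_add, TensorProduct.tmul_add, hx, hy]
      | tmul p e => simp
  have e₂ : ∀ t : C ⊗[k] L, LinearMap.lTensor Q (LinearMap.lTensor C (N.act.flip b))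
      (TensorProduct.assoc k Q C L (LinearMap.rTensor L (Γ.left.covR x) t)) =
      TensorProduct.assoc k Q C B (LinearMap.rTensor B (Γ.left.covR x)
        (LinearMap.lTensor C (N.act.flip b) t)) := by
    intro t
    induction t using TensorProduct.induction_on with
    | zero => simp
    | add x y hx hy => simp only [map_add, hx, hy]
    | tmul d q =>
      simp only [LinearMap.lTensor_tmul, LinearMap.rTensor_tmul]
      generalize Γ.left.covR x d = s
      induction s using TensorProduct.induction_on with
      | zero => simp
      | add x y hx hy => simp only [map_add, TensorProduct.add_tmul, hx, hy]
      | tmul p e => simp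
  rw [e₁, e₂] at h
  rw [h, rightTwist'_eq, swapTwist_tmul, rightTwist_isTwist N Γ.right y c b]
  congr 2
  simp only [LinearMap.compr₂_apply, LinearEquiv.coe_coe]
  generalize Γ.right.covL y c = s
  induction s using TensorProduct.induction_on with
  | zero => simp
  | add x y hx hy => simp only [map_add, hx, hy]
  | tmul p e => simp

/-- In a(c₍₋₁₎ ▷ a') # c₀c' the coaction of `L` sees only c₀c'. Multiplicativity on `C` separates c₀
from c', and colinearity of the twist lets the coaction be applied to `c` before twisting. -/
theorem inducedRight_mul (Γ : BicomoduleAlgebra HQ HL C) (M : LeftModuleAlgebra HQ A) (x : L)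
    (z z' : SmashL M Γ.left) :
    inducedRight _ Γ.right.covL x (z * z') =
      mulL (LinearMap.mul k (SmashL M Γ.left)) (LinearMap.lTensor _
        ((inducedRight _ Γ.right.covL).flip z') (inducedRight _ Γ.right.covL x z)) := by
  obtain ⟨z, rfl⟩ := (WithProduct.of _).surjective z
  obtain ⟨z', rfl⟩ := (WithProduct.of _).surjective z'
  induction z using TensorProduct.induction_on with
  | zero => simp
  | add x y hx hy => simp only [map_add, add_mul, hx, hy]
  | tmul a c =>
  induction z' using TensorProduct.induction_on with
  | zero => simp
  | add x y hx hy =>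
    simp only [map_add, mul_add, hx, hy, LinearMap.lTensor_add, LinearMap.add_apply]
  | tmul a' c' =>
  -- `Θ (α ⊗ s) = ∑ (a α # e) ⊗ r` with `∑ e ⊗ r = s Υ(c')`
  let Θ : A ⊗[k] (C ⊗[k] L) →ₗ[k] SmashL M Γ.left ⊗[k] L :=
    LinearMap.rTensor L (WithProduct.of _).toLinearMap ∘ₗ
      (TensorProduct.assoc k A C L).symm.toLinearMap ∘ₗ
      TensorProduct.map (LinearMap.mul k A a)
        (mulL (LinearMap.mul k C) ∘ₗ LinearMap.lTensor C (Γ.right.covL.flip c'))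
  have e₁ : ∀ t : A ⊗[k] C, inducedRight _ Γ.right.covL x
      (WithProduct.of (twistedProduct (leftTwist M Γ.left))
        (TensorProduct.map (LinearMap.mul k A a) ((LinearMap.mul k C).flip c') t)) =
      Θ (LinearMap.lTensor A (Γ.right.covL x) t) := by
    intro t
    induction t using TensorProduct.induction_on with
    | zero => simp
    | add x y hx hy => simp only [map_add, hx, hy]
    | tmul α γ =>
      rw [TensorProduct.map_tmul, inducedRight_tmul, LinearMap.flip_apply, LinearMap.mul_apply',
        LinearMap.mul_apply', Γ.right.covL_mul]
      simp only [Θ, LinearMap.lTensor_tmul, LinearMap.comp_apply, TensorProduct.map_tmul,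
        LinearMap.mul_apply', LinearEquiv.coe_coe]
      generalize mulL (LinearMap.mul k C)
        (LinearMap.lTensor C (Γ.right.covL.flip c') (Γ.right.covL x γ)) = s
      induction s using TensorProduct.induction_on with
      | zero => simp
      | add x y hx hy => simp only [map_add, TensorProduct.tmul_add, hx, hy]
      | tmul p e => simp
  rw [smashL_mul_tmul, e₁, Γ.covL_leftTwist, inducedRight_tmul]
  generalize Γ.right.covL x c = s
  induction s using TensorProduct.induction_on with
  | zero => simp
  | add x y hx hy => simp only [map_add, hx, hy]
  | tmul d q =>
    simp only [LinearMap.rTensor_tmul, LinearMap.lTensor_tmul, LinearMap.comp_apply,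
      LinearMap.flip_apply, TensorProduct.mk_apply, LinearEquiv.coe_coe, mulL_tmul,
      inducedRight_tmul]
    -- Left multiplication by a # d in the smash product, expressed through the twist of d ⊗ a',
    -- which can then be generalized to an arbitrary tensor.
    have e₂ : ∀ s : C ⊗[k] L, LinearMap.rTensor L
        (LinearMap.mul k (SmashL M Γ.left) (WithProduct.of _ (a ⊗ₜ d)))
        (LinearMap.rTensor L ((WithProduct.of (twistedProduct (leftTwist M Γ.left))).toLinearMap ∘ₗ
          TensorProduct.mk k A C a') s) =
        LinearMap.rTensor L (WithProduct.of _).toLinearMap ((TensorProduct.assoc k A C L).symm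
          (TensorProduct.map (LinearMap.mul k A a) (mulL (LinearMap.mul k C))
            (TensorProduct.assoc k A C (C ⊗[k] L) (leftTwist M Γ.left (d ⊗ₜ a') ⊗ₜ s)))) := by
      intro s
      induction s using TensorProduct.induction_on with
      | zero => simp
      | add x y hx hy => simp only [map_add, TensorProduct.tmul_add, hx, hy]
      | tmul e r =>
        simp only [LinearMap.rTensor_tmul, LinearMap.comp_apply, LinearEquiv.coe_coe,
          TensorProduct.mk_apply, LinearMap.mul_apply', smashL_mul_tmul]
        generalize leftTwist M Γ.left (d ⊗ₜ a') = s
        induction s using TensorProduct.induction_on with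
        | zero => simp
        | add x y hx hy => simp only [map_add, TensorProduct.add_tmul, hx, hy]
        | tmul α δ => simp
    rw [e₂]
    generalize leftTwist M Γ.left (d ⊗ₜ a') = s
    induction s using TensorProduct.induction_on with
    | zero => simp
    | add x y hx hy => simp only [map_add, TensorProduct.add_tmul, hx, hy]
    | tmul α δ => simp [Θ]

theorem inducedLeft_mul (Γ : BicomoduleAlgebra HQ HL C) (N : RightModuleAlgebra HL B) (x : Q)
    (z z' : SmashR Γ.right N) :
    inducedLeft _ Γ.left.covR x (z * z') =
      mulR (LinearMap.mul k (SmashR Γ.right N)) (LinearMap.rTensor _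
        ((inducedLeft _ Γ.left.covR).flip z) (inducedLeft _ Γ.left.covR x z')) := by
  obtain ⟨z, rfl⟩ := (WithProduct.of _).surjective z
  obtain ⟨z', rfl⟩ := (WithProduct.of _).surjective z'
  induction z using TensorProduct.induction_on with
  | zero => simp
  | add x y hx hy =>
    simp only [map_add, add_mul, hx, hy, LinearMap.rTensor_add, LinearMap.add_apply]
  | tmul c b =>
  induction z' using TensorProduct.induction_on with
  | zero => simp
  | add x y hx hy => simp only [map_add, mul_add, hx, hy]
  | tmul c' b' =>
  let Θ : (Q ⊗[k] C) ⊗[k] B →ₗ[k] Q ⊗[k] SmashR Γ.right N :=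
    LinearMap.lTensor Q (WithProduct.of _).toLinearMap ∘ₗ
      (TensorProduct.assoc k Q C B).toLinearMap ∘ₗ
      TensorProduct.map (mulR (LinearMap.mul k C) ∘ₗ LinearMap.rTensor C (Γ.left.covR.flip c))
        ((LinearMap.mul k B).flip b')
  have e₁ : ∀ t : C ⊗[k] B, inducedLeft _ Γ.left.covR x
      (WithProduct.of (twistedProduct (rightTwist' N Γ.right))
        (TensorProduct.map (LinearMap.mul k C c) ((LinearMap.mul k B).flip b') t)) =
      Θ (LinearMap.rTensor B (Γ.left.covR x) t) := by
    intro t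
    induction t using TensorProduct.induction_on with
    | zero => simp
    | add x y hx hy => simp only [map_add, hx, hy]
    | tmul γ β =>
      rw [TensorProduct.map_tmul, inducedLeft_tmul, LinearMap.flip_apply, LinearMap.mul_apply',
        LinearMap.mul_apply', Γ.left.covR_mul]
      simp only [Θ, LinearMap.rTensor_tmul, LinearMap.comp_apply, TensorProduct.map_tmul,
        LinearMap.mul_apply', LinearEquiv.coe_coe, LinearMap.flip_apply]
      generalize mulR (LinearMap.mul k C)
        (LinearMap.rTensor C (Γ.left.covR.flip c) (Γ.left.covR x γ)) = s
      induction s using TensorProduct.induction_on with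
      | zero => simp
      | add x y hx hy => simp only [map_add, TensorProduct.add_tmul, hx, hy]
      | tmul p e => simp
  rw [smashR_mul_tmul, e₁, inducedLeft_tmul, ← (TensorProduct.assoc k Q C B).symm_apply_apply
    (LinearMap.rTensor B (Γ.left.covR x) (rightTwist' N Γ.right (b ⊗ₜ c'))), Γ.covR_rightTwist']
  generalize Γ.left.covR x c' = s
  induction s using TensorProduct.induction_on with
  | zero => simp
  | add x y hx hy => simp only [map_add, hx, hy]
  | tmul q d =>
    simp only [LinearMap.rTensor_tmul, LinearMap.lTensor_tmul, LinearMap.comp_apply,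
      LinearMap.flip_apply, TensorProduct.mk_apply, LinearEquiv.coe_coe, mulR_tmul,
      inducedLeft_tmul]
    have e₂ : ∀ s : Q ⊗[k] C, LinearMap.lTensor Q
        ((LinearMap.mul k (SmashR Γ.right N)).flip (WithProduct.of _ (d ⊗ₜ b')))
        (LinearMap.lTensor Q
          ((WithProduct.of (twistedProduct (rightTwist' N Γ.right))).toLinearMap ∘ₗ
            (TensorProduct.mk k C B).flip b) s) =
        LinearMap.lTensor Q (WithProduct.of _).toLinearMap (TensorProduct.assoc k Q C B
          (TensorProduct.map (mulR (LinearMap.mul k C)) ((LinearMap.mul k B).flip b')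
            ((TensorProduct.assoc k (Q ⊗[k] C) C B).symm
              (s ⊗ₜ rightTwist' N Γ.right (b ⊗ₜ d))))) := by
      intro s
      induction s using TensorProduct.induction_on with
      | zero => simp
      | add x y hx hy => simp only [map_add, TensorProduct.add_tmul, hx, hy]
      | tmul r e =>
        simp only [LinearMap.lTensor_tmul, LinearMap.comp_apply, LinearEquiv.coe_coe,
          TensorProduct.mk_apply, LinearMap.mul_apply', LinearMap.flip_apply, smashR_mul_tmul]
        generalize rightTwist' N Γ.right (b ⊗ₜ d) = s
        induction s using TensorProduct.induction_on with
        | zero => simp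
        | add x y hx hy => simp only [map_add, TensorProduct.tmul_add, hx, hy]
        | tmul α δ => simp
    rw [e₂]
    generalize rightTwist' N Γ.right (b ⊗ₜ d) = s
    induction s using TensorProduct.induction_on with
    | zero => simp
    | add x y hx hy => simp only [map_add, TensorProduct.tmul_add, hx, hy]
    | tmul α δ => simp [Θ]

end Induced

/-! ### Coactions on smash products -/

section Lift

variable {k M N P M' : Type*} [Field k] [AddCommGroup M] [Module k M] [AddCommGroup N] [Module k N]
  [AddCommGroup P] [Module k P] [AddCommGroup M'] [Module k M']

theorem lift_zero : TensorProduct.lift (0 : M →ₗ[k] N →ₗ[k] P) = 0 :=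
  TensorProduct.ext' fun _ _ => by simp

theorem lift_add (f g : M →ₗ[k] N →ₗ[k] P) :
    TensorProduct.lift (f + g) = TensorProduct.lift f + TensorProduct.lift g :=
  TensorProduct.ext' fun _ _ => by simp

theorem compl₂_zero (f : M →ₗ[k] N →ₗ[k] P) : f.compl₂ (0 : M' →ₗ[k] N) = 0 := by
  ext
  simp

theorem compl₂_add (f : M →ₗ[k] N →ₗ[k] P) (g g' : M' →ₗ[k] N) :
    f.compl₂ (g + g') = f.compl₂ g + f.compl₂ g' := by
  ext
  simp

end Lift

section InducedCoactions

variable {k : Type*} [Field k] {Q L : Type*}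
  [NonUnitalRing Q] [Module k Q] [SMulCommClass k Q Q] [IsScalarTower k Q Q]
  [NonUnitalRing L] [Module k L] [SMulCommClass k L L] [IsScalarTower k L L]
  {HQ : MultiplierHopfAlgebra k Q} {HL : MultiplierHopfAlgebra k L}
  {A B C : Type*}
  [NonUnitalNonAssocRing A] [Module k A] [SMulCommClass k A A] [IsScalarTower k A A]
  [NonUnitalNonAssocRing B] [Module k B] [SMulCommClass k B B] [IsScalarTower k B B]
  [NonUnitalNonAssocRing C] [Module k C] [SMulCommClass k C C] [IsScalarTower k C C]

theorem LeftComoduleAlgebra.eq_zero_of_covL (Γ : LeftComoduleAlgebra HQ C) (c : C)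
    (h : ∀ x, Γ.covL x c = 0) : c = 0 := by
  refine (injective_iff_map_eq_zero Γ.coact).1 Γ.injective c ?_
  refine (outerMul_fst HQ.localUnits).eq_of_right
    (NondegenerateProduct.tensor_left HQ.localUnits Γ.nondeg Γ.assoc) fun x u => ?_
  rw [Γ.covL_spec, h, mul_zero]
  rfl

/-- The antipode enters through nondegeneracy of A # C, which is part of being a comodule algebra
and rests on bijectivity of the twist. The other axioms are transported from `C`: the coaction does
not touch the `A` leg. -/
theorem exists_isInducedRight (S : Antipode HQ) (hA : NondegenerateProduct A)
    (hass : ∀ a b c : A, a * b * c = a * (b * c)) (M : LeftModuleAlgebra HQ A)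
    (Γ : BicomoduleAlgebra HQ HL C) :
    ∃ Υ' : RightComoduleAlgebra HL (SmashL M Γ.left), IsInducedRight M Γ.left Γ.right Υ' := by
  have hX := smashL_assoc hass M Γ.left
  have hX' := smashL_nondegenerate S hA M Γ.left
  obtain ⟨coact, hinj, hcov⟩ := (outerMul_snd (C := SmashL M Γ.left) HL.localUnits).exists_coaction
    (NondegenerateProduct.tensor_right HL.localUnits hX' hX)
    (tensor_mul_assoc hX mul_assoc)
    (inducedRight (twistedProduct (leftTwist M Γ.left)) Γ.right.covR)
    (inducedRight (twistedProduct (leftTwist M Γ.left)) Γ.right.covL)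
    (fun f x z => by
      obtain ⟨z, rfl⟩ := (WithProduct.of _).surjective z
      induction z using TensorProduct.induction_on with
      | zero => simp
      | add x y hx hy => simp only [map_add, hx, hy]
      | tmul a c =>
        have h := congrArg (LinearMap.rTensor L
          ((WithProduct.of (twistedProduct (leftTwist M Γ.left))).toLinearMap ∘ₗ
            TensorProduct.mk k A C a)) (Γ.right.cover_compat f x c)
        rw [inducedRight_tmul, inducedRight_tmul]
        refine (rTensor_lTensor_comm _ _ _).symm.trans (h.trans (rTensor_lTensor_comm _ _ _)))
    (fun z z' m m' hm hm' => Or.inr fun x u => by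
      rw [inducedRight_mul, ← right_mul_of_cover hX m' _ hm'.2]
      exact congrArg (Multiplier.right m') (hm.2 x u))
    (inducedRight_eq_zero Γ.right.eq_zero_of_covL)
  refine ⟨{
    assoc := hX
    nondeg := hX'
    coact := coact
    injective := hinj
    covR := inducedRight _ Γ.right.covR
    covL := inducedRight _ Γ.right.covL
    covR_spec := fun x z => (hcov z).1 x
    covL_spec := fun x z => (hcov z).2 x
    coassoc := fun p y z => ?_ }, fun x a c => ⟨inducedRight_tmul _ _ x a c,
      inducedRight_tmul _ _ x a c⟩⟩
  obtain ⟨z, rfl⟩ := (WithProduct.of _).surjective z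
  induction z using TensorProduct.induction_on with
  | zero => simp [compl₂_zero, lift_zero]
  | add x y hx hy => simp only [map_add, compl₂_add, lift_add, LinearMap.add_apply, hx, hy]
  | tmul a c =>
  -- On a # c, coassociativity is the image of coassociativity on `C` under d ↦ a # d in the first
  -- leg.
  have h := congrArg (LinearMap.rTensor (L ⊗[k] L)
    ((WithProduct.of (twistedProduct (leftTwist M Γ.left))).toLinearMap ∘ₗ
      TensorProduct.mk k A C a)) (Γ.right.coassoc p y c)
  rw [inducedRight_tmul, ← rTensor_lTensor_comm, ← h]
  generalize HL.T₂ (y ⊗ₜ p) = s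
  induction s using TensorProduct.induction_on with
  | zero => simp
  | add x y hx hy => simp only [map_add, hx, hy]
  | tmul q r =>
    simp only [TensorProduct.lift.tmul, LinearMap.compl₂_apply, LinearMap.comp_apply,
      LinearMap.flip_apply, LinearMap.coe_rTensorHom, inducedRight_tmul]
    generalize Γ.right.covL r c = s
    induction s using TensorProduct.induction_on with
    | zero => simp
    | add x y hx hy => simp only [map_add, hx, hy]
    | tmul d q' =>
      simp only [LinearMap.rTensor_tmul, LinearMap.comp_apply, TensorProduct.mk_apply,
        LinearEquiv.coe_coe, inducedRight_tmul]
      generalize Γ.right.covL q d = s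
      induction s using TensorProduct.induction_on with
      | zero => simp
      | add x y hx hy => simp only [map_add, TensorProduct.add_tmul, hx, hy]
      | tmul e q => simp

theorem exists_isInducedLeft (S : Antipode HL) (hB : NondegenerateProduct B)
    (hass : ∀ a b c : B, a * b * c = a * (b * c)) (N : RightModuleAlgebra HL B)
    (Γ : BicomoduleAlgebra HQ HL C) :
    ∃ Γ' : LeftComoduleAlgebra HQ (SmashR Γ.right N), IsInducedLeft Γ.left Γ.right N Γ' := by
  have hX := smashR_assoc hass Γ.right N
  have hX' := smashR_nondegenerate S hB Γ.right N
  obtain ⟨coact, hinj, hcov⟩ := (outerMul_fst (C := SmashR Γ.right N) HQ.localUnits).exists_coaction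
    (NondegenerateProduct.tensor_left HQ.localUnits hX' hX)
    (tensor_mul_assoc mul_assoc hX)
    (inducedLeft (twistedProduct (rightTwist' N Γ.right)) Γ.left.covR)
    (inducedLeft (twistedProduct (rightTwist' N Γ.right)) Γ.left.covL)
    (fun f x z => by
      obtain ⟨z, rfl⟩ := (WithProduct.of _).surjective z
      induction z using TensorProduct.induction_on with
      | zero => simp
      | add x y hx hy => simp only [map_add, hx, hy]
      | tmul c b =>
        have h := congrArg (LinearMap.lTensor Q
          ((WithProduct.of (twistedProduct (rightTwist' N Γ.right))).toLinearMap ∘ₗ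
            (TensorProduct.mk k C B).flip b)) (Γ.left.cover_compat f x c)
        rw [inducedLeft_tmul, inducedLeft_tmul]
        refine (rTensor_lTensor_comm _ _ _).trans (h.trans (rTensor_lTensor_comm _ _ _).symm))
    (fun z z' m m' hm hm' => Or.inl fun x u => by
      rw [inducedLeft_mul, ← left_mul_of_cover hX m _ hm.1]
      exact congrArg (Multiplier.left m) (hm'.1 x u))
    (inducedLeft_eq_zero Γ.left.eq_zero_of_covL)
  refine ⟨{
    assoc := hX
    nondeg := hX'
    coact := coact
    injective := hinj
    covR := inducedLeft _ Γ.left.covR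
    covL := inducedLeft _ Γ.left.covL
    covR_spec := fun x z => (hcov z).1 x
    covL_spec := fun x z => (hcov z).2 x
    coassoc := fun p y z => ?_ }, fun x c b => ⟨inducedLeft_tmul _ _ x c b,
      inducedLeft_tmul _ _ x c b⟩⟩
  obtain ⟨z, rfl⟩ := (WithProduct.of _).surjective z
  induction z using TensorProduct.induction_on with
  | zero => simp [lift_zero]
  | add x y hx hy => simp only [map_add, LinearMap.comp_add, lift_add, LinearMap.add_apply, hx, hy]
  | tmul c b =>
  have h := congrArg (LinearMap.lTensor Q (LinearMap.lTensor Q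
    ((WithProduct.of (twistedProduct (rightTwist' N Γ.right))).toLinearMap ∘ₗ
      (TensorProduct.mk k C B).flip b))) (Γ.left.coassoc p y c)
  have e : ∀ t : Q ⊗[k] C, LinearMap.lTensor Q (LinearMap.lTensor Q
      ((WithProduct.of (twistedProduct (rightTwist' N Γ.right))).toLinearMap ∘ₗ
        (TensorProduct.mk k C B).flip b)) (TensorProduct.assoc k Q Q C
          (LinearMap.rTensor C (HQ.T₁.toLinearMap ∘ₗ (TensorProduct.mk k Q Q).flip y) t)) =
      TensorProduct.assoc k Q Q _
        (LinearMap.rTensor _ (HQ.T₁.toLinearMap ∘ₗ (TensorProduct.mk k Q Q).flip y)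
        (LinearMap.lTensor Q
          ((WithProduct.of (twistedProduct (rightTwist' N Γ.right))).toLinearMap ∘ₗ
            (TensorProduct.mk k C B).flip b) t)) := by
    intro t
    rw [rTensor_lTensor_comm]
    generalize LinearMap.rTensor C (HQ.T₁.toLinearMap ∘ₗ (TensorProduct.mk k Q Q).flip y) t = s
    induction s using TensorProduct.induction_on with
    | zero => simp
    | add x y hx hy => simp only [map_add, hx, hy]
    | tmul r d =>
      induction r using TensorProduct.induction_on with
      | zero => simp
      | add x y hx hy => simp only [map_add, TensorProduct.add_tmul, hx, hy]
      | tmul r r' => simp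
  rw [inducedLeft_tmul, ← e, ← h]
  generalize HQ.T₁ (p ⊗ₜ y) = s
  induction s using TensorProduct.induction_on with
  | zero => simp
  | add x y hx hy => simp only [map_add, hx, hy]
  | tmul q r =>
    simp only [TensorProduct.lift.tmul, LinearMap.comp_apply,
      LinearMap.flip_apply, LinearMap.coe_lTensorHom, inducedLeft_tmul]
    generalize Γ.left.covR q c = s
    induction s using TensorProduct.induction_on with
    | zero => simp
    | add x y hx hy => simp only [map_add, hx, hy]
    | tmul q' d =>
      simp only [LinearMap.lTensor_tmul, LinearMap.comp_apply, TensorProduct.mk_apply,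
        LinearMap.flip_apply, LinearEquiv.coe_coe, inducedLeft_tmul]

/-! ### Twisting maps of induced structures -/

/-- Twisting past a # c is twisting past `c` alone; this identifies the iterated smash product with
the two-sided one. -/
theorem rightTwist_of_isInducedRight {M : LeftModuleAlgebra HQ A} {Γ : LeftComoduleAlgebra HQ C}
    {Υ : RightComoduleAlgebra HL C} {Υ' : RightComoduleAlgebra HL (SmashL M Γ)}
    (h : IsInducedRight M Γ Υ Υ') (N : RightModuleAlgebra HL B) (a : A) (c : C) (b : B) :
    rightTwist N Υ' (WithProduct.of _ (a ⊗ₜ c) ⊗ₜ b) =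
      LinearMap.lTensor B ((WithProduct.of (twistedProduct (leftTwist M Γ))).toLinearMap ∘ₗ
        TensorProduct.mk k A C a) (rightTwist N Υ (c ⊗ₜ b)) := by
  induction b using unital_induction N.unital with
  | zero => simp
  | add v w hv hw => simp only [TensorProduct.tmul_add, map_add, hv, hw]
  | mem x b =>
  rw [rightTwist_isTwist N Υ' x, rightTwist_isTwist N Υ x, LinearMap.compr₂_apply,
    LinearMap.compr₂_apply, (h x a c).2, ← rTensor_lTensor_comm]
  congr 1
  generalize Υ.covL x c = s
  induction s using TensorProduct.induction_on with
  | zero => simp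
  | add x y hx hy => simp only [map_add, hx, hy]
  | tmul d q => simp

theorem leftTwist_of_isInducedLeft {Γ : LeftComoduleAlgebra HQ C} {Υ : RightComoduleAlgebra HL C}
    {N : RightModuleAlgebra HL B} {Γ' : LeftComoduleAlgebra HQ (SmashR Υ N)}
    (h : IsInducedLeft Γ Υ N Γ') (M : LeftModuleAlgebra HQ A) (a : A) (c : C) (b : B) :
    leftTwist M Γ' (WithProduct.of _ (c ⊗ₜ b) ⊗ₜ a) =
      LinearMap.lTensor A ((WithProduct.of (twistedProduct (rightTwist' N Υ))).toLinearMap ∘ₗ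
        (TensorProduct.mk k C B).flip b) (leftTwist M Γ (c ⊗ₜ a)) := by
  induction a using unital_induction M.unital with
  | zero => simp
  | add v w hv hw => simp only [TensorProduct.tmul_add, map_add, hv, hw]
  | mem x a =>
  rw [leftTwist_isTwist M Γ' x, leftTwist_isTwist M Γ x, (h x c b).1, rTensor_lTensor_comm]

/-- `Q` acts only on the first factor of A ⊗ B, so `b` passes through the twist unchanged. -/
theorem leftTwist_tensorLeft (M : LeftModuleAlgebra HQ A) (Γ : LeftComoduleAlgebra HQ C)
    (a : A) (b : B) (c : C) :
    leftTwist (tensorLeft (B := B) M) Γ (c ⊗ₜ (a ⊗ₜ b)) =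
      LinearMap.rTensor C ((TensorProduct.mk k A B).flip b) (leftTwist M Γ (c ⊗ₜ a)) := by
  induction a using unital_induction M.unital with
  | zero => simp
  | add v w hv hw => simp only [TensorProduct.tmul_add, TensorProduct.add_tmul, map_add, hv, hw]
  | mem x a =>
  refine (leftTwist_isTwist (tensorLeft (B := B) M) Γ x c (a ⊗ₜ b)).trans ?_
  rw [leftTwist_isTwist M Γ x, ← LinearMap.rTensor_comp_apply]
  rfl

theorem rightTwist_tensorRight (N : RightModuleAlgebra HL B) (Υ : RightComoduleAlgebra HL C)
    (a : A) (b : B) (c : C) :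
    rightTwist (tensorRight (A := A) N) Υ (c ⊗ₜ (a ⊗ₜ b)) =
      LinearMap.rTensor C (TensorProduct.mk k A B a) (rightTwist N Υ (c ⊗ₜ b)) := by
  induction b using unital_induction N.unital with
  | zero => simp
  | add v w hv hw => simp only [TensorProduct.tmul_add, map_add, hv, hw]
  | mem x b =>
  refine (rightTwist_isTwist (tensorRight (A := A) N) Υ x c (a ⊗ₜ b)).trans ?_
  rw [rightTwist_isTwist N Υ x, ← LinearMap.rTensor_comp_apply]
  rfl

end InducedCoactions

/-! ### Two-sided twisted tensor products -/

section Products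

variable {k : Type*} [Field k] {A B C : Type*}
  [NonUnitalNonAssocRing A] [Module k A] [SMulCommClass k A A] [IsScalarTower k A A]
  [NonUnitalNonAssocRing B] [Module k B] [SMulCommClass k B B] [IsScalarTower k B B]
  [NonUnitalNonAssocRing C] [Module k C] [SMulCommClass k C C] [IsScalarTower k C C]

theorem twoSidedProduct_tmul (R : C ⊗[k] A →ₗ[k] A ⊗[k] C) (T : B ⊗[k] C →ₗ[k] C ⊗[k] B)
    (a a' : A) (c c' : C) (b b' : B) :
    twoSidedProduct R T (a ⊗ₜ (c ⊗ₜ b)) (a' ⊗ₜ (c' ⊗ₜ b')) =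
      LinearMap.lTensor A (LinearMap.rTensor B (LinearMap.mul' k C) ∘ₗ
          (TensorProduct.assoc k C C B).symm.toLinearMap)
        (TensorProduct.assoc k A C (C ⊗[k] B)
          (LinearMap.rTensor C (LinearMap.mul k A a) (R (c ⊗ₜ a')) ⊗ₜ
            LinearMap.lTensor C ((LinearMap.mul k B).flip b') (T (b ⊗ₜ c')))) := by
  simp only [twoSidedProduct, TensorProduct.curry_apply, LinearMap.comp_apply,
    LinearMap.rTensor_tmul, LinearMap.lTensor_tmul, LinearEquiv.coe_coe,
    TensorProduct.assoc_symm_tmul, TensorProduct.tensorTensorTensorComm_tmul,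
    TensorProduct.map_tmul, TensorProduct.assoc_tmul]
  congr 3
  · generalize R (c ⊗ₜ a') = s
    induction s using TensorProduct.induction_on with
    | zero => simp
    | add x y hx hy => simp only [map_add, TensorProduct.tmul_add, hx, hy]
    | tmul α γ => simp
  · generalize T (b ⊗ₜ c') = s
    induction s using TensorProduct.induction_on with
    | zero => simp
    | add x y hx hy => simp only [map_add, TensorProduct.add_tmul, hx, hy]
    | tmul α γ => simp

end Products

section Isomorphisms

variable {k : Type*} [Field k] {Q L : Type*}
  [NonUnitalRing Q] [Module k Q] [SMulCommClass k Q Q] [IsScalarTower k Q Q]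
  [NonUnitalRing L] [Module k L] [SMulCommClass k L L] [IsScalarTower k L L]
  {HQ : MultiplierHopfAlgebra k Q} {HL : MultiplierHopfAlgebra k L}
  {A B C D : Type*}
  [NonUnitalNonAssocRing A] [Module k A] [SMulCommClass k A A] [IsScalarTower k A A]
  [NonUnitalNonAssocRing B] [Module k B] [SMulCommClass k B B] [IsScalarTower k B B]
  [NonUnitalNonAssocRing C] [Module k C] [SMulCommClass k C C] [IsScalarTower k C C]
  [NonUnitalNonAssocRing D] [Module k D] [SMulCommClass k D D] [IsScalarTower k D D]

/-- On pure tensors the two twists of A ⊗ B reduce to the twist of `A` and the twist of `B`. The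
products of the two algebras then agree factor by factor up to reordering the legs. -/
theorem exists_diamondL_iso_twoSided (M : LeftModuleAlgebra HQ A) (N : RightModuleAlgebra HL B)
    (Γ : BicomoduleAlgebra HQ HL C) :
    ∃ Φ : DiamondL (tensorBimodule M N) Γ ≃ₗ[k] TwoSided M Γ N, IsAlgebraIso Φ ∧
      ∀ (a : A) (b : B) (c : C),
        Φ (WithProduct.of _ ((a ⊗ₜ b) ⊗ₜ c)) = WithProduct.of _ (a ⊗ₜ (c ⊗ₜ b)) := by
  let e : (A ⊗[k] B) ⊗[k] C ≃ₗ[k] A ⊗[k] (C ⊗[k] B) :=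
    TensorProduct.assoc k A B C ≪≫ₗ
      TensorProduct.congr (LinearEquiv.refl k A) (TensorProduct.comm k B C)
  refine ⟨_, isAlgebraIso_withProduct e fun x y => ?_, fun a b c => ?_⟩
  swap
  · simp [e]
  induction x using TensorProduct.induction_on with
  | zero => simp
  | add x y hx hy => simp only [map_add, LinearMap.add_apply, hx, hy]
  | tmul x c =>
  induction x using TensorProduct.induction_on with
  | zero => simp
  | add x y hx hy => simp only [map_add, TensorProduct.add_tmul, LinearMap.add_apply, hx, hy]
  | tmul a b =>
  induction y using TensorProduct.induction_on with
  | zero => simp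
  | add x y hx hy => simp only [map_add, hx, hy]
  | tmul y c' =>
  induction y using TensorProduct.induction_on with
  | zero => simp
  | add x y hx hy => simp only [map_add, TensorProduct.add_tmul, hx, hy]
  | tmul a' b' =>
  have h : ∀ (a : A) (b : B) (c : C), e ((a ⊗ₜ b) ⊗ₜ c) = a ⊗ₜ (c ⊗ₜ b) := fun a b c => by simp [e]
  rw [h, h, twoSidedProduct_tmul, lrProduct_tmul, rightTwist'_eq, swapTwist_tmul]
  have hL := leftTwist_tensorLeft (B := B) M Γ.left a' b' c
  have hR := rightTwist_tensorRight (A := A) N Γ.right a b c'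
  simp only [LinearMap.comp_apply, LinearEquiv.coe_coe, TensorProduct.comm_tmul, tensorBimodule,
    hL, hR]
  generalize rightTwist N Γ.right (c' ⊗ₜ b) = s
  generalize leftTwist M Γ.left (c ⊗ₜ a') = t
  induction s using TensorProduct.induction_on with
  | zero => simp
  | add x y hx hy => simp only [map_add, LinearMap.add_apply, TensorProduct.tmul_add, hx, hy]
  | tmul β γ' =>
  induction t using TensorProduct.induction_on with
  | zero => simp
  | add x y hx hy => simp only [map_add, TensorProduct.add_tmul, hx, hy]
  | tmul α γ => simp [h]

theorem exists_diamondR_iso_twoSided (M : LeftModuleAlgebra HQ A) (N : RightModuleAlgebra HL B)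
    (Γ : BicomoduleAlgebra HQ HL C) :
    ∃ Ψ : DiamondR Γ (tensorBimodule M N) ≃ₗ[k] TwoSided M Γ N, IsAlgebraIso Ψ ∧
      ∀ (a : A) (b : B) (c : C),
        Ψ (WithProduct.of _ (c ⊗ₜ (a ⊗ₜ b))) = WithProduct.of _ (a ⊗ₜ (c ⊗ₜ b)) := by
  refine ⟨_, isAlgebraIso_withProduct (TensorProduct.leftComm k C A B) fun x y => ?_,
    fun a b c => ?_⟩
  swap
  · simp
  induction x using TensorProduct.induction_on with
  | zero => simp
  | add x y hx hy => simp only [map_add, LinearMap.add_apply, hx, hy]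
  | tmul c x =>
  induction x using TensorProduct.induction_on with
  | zero => simp
  | add x y hx hy => simp only [map_add, TensorProduct.tmul_add, LinearMap.add_apply, hx, hy]
  | tmul a b =>
  induction y using TensorProduct.induction_on with
  | zero => simp
  | add x y hx hy => simp only [map_add, hx, hy]
  | tmul c' y =>
  induction y using TensorProduct.induction_on with
  | zero => simp
  | add x y hx hy => simp only [map_add, TensorProduct.tmul_add, hx, hy]
  | tmul a' b' =>
  rw [TensorProduct.leftComm_tmul, TensorProduct.leftComm_tmul, twoSidedProduct_tmul,
    lrProduct_tmul, rightTwist'_eq, rightTwist'_eq, swapTwist_tmul, swapTwist_tmul]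
  have hL := leftTwist_tensorLeft (B := B) M Γ.left a' b' c
  have hR := rightTwist_tensorRight (A := A) N Γ.right a b c'
  simp only [LinearMap.comp_apply, LinearEquiv.coe_coe, tensorBimodule, hL, hR]
  generalize rightTwist N Γ.right (c' ⊗ₜ b) = s
  generalize leftTwist M Γ.left (c ⊗ₜ a') = t
  induction s using TensorProduct.induction_on with
  | zero => simp
  | add x y hx hy => simp only [map_add, TensorProduct.tmul_add, hx, hy]
  | tmul β γ' =>
  induction t using TensorProduct.induction_on with
  | zero => simp
  | add x y hx hy => simp only [map_add, LinearMap.add_apply, TensorProduct.add_tmul, hx, hy]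
  | tmul α γ => simp

theorem exists_smashR_iso_twoSided {M : LeftModuleAlgebra HQ A} {Γ : BicomoduleAlgebra HQ HL C}
    {Υ' : RightComoduleAlgebra HL (SmashL M Γ.left)} (h : IsInducedRight M Γ.left Γ.right Υ')
    (N : RightModuleAlgebra HL B) :
    ∃ e : SmashR Υ' N ≃ₗ[k] TwoSided M Γ N, IsAlgebraIso e ∧
      ∀ (a : A) (c : C) (b : B),
        e (WithProduct.of _ (WithProduct.of _ (a ⊗ₜ c) ⊗ₜ b)) =
          WithProduct.of _ (a ⊗ₜ (c ⊗ₜ b)) := by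
  let e : SmashL M Γ.left ⊗[k] B ≃ₗ[k] A ⊗[k] (C ⊗[k] B) :=
    TensorProduct.congr (WithProduct.of _).symm (LinearEquiv.refl k B) ≪≫ₗ
      TensorProduct.assoc k A C B
  refine ⟨_, isAlgebraIso_withProduct e fun x y => ?_, fun a b c => ?_⟩
  swap
  · simp [e]
  have he : ∀ (x : A ⊗[k] C) (b : B), e (WithProduct.of _ x ⊗ₜ b) =
      TensorProduct.assoc k A C B (x ⊗ₜ b) := fun x b => by simp [e]
  induction x using TensorProduct.induction_on with
  | zero => simp
  | add x y hx hy => simp only [map_add, LinearMap.add_apply, hx, hy]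
  | tmul x b =>
  obtain ⟨x, rfl⟩ := (WithProduct.of _).surjective x
  induction x using TensorProduct.induction_on with
  | zero => simp
  | add x y hx hy => simp only [map_add, TensorProduct.add_tmul, LinearMap.add_apply, hx, hy]
  | tmul a c =>
  induction y using TensorProduct.induction_on with
  | zero => simp
  | add x y hx hy => simp only [map_add, hx, hy]
  | tmul y b' =>
  obtain ⟨y, rfl⟩ := (WithProduct.of _).surjective y
  induction y using TensorProduct.induction_on with
  | zero => simp
  | add x y hx hy => simp only [map_add, TensorProduct.add_tmul, hx, hy]
  | tmul a' c' =>
  rw [he, he, TensorProduct.assoc_tmul, TensorProduct.assoc_tmul, twoSidedProduct_tmul,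
    twistedProduct_tmul, rightTwist'_eq, rightTwist'_eq, swapTwist_tmul, swapTwist_tmul,
    rightTwist_of_isInducedRight h]
  generalize rightTwist N Γ.right (c' ⊗ₜ b) = s
  induction s using TensorProduct.induction_on with
  | zero => simp
  | add x y hx hy => simp only [map_add, TensorProduct.tmul_add, hx, hy]
  | tmul β γ' =>
  simp only [LinearMap.lTensor_tmul, LinearMap.comp_apply, TensorProduct.mk_apply,
    LinearEquiv.coe_coe, TensorProduct.comm_tmul, TensorProduct.map_tmul, LinearMap.mul_apply',
    smashL_mul_tmul, he]
  generalize leftTwist M Γ.left (c ⊗ₜ a') = t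
  induction t using TensorProduct.induction_on with
  | zero => simp
  | add x y hx hy => simp only [map_add, TensorProduct.add_tmul, hx, hy]
  | tmul α γ => simp

theorem exists_smashL_iso_twoSided {N : RightModuleAlgebra HL B} {Γ : BicomoduleAlgebra HQ HL C}
    {Γ' : LeftComoduleAlgebra HQ (SmashR Γ.right N)} (h : IsInducedLeft Γ.left Γ.right N Γ')
    (M : LeftModuleAlgebra HQ A) :
    ∃ e : SmashL M Γ' ≃ₗ[k] TwoSided M Γ N, IsAlgebraIso e ∧
      ∀ (a : A) (c : C) (b : B),
        e (WithProduct.of _ (a ⊗ₜ WithProduct.of _ (c ⊗ₜ b))) =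
          WithProduct.of _ (a ⊗ₜ (c ⊗ₜ b)) := by
  let e : A ⊗[k] SmashR Γ.right N ≃ₗ[k] A ⊗[k] (C ⊗[k] B) :=
    TensorProduct.congr (LinearEquiv.refl k A) (WithProduct.of _).symm
  refine ⟨_, isAlgebraIso_withProduct e fun x y => ?_, fun a b c => ?_⟩
  swap
  · simp [e]
  have he : ∀ (a : A) (x : C ⊗[k] B), e (a ⊗ₜ WithProduct.of _ x) = a ⊗ₜ x :=
    fun a x => by simp [e]
  induction x using TensorProduct.induction_on with
  | zero => simp
  | add x y hx hy => simp only [map_add, LinearMap.add_apply, hx, hy]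
  | tmul a x =>
  obtain ⟨x, rfl⟩ := (WithProduct.of _).surjective x
  induction x using TensorProduct.induction_on with
  | zero => simp
  | add x y hx hy => simp only [map_add, TensorProduct.tmul_add, LinearMap.add_apply, hx, hy]
  | tmul c b =>
  induction y using TensorProduct.induction_on with
  | zero => simp
  | add x y hx hy => simp only [map_add, hx, hy]
  | tmul a' y =>
  obtain ⟨y, rfl⟩ := (WithProduct.of _).surjective y
  induction y using TensorProduct.induction_on with
  | zero => simp
  | add x y hx hy => simp only [map_add, TensorProduct.tmul_add, hx, hy]
  | tmul c' b' =>
  rw [he, he, twoSidedProduct_tmul, twistedProduct_tmul, leftTwist_of_isInducedLeft h]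
  generalize leftTwist M Γ.left (c ⊗ₜ a') = s
  induction s using TensorProduct.induction_on with
  | zero => simp
  | add x y hx hy => simp only [map_add, TensorProduct.add_tmul, hx, hy]
  | tmul α γ =>
  simp only [LinearMap.lTensor_tmul, LinearMap.comp_apply, TensorProduct.mk_apply,
    LinearMap.flip_apply, LinearEquiv.coe_coe, TensorProduct.map_tmul, LinearMap.mul_apply',
    smashR_mul_tmul, he]
  generalize rightTwist' N Γ.right (b ⊗ₜ c') = t
  induction t using TensorProduct.induction_on with
  | zero => simp
  | add x y hx hy => simp only [map_add, TensorProduct.tmul_add, hx, hy]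
  | tmul γ' β => simp

/-- Transported from (A # C) # B, where it follows by applying associativity of twisted products
twice. -/
theorem twoSided_assoc (S : Antipode HQ) (hA : NondegenerateProduct A)
    (hA' : ∀ a b c : A, a * b * c = a * (b * c)) (hB' : ∀ a b c : B, a * b * c = a * (b * c))
    (M : LeftModuleAlgebra HQ A) (Γ : BicomoduleAlgebra HQ HL C) (N : RightModuleAlgebra HL B)
    (x y z : TwoSided M Γ N) : x * y * z = x * (y * z) := by
  obtain ⟨Υ', h⟩ := exists_isInducedRight S hA hA' M Γ
  obtain ⟨e, he, -⟩ := exists_smashR_iso_twoSided h N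
  apply e.symm.injective
  rw [he.symm, he.symm, he.symm, he.symm, smashR_assoc hB']

/-! ### The L-R-smash products and the generalized twisted smash products -/

/-- The isomorphism is d ⋆ c ↦ ∑ (d ◁ c₍₁₎) ⋄ c₀. It cancels the S⁻¹(c₍₁₎) in the generalized
twisted product and supplies the missing right twist. -/
theorem exists_starL_iso_diamondL (S : Antipode HL) (M : BimoduleAlgebra HQ HL D)
    (Γ : BicomoduleAlgebra HQ HL C) : ∃ e : StarL S M Γ ≃ₗ[k] DiamondL M Γ, IsAlgebraIso e := by
  let e : D ⊗[k] C ≃ₗ[k] D ⊗[k] C := TensorProduct.comm k D C ≪≫ₗ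
    LinearEquiv.ofBijective _ (rightTwist_bijective S M.right Γ.right)
  exact ⟨_, isAlgebraIso_withProduct e fun x y =>
    twistedProduct_lrProduct (rightTwist_rightTwistInv S M.right Γ.right)
      (rightTwist_twistsFst M.right Γ.right) (rightTwist_twistsSnd M.right Γ.right)
      (fun a a' b => Γ.twistsCommute M.left M.right b a' a)
      (fun b b' a => (leftTwist_isTwist M.left Γ.left).rightComm M.left.unital
        (rightTwist_isTwist M.right Γ.right) M.right.unital M.act_comm b b' a) x y⟩

/-- The mirror image: c ⋆ d ↦ ∑ c₀ ⋄ (c₍₋₁₎ ▷ d) is multiplicative, and its inverse is taken. The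
roles of the two twists are exchanged, with the left twist now the one being undone. -/
theorem exists_diamondR_iso_starR (S : Antipode HQ) (M : BimoduleAlgebra HQ HL D)
    (Γ : BicomoduleAlgebra HQ HL C) : ∃ e : DiamondR Γ M ≃ₗ[k] StarR S Γ M, IsAlgebraIso e := by
  let e : C ⊗[k] D ≃ₗ[k] C ⊗[k] D :=
    LinearEquiv.ofBijective _ (leftTwist_bijective S M.left Γ.left) ≪≫ₗ TensorProduct.comm k D C
  refine ⟨_, (isAlgebraIso_withProduct e fun x y => ?_).symm⟩
  have key := twistedProduct_lrProduct (R := rightTwist' M.right Γ.right)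
    (T := swapTwist (leftTwist M.left Γ.left)) (T' := swapTwist (leftTwistInv S M.left Γ.left))
    (swapTwist_comm_swapTwist (leftTwist_leftTwistInv S M.left Γ.left))
    (leftTwist_twistsSnd M.left Γ.left).swap (leftTwist_twistsFst M.left Γ.left).swap
    (fun a a' b => leftComm_swapTwist_of_rightComm
      ((rightTwist_isTwist M.right Γ.right).rightComm M.right.unital
        (leftTwist_isTwist M.left Γ.left) M.left.unital fun x y v => (M.act_comm y x v).symm)
      a' a b)
    (fun b b' a => (Γ.twistsCommute M.left M.right).symm.swap a b b') x y
  -- Adjacent flips cancel, which brings the mirrored twists into the form used in the definitions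
  -- of the two products.
  rw [← LinearMap.comp_assoc _ _ (swapTwist (leftTwistInv S M.left Γ.left)), swapTwist_comp_comm,
    swapTwist_comp_comm, LinearMap.comp_assoc] at key
  simp only [swapTwist_comm] at key
  exact key

theorem exists_diamondL_iso_diamondR (M : LeftModuleAlgebra HQ A) (N : RightModuleAlgebra HL B)
    (Γ : BicomoduleAlgebra HQ HL C) :
    ∃ e : DiamondL (tensorBimodule M N) Γ ≃ₗ[k] DiamondR Γ (tensorBimodule M N),
      IsAlgebraIso e := by
  obtain ⟨Φ, hΦ, -⟩ := exists_diamondL_iso_twoSided M N Γ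
  obtain ⟨Ψ, hΨ, -⟩ := exists_diamondR_iso_twoSided M N Γ
  exact ⟨_, hΦ.trans hΨ.symm⟩

end Isomorphisms

end

end MultHopf

theorem proposition3p1p2
    {k : Type*} [Field k]
    -- regular multiplier Hopf algebras `Q` and `L`
    {Q : Type*} [NonUnitalRing Q] [Module k Q] [SMulCommClass k Q Q] [IsScalarTower k Q Q]
    {L : Type*} [NonUnitalRing L] [Module k L] [SMulCommClass k L L] [IsScalarTower k L L]
    (HQ : MultiplierHopfAlgebra k Q) (hQ : HQ.IsRegular)
    (HL : MultiplierHopfAlgebra k L) (hL : HL.IsRegular)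
    -- algebras `A`, `B`, `C` with nondegenerate products
    {A : Type*} [NonUnitalRing A] [Module k A] [SMulCommClass k A A] [IsScalarTower k A A]
    {B : Type*} [NonUnitalRing B] [Module k B] [SMulCommClass k B B] [IsScalarTower k B B]
    {C : Type*} [NonUnitalRing C] [Module k C] [SMulCommClass k C C] [IsScalarTower k C C]
    (hA : NondegenerateProduct A) (hB : NondegenerateProduct B)
    (M : LeftModuleAlgebra HQ A) (N : RightModuleAlgebra HL B) (Γ : BicomoduleAlgebra HQ HL C) :
    -- the two-sided twisted tensor product is associative
    (∀ x y z : TwoSided M Γ N, x * y * z = x * (y * z)) ∧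
    -- (1)
    (∃ Φ : DiamondL (tensorBimodule M N) Γ ≃ₗ[k] TwoSided M Γ N, IsAlgebraIso Φ ∧
      ∀ (a : A) (b : B) (c : C),
        Φ (WithProduct.of _ ((a ⊗ₜ b) ⊗ₜ c)) = WithProduct.of _ (a ⊗ₜ (c ⊗ₜ b))) ∧
    -- (2)
    (∃ Ψ : DiamondR Γ (tensorBimodule M N) ≃ₗ[k] TwoSided M Γ N, IsAlgebraIso Ψ ∧
      ∀ (a : A) (b : B) (c : C),
        Ψ (WithProduct.of _ (c ⊗ₜ (a ⊗ₜ b))) = WithProduct.of _ (a ⊗ₜ (c ⊗ₜ b))) ∧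
    -- (3), with the antipodes of `Q` and `L`
    (Nonempty (Antipode HQ) ∧ Nonempty (Antipode HL) ∧
      ∀ (SQ : Antipode HQ) (SL : Antipode HL),
        (∃ e : StarL SL (tensorBimodule M N) Γ ≃ₗ[k] DiamondL (tensorBimodule M N) Γ,
          IsAlgebraIso e) ∧
        (∃ e : DiamondL (tensorBimodule M N) Γ ≃ₗ[k] DiamondR Γ (tensorBimodule M N),
          IsAlgebraIso e) ∧
        (∃ e : DiamondR Γ (tensorBimodule M N) ≃ₗ[k] StarR SQ Γ (tensorBimodule M N),
          IsAlgebraIso e)) ∧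
    -- (4), first algebra: `A #_l C` is a right `L`-comodule algebra with the induced coaction
    (∃ Υ' : RightComoduleAlgebra HL (SmashL M Γ.left), IsInducedRight M Γ.left Γ.right Υ' ∧
      ∃ e : SmashR Υ' N ≃ₗ[k] TwoSided M Γ N, IsAlgebraIso e ∧
        ∀ (a : A) (c : C) (b : B),
          e (WithProduct.of _ (WithProduct.of _ (a ⊗ₜ c) ⊗ₜ b)) =
            WithProduct.of _ (a ⊗ₜ (c ⊗ₜ b))) ∧
    -- (4), second algebra: `C #_r B` is a left `Q`-comodule algebra with the induced coaction
    (∃ Γ' : LeftComoduleAlgebra HQ (SmashR Γ.right N), IsInducedLeft Γ.left Γ.right N Γ' ∧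
      ∃ e : SmashL M Γ' ≃ₗ[k] TwoSided M Γ N, IsAlgebraIso e ∧
        ∀ (a : A) (c : C) (b : B),
          e (WithProduct.of _ (a ⊗ₜ WithProduct.of _ (c ⊗ₜ b))) =
            WithProduct.of _ (a ⊗ₜ (c ⊗ₜ b))) := by
  -- Regularity serves to provide these antipodes. They are used for associativity and the induced
  -- coactions, whereas (3) is proved for arbitrary antipodes.
  obtain ⟨SQ⟩ := hQ.nonempty_antipode
  obtain ⟨SL⟩ := hL.nonempty_antipode
  obtain ⟨Υ', hΥ'⟩ := exists_isInducedRight SQ hA mul_assoc M Γ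
  obtain ⟨Γ', hΓ'⟩ := exists_isInducedLeft SL hB mul_assoc N Γ
  exact ⟨twoSided_assoc SQ hA mul_assoc mul_assoc M Γ N,
    exists_diamondL_iso_twoSided M N Γ,
    exists_diamondR_iso_twoSided M N Γ,
    ⟨⟨SQ⟩, ⟨SL⟩, fun SQ SL =>
      ⟨exists_starL_iso_diamondL SL (tensorBimodule M N) Γ, exists_diamondL_iso_diamondR M N Γ,
        exists_diamondR_iso_starR SQ (tensorBimodule M N) Γ⟩⟩,
    ⟨Υ', hΥ', exists_smashR_iso_twoSided hΥ' N⟩,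
    ⟨Γ', hΓ', exists_smashL_iso_twoSided hΓ' M⟩⟩
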